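/- **Notation.** $I,X,Y,Z$ are the Pauli matrices, $[n]=\{1,\dots,n\}$. The *eight-qubit code* is the stabilizer code on $(\mathbb C^2)^{\otimes 8}$ with generators $g_1=XXXXXXXX$, $g_2=XZXZXZXZ$, $g_3=YYIIIIII$, $g_4=IIYYIIII$, $g_5=IIIIYYII$, $g_6=IIIIIIYY$; $\Pi$ is the orthogonal projection onto its code space (the common $+1$-eigenspace of the $g_j$), and $\Xi$ is the set of the $32$ elements of the stabilizer group of the form $(-1)^s\bigotimes_{i=1}^8 D^{(i)}$ with all $D^{(i)}\in\{X,Z\}$. $\mathcal P_{n,k}$ is the set of operators $\bigotimes_{v=1}^n D_v$ with $D_v\in\{I,X,Z\}$ of weight at most $k$ (the weight is the number of non-identity factors, the support is the set of their positions); $D_v$ also denotes the operator that acts as $D$ on qubit $v$ and trivially elsewhere. $\mathcal Q_{n,k}$ is the collection of all sets $Q\subseteq\mathcal P_{n,k}$ of $k$ pairwise commuting operators for which there is a set $J\subseteq[n]$ of $k$ qubits that contains the supports of all operators in $Q$. **The game.** Let $2\le k\le n$. In the $(n,k)$-stabilizer game a referee sends to each of eight players either some $P\in\mathcal P_{n,k}$,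 to be answered by one bit, or some $Q\in\mathcal Q_{n,k}$, to be answered by bits $(b_P)_{P\in Q}$. He performs one of the following four tests, each with probability $1/4$; all choices are uniform. 1. *Stabilizer check.* Choose $u\in[n]$ and $(-1)^s\bigotimes_i D^{(i)}\in\Xi$. Send $D^{(i)}_u$ to player $i$, receive $a^{(i)}$, and accept iff $\bigoplus_{i=1}^8a^{(i)}=s$. 2. *Confusion check.* Choose $J\subseteq[n]$ with $|J|=k$, $u\in J$, $t\in[8]$ and, independently for $v\in J$, elements $(-1)^{s_v}\bigotimes_i D^{(i)}_v$ of $\Xi$. Send $D_u^{(i)}$ to each player $i\ne t$ and receive $a^{(i)}$; send $\{D_v^{(t)}\}_{v\in J}$ to player $t$ and let $a^{(t)}$ be the answer bit for $D^{(t)}_u$. Accept iff $\bigoplus_i a^{(i)}=s_u$. 3. *Parity check.* Choose $P\in\mathcal P_{n,k}$ with support $J$, and $t\in[8]$; write $P=\prod_{v\in J}D_v$. Choose $J'\supseteq J$ with $|J'|=k$, and $D_v\in\{X_v,Z_v\}$ for $v\in J'\setminus J$. Send $P$ to player $t$ and receive $a^{(t)}$; send $\{D_v\}_{v\in J'}$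 to each player $i\neq t$, receive $(a^{(i)}_v)_{v\in J'}$ and put $a^{(i)}=\bigoplus_{v\in J}a^{(i)}_v$. Accept iff $\bigoplus_i a^{(i)}=0$. 4. *Pauli check.* Choose $Q\in\mathcal Q_{n,k}$, $P\in Q$, $t\in[8]$. Send $P$ to each player $i\ne t$ and receive $a^{(i)}$; send $Q$ to player $t$ and let $a^{(t)}$ be the answer bit for $P$. Accept iff $\bigoplus_i a^{(i)}=0$. **Strategies and distances.** A strategy consists of finite-dimensional Hilbert spaces $\mathcal R_1,\dots,\mathcal R_8$, a density operator $\rho$ on $\bigotimes_i\mathcal R_i$ and, for each player $i$, a reflection $\hat P^{(i)}$ on $\mathcal R_i$ (Hermitian, with square $1$) for each $P\in\mathcal P_{n,k}$ and a POVM $\hat Q^{(i)}=\{\hat Q^{(i),b}\}_{b\in\{0,1\}^Q}$ on $\mathcal R_i$ for each $Q\in\mathcal Q_{n,k}$; on question $P$ player $i$ measures $\{(1+(-1)^a\hat P^{(i)})/2\}_{a\in\{0,1\}}$, on question $Q$ he measures $\hat Q^{(i)}$. The value of the strategy is the probability that the referee accepts. For an operator $A$ on $\mathcal R_i$ put $\operatorname{tr}_\rho(A)=\operatorname{tr}((A\otimes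 1)\rho)$. For Hermitian contractions $R_0,R_1$ on $\mathcal R_i$ put $d_\rho(R_0,R_1)=[1-\operatorname{Re}\operatorname{tr}_\rho(R_0R_1)]^{1/2}$. For POVMs $M_0,M_1$ on $\mathcal R_i$ with the same outcomes put $$d_\rho(M_0,M_1)=\inf\Bigl[\sum_a\operatorname{tr}_\rho\bigl((N_0^a-N_1^a)^*(N_0^a-N_1^a)\bigr)\Bigr]^{1/2},$$ the infimum over all families of operators $N_j^a$ from $\mathcal R_i$ to a common finite-dimensional Hilbert space with $M_j^a=(N_j^a)^*N_j^a$. **Theorem.** For every integer $k\ge2$ there are constants $\kappa>0$ and $C>0$, depending only on $k$, such that for every $n\ge k$, every $\epsilon\ge0$ and every strategy for the $(n,k)$-stabilizer game with value at least $1-\epsilon$ there are finite-dimensional Hilbert spaces $\mathcal R_i'$ and isometries $V_i:\mathcal R_i\to(\mathbb C^2)^{\otimes n}\otimes\mathcal R_i'$, $i\in[8]$, with the following properties. * For all $i\in[8]$, $P\in\mathcal P_{n,k}$ and $Q\in\mathcal Q_{n,k}$, $$d_\rho\bigl(\hat P^{(i)},\check P^{(i)}\bigr)\le C\,n^\kappa\epsilon^{1/\kappa},\qquad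 d_\rho\bigl(\hat Q^{(i)},\check Q^{(i)}\bigr)\le C\,n^\kappa\epsilon^{1/\kappa},$$ where $\check P^{(i)}=V_i^*(P\otimes 1)V_i$, and $\check Q^{(i)}$ is the POVM that applies $V_i$ and then measures all operators of $Q$, that is, $\check Q^{(i),b}=V_i^*\bigl(\prod_{P\in Q}\tfrac{1+(-1)^{b_P}P}{2}\otimes 1\bigr)V_i$. * With $V=\bigotimes_{i=1}^8V_i$, $$\operatorname{tr}\bigl((\Pi^{\otimes n}\otimes 1)\,V\rho V^*\bigr)\ge 1-C\,n^\kappa\epsilon^{1/\kappa},$$ where the $t$-th factor of $\Pi^{\otimes n}$ acts on the eight qubits consisting of the $t$-th qubit of each player. -/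

import Mathlib

open scoped BigOperators Matrix ComplexOrder

noncomputable section

namespace StabGame

/-! ### Pauli operators and tensor products -/

/-- The four single-qubit Pauli labels. -/
inductive Pauli
  | I | X | Y | Z
  deriving DecidableEq

instance : Fintype Pauli :=
  ⟨{.I, .X, .Y, .Z}, fun P => by cases P <;> decide⟩

/-- The Pauli matrices. -/
def Pauli.mat : Pauli → Matrix (Fin 2) (Fin 2) ℂ
  | .I => 1
  | .X => !![0, 1; 1, 0]
  | .Y => !![0, -Complex.I; Complex.I, 0]
  | .Z => !![1, 0; 0, -1]

/-- The tensor product of a finite family of (possibly rectangular) matrices. -/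
def tensor {ι : Type*} [Fintype ι] {a b : ι → Type*} (A : ∀ i, Matrix (a i) (b i) ℂ) :
    Matrix (∀ i, a i) (∀ i, b i) ℂ :=
  Matrix.of fun x y => ∏ i, A i (x i) (y i)

/-- The operator `⨂ i, P i` on the qubits indexed by `ι`. -/
def pauliOp {ι : Type*} [Fintype ι] (P : ι → Pauli) : Matrix (ι → Fin 2) (ι → Fin 2) ℂ :=
  tensor fun i => (P i).mat

/-- The qubits on which a Pauli string acts nontrivially; its cardinality is the weight. -/
def supp {ι : Type*} [Fintype ι] (P : ι → Pauli) : Finset ι :=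
  Finset.univ.filter fun i => P i ≠ .I

/-- `(-1)^s` for a bit `s`. -/
def sgn (s : ZMod 2) : ℂ := (-1) ^ s.val

theorem mem_supp {ι : Type*} [Fintype ι] {P : ι → Pauli} {i : ι} :
    i ∈ supp P ↔ P i ≠ .I := by
  simp [supp]

theorem tensor_mul {ι : Type*} [Fintype ι] [DecidableEq ι] {a b c : ι → Type*}
    [∀ i, Fintype (b i)]
    (A : ∀ i, Matrix (a i) (b i) ℂ) (B : ∀ i, Matrix (b i) (c i) ℂ) :
    tensor A * tensor B = tensor fun i => A i * B i := by
  ext x y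
  simp only [tensor, Matrix.mul_apply, Matrix.of_apply, ← Finset.prod_mul_distrib]
  exact (Fintype.prod_sum fun i j => A i (x i) j * B i j (y i)).symm

theorem pauliOp_commute {ι : Type*} [Fintype ι] [DecidableEq ι] {P P' : ι → Pauli}
    (h : ∀ i, P i = P' i ∨ P i = .I ∨ P' i = .I) : Commute (pauliOp P) (pauliOp P') := by
  unfold Commute SemiconjBy pauliOp
  rw [tensor_mul, tensor_mul]
  congr 1
  funext i
  rcases h i with h | h | h <;> simp [h, Pauli.mat]

/-! ### The eight-qubit code -/

open Pauli in
/-- The generators `g₁, …, g₆` of the stabilizer of the eight-qubit code. -/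
def gen : Fin 6 → Fin 8 → Pauli :=
  ![![X, X, X, X, X, X, X, X],
    ![X, Z, X, Z, X, Z, X, Z],
    ![Y, Y, I, I, I, I, I, I],
    ![I, I, Y, Y, I, I, I, I],
    ![I, I, I, I, Y, Y, I, I],
    ![I, I, I, I, I, I, Y, Y]]

/-- The stabilizer of the code. The generators are commuting involutions, so the submonoid
that they generate is a group. -/
def stabilizer : Submonoid (Matrix (Fin 8 → Fin 2) (Fin 8 → Fin 2) ℂ) :=
  Submonoid.closure (Set.range fun j => pauliOp (gen j))

/-- The set `Ξ` of the stabilizer elements `(-1)^s D⁽¹⁾ ⊗ ⋯ ⊗ D⁽⁸⁾` with all `D⁽ⁱ⁾ ∈ {X, Z}`,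
given by their sign bit `s` and their tensor factors. -/
abbrev Xi : Type :=
  {ξ : ZMod 2 × (Fin 8 → Pauli) //
    (∀ i, ξ.2 i = .X ∨ ξ.2 i = .Z) ∧ sgn ξ.1 • pauliOp ξ.2 ∈ stabilizer}

instance : Fintype Xi := Fintype.ofFinite _

theorem Xi.ne_Y (ξ : Xi) (i : Fin 8) : ξ.1.2 i ≠ .Y := by
  rcases ξ.2.1 i with h | h <;> simp [h]

theorem Xi.ne_I (ξ : Xi) (i : Fin 8) : ξ.1.2 i ≠ .I := by
  rcases ξ.2.1 i with h | h <;> simp [h]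

/-- The code space: the simultaneous `+1` eigenspace of the stabilizer. -/
def codeSpace : Submodule ℂ (EuclideanSpace ℂ (Fin 8 → Fin 2)) :=
  ⨅ j, Module.End.eigenspace (Matrix.toEuclideanLin (pauliOp (gen j))) 1

/-- The matrix of the orthogonal projection onto the code space. -/
def codeProj : Matrix (Fin 8 → Fin 2) (Fin 8 → Fin 2) ℂ :=
  Matrix.toEuclideanLin.symm (codeSpace.starProjection : _ →ₗ[ℂ] _)

/-! ### Questions and answers -/

/-- The `XZ`-form Pauli operators on `n` qubits of weight at most `k`. -/
abbrev XZPauli (n k : ℕ) : Type :=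
  {P : Fin n → Pauli // (∀ v, P v ≠ .Y) ∧ (supp P).card ≤ k}

/-- The sets of `k` pairwise commuting elements of `XZPauli n k` which all act on one common set
of `k` qubits. -/
abbrev PauliSet (n k : ℕ) : Type :=
  {Q : Finset (XZPauli n k) // Q.card = k ∧
    (∀ P ∈ Q, ∀ P' ∈ Q, Commute (pauliOp P.1) (pauliOp P'.1)) ∧
    ∃ J : Finset (Fin n), J.card = k ∧ ∀ P ∈ Q, supp P.1 ⊆ J}

instance (n k : ℕ) : Fintype (PauliSet n k) := Fintype.ofFinite _

/-- A question to a player: one Pauli operator, or a set of commuting Pauli operators. -/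
inductive Question (n k : ℕ)
  | single (P : XZPauli n k)
  | multi (Q : PauliSet n k)

/-- The answers: one bit, or one bit for each Pauli operator of the set. -/
def Answer {n k : ℕ} : Question n k → Type
  | .single _ => ZMod 2
  | .multi Q => {P // P ∈ Q.1} → ZMod 2

instance {n k : ℕ} (q : Question n k) : Fintype (Answer q) :=
  match q with
  | .single _ => inferInstanceAs (Fintype (ZMod 2))
  | .multi Q => inferInstanceAs (Fintype ({P // P ∈ Q.1} → ZMod 2))

/-! ### Strategies -/

/-- A quantum strategy for the eight players: a state `ρ` on `⨂ i, ℂ^(d i)`, a reflection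
`R i P` for each question `P` and a POVM `M i Q` for each question `Q`. -/
structure Strategy (n k : ℕ) (d : Fin 8 → ℕ) where
  ρ : Matrix (∀ i, Fin (d i)) (∀ i, Fin (d i)) ℂ
  ρ_pos : ρ.PosSemidef
  ρ_trace : ρ.trace = 1
  R : ∀ i : Fin 8, XZPauli n k → Matrix (Fin (d i)) (Fin (d i)) ℂ
  R_herm : ∀ i P, (R i P).IsHermitian
  R_sq : ∀ i P, R i P * R i P = 1
  M : ∀ (i : Fin 8) (Q : PauliSet n k), ({P // P ∈ Q.1} → ZMod 2) →
    Matrix (Fin (d i)) (Fin (d i)) ℂ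
  M_pos : ∀ i Q b, (M i Q b).PosSemidef
  M_sum : ∀ i Q, ∑ b, M i Q b = 1

/-- The measurement operator `(1 + (-1)^a R) / 2` of a reflection. -/
def half {m : Type*} [DecidableEq m] (R : Matrix m m ℂ) (a : ZMod 2) : Matrix m m ℂ :=
  (1 / 2 : ℂ) • (1 + sgn a • R)

/-- The measurement operators of player `i` on a question. -/
def Strategy.meas {n k : ℕ} {d : Fin 8 → ℕ} (S : Strategy n k d) (i : Fin 8) :
    (q : Question n k) → Answer q → Matrix (Fin (d i)) (Fin (d i)) ℂ
  | .single P => fun a : ZMod 2 => half (S.R i P) a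
  | .multi Q => fun b : {P // P ∈ Q.1} → ZMod 2 => S.M i Q b

/-! ### The game -/

/-- What the referee does with one player: he sends the question `q` and condenses the answer to
one bit by `bit`. -/
structure Query (n k : ℕ) where
  q : Question n k
  bit : Answer q → ZMod 2

/-- The probability that the eight condensed bits have parity `s`. -/
def Strategy.acceptProb {n k : ℕ} {d : Fin 8 → ℕ} (S : Strategy n k d)
    (w : Fin 8 → Query n k) (s : ZMod 2) : ℝ :=
  ∑ a : ∀ i, Answer (w i).q,
    if ∑ i, (w i).bit (a i) = s then
      ((tensor fun i => S.meas i (w i).q (a i)) * S.ρ).trace.re else 0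

/-- Send `P`; the bit is the answer. -/
def Query.ask {n k : ℕ} (P : XZPauli n k) : Query n k :=
  ⟨.single P, fun a : ZMod 2 => a⟩

/-- Send `Q`; the bit is the exclusive or of the answers for the operators `f j`, `j ∈ J`. -/
def Query.parity {n k : ℕ} {J : Type*} [Fintype J] (Q : PauliSet n k) (f : J → {P // P ∈ Q.1}) :
    Query n k :=
  ⟨.multi Q, fun b : {P // P ∈ Q.1} → ZMod 2 => ∑ j, b (f j)⟩

/-- Send `Q`; the bit is the answer for `P ∈ Q`. -/
def Query.askIn {n k : ℕ} (Q : PauliSet n k) (P : {P // P ∈ Q.1}) : Query n k :=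
  ⟨.multi Q, fun b : {P // P ∈ Q.1} → ZMod 2 => b P⟩

/-- The Pauli string with letter `D` at `v` and identities elsewhere. -/
def at1 {n : ℕ} (v : Fin n) (D : Pauli) : Fin n → Pauli :=
  fun w => if w = v then D else .I

theorem supp_at1 {n : ℕ} (v : Fin n) (D : Pauli) : supp (at1 v D) ⊆ {v} := by
  intro w hw
  rw [mem_supp] at hw
  by_contra h
  exact hw (if_neg (by simpa using h))

/-- The weight-one operator `D_v`. -/
def weightOne {n k : ℕ} (hk : 2 ≤ k) (v : Fin n) (D : Pauli) (hD : D ≠ .Y) : XZPauli n k :=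
  ⟨at1 v D, fun w => by unfold at1; split_ifs <;> simp [hD],
    ((Finset.card_le_card (supp_at1 v D)).trans (by simp)).trans (by omega : 1 ≤ k)⟩

/-- The `XZ`-form strings of weight exactly `k`. Such a string `F` is the same as a set `J`
(its support) of `k` qubits with a letter in `{X, Z}` for each of them. -/
abbrev FullString (n k : ℕ) : Type :=
  {F : Fin n → Pauli // (∀ v, F v ≠ .Y) ∧ (supp F).card = k}

/-- The factor of `F` at the qubit `v`, as a weight-one operator. -/
def FullString.factor {n k : ℕ} (hk : 2 ≤ k) (F : FullString n k) (v : Fin n) : XZPauli n k :=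
  weightOne hk v (F.1 v) (F.2.1 v)

theorem FullString.factor_injOn {n k : ℕ} (hk : 2 ≤ k) (F : FullString n k) :
    Set.InjOn (F.factor hk) (supp F.1) := by
  intro v hv w _ h
  by_contra hne
  have h1 := congrFun (congrArg Subtype.val h) v
  simp only [FullString.factor, weightOne, at1, if_true, if_neg hne] at h1
  exact mem_supp.1 hv h1

/-- The question `{D_v}_{v ∈ J}` made of the factors of `F`. -/
def FullString.split {n k : ℕ} (hk : 2 ≤ k) (F : FullString n k) : PauliSet n k :=
  ⟨(supp F.1).image (F.factor hk), by
    refine ⟨(Finset.card_image_of_injOn (F.factor_injOn hk)).trans F.2.2, ?_,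
      supp F.1, F.2.2, ?_⟩
    · intro P hP P' hP'
      obtain ⟨v, _, rfl⟩ := Finset.mem_image.1 hP
      obtain ⟨w, _, rfl⟩ := Finset.mem_image.1 hP'
      refine pauliOp_commute fun x => ?_
      simp only [FullString.factor, weightOne, at1]
      split_ifs with h1 h2
      · left; rw [← h1, ← h2]
      all_goals simp
    · intro P hP
      obtain ⟨v, hv, rfl⟩ := Finset.mem_image.1 hP
      exact (supp_at1 v _).trans (by simpa using hv)⟩

/-- The element `D_v` of the question `F.split`. -/
def FullString.elem {n k : ℕ} (hk : 2 ≤ k) (F : FullString n k) (v : Fin n) (hv : v ∈ supp F.1) :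
    {P // P ∈ (F.split hk).1} :=
  ⟨F.factor hk v, Finset.mem_image_of_mem _ hv⟩

/-- Stabilizer check: the stabilizer game on a random qubit `u`. -/
def Strategy.stabCheck {n k : ℕ} {d : Fin 8 → ℕ} (hk : 2 ≤ k) (S : Strategy n k d) : ℝ :=
  𝔼 u : Fin n, 𝔼 ξ : Xi,
    S.acceptProb (fun i => Query.ask (weightOne hk u (ξ.1.2 i) (ξ.ne_Y i))) ξ.1.1

/-- The letters that player `t` receives in the confusion check on the qubits in `J`. -/
def confString {n k : ℕ} (J : {J : Finset (Fin n) // J.card = k}) (ξ : {v // v ∈ J.1} → Xi)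
    (t : Fin 8) : FullString n k :=
  ⟨fun v => if h : v ∈ J.1 then (ξ ⟨v, h⟩).1.2 t else .I, by
    constructor
    · intro v
      beta_reduce
      split_ifs with h
      · exact (ξ ⟨v, h⟩).ne_Y t
      · simp
    · refine (congrArg Finset.card ?_).trans J.2
      ext v
      rw [mem_supp]
      split_ifs with h
      · simp [h, (ξ ⟨v, h⟩).ne_I t]
      · simp [h]⟩

theorem mem_supp_confString {n k : ℕ} (J : {J : Finset (Fin n) // J.card = k})
    (ξ : {v // v ∈ J.1} → Xi) (t : Fin 8) (u : {v // v ∈ J.1}) :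
    u.1 ∈ supp (confString J ξ t).1 := by
  rw [mem_supp]
  simp only [confString, dif_pos u.2]
  exact (ξ _).ne_I t

/-- Confusion check: the stabilizer game on the qubit `u`, which is hidden in `J` from player
`t`. The samples `ξ v` for `v ∈ J` are independent. -/
def Strategy.confCheck {n k : ℕ} {d : Fin 8 → ℕ} (hk : 2 ≤ k) (S : Strategy n k d) : ℝ :=
  𝔼 J : {J : Finset (Fin n) // J.card = k}, 𝔼 u : {v // v ∈ J.1}, 𝔼 t : Fin 8,
    𝔼 ξ : {v // v ∈ J.1} → Xi,
      S.acceptProb (fun i =>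
        if i = t then
          Query.askIn ((confString J ξ t).split hk)
            ((confString J ξ t).elem hk u.1 (mem_supp_confString J ξ t u))
        else Query.ask (weightOne hk u.1 ((ξ u).1.2 i) ((ξ u).ne_Y i)))
      (ξ u).1.1

/-- The full strings that extend `P`. A uniformly random extension amounts to a uniformly random
set `J'` of `k` qubits that contains the support of `P`, with uniformly random letters in
`{X, Z}` on the rest of `J'`. -/
abbrev Extension {n k : ℕ} (P : XZPauli n k) : Type :=
  {F : FullString n k // ∀ v ∈ supp P.1, F.1 v = P.1 v}

theorem Extension.mem_supp {n k : ℕ} {P : XZPauli n k} (F : Extension P)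
    (v : {v // v ∈ supp P.1}) : v.1 ∈ supp F.1.1 := by
  rw [StabGame.mem_supp, F.2 v.1 v.2]
  exact StabGame.mem_supp.1 v.2

/-- Parity check: `P` for player `t` against the single-qubit factors for the others. -/
def Strategy.parityCheck {n k : ℕ} {d : Fin 8 → ℕ} (hk : 2 ≤ k) (S : Strategy n k d) : ℝ :=
  𝔼 P : XZPauli n k, 𝔼 t : Fin 8, 𝔼 F : Extension P,
    S.acceptProb (fun i =>
      if i = t then Query.ask P
      else Query.parity (F.1.split hk) fun v : {v // v ∈ supp P.1} =>
        F.1.elem hk v.1 (F.mem_supp v))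
    0

/-- Pauli check: `Q` for player `t` against `P ∈ Q` for the others. -/
def Strategy.pauliCheck {n k : ℕ} {d : Fin 8 → ℕ} (S : Strategy n k d) : ℝ :=
  𝔼 Q : PauliSet n k, 𝔼 P : {P // P ∈ Q.1}, 𝔼 t : Fin 8,
    S.acceptProb (fun i => if i = t then Query.askIn Q P else Query.ask P.1) 0

/-- The value of a strategy in the `(n, k)`-stabilizer game. -/
def Strategy.value {n k : ℕ} {d : Fin 8 → ℕ} (hk : 2 ≤ k) (S : Strategy n k d) : ℝ :=
  (S.stabCheck hk + S.confCheck hk + S.parityCheck hk + S.pauliCheck) / 4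

/-! ### State-dependent distances -/

/-- `tr_ρ A` for an operator `A` on the system of player `i`. -/
def localTr {d : Fin 8 → ℕ} (ρ : Matrix (∀ i, Fin (d i)) (∀ i, Fin (d i)) ℂ) (i : Fin 8)
    (A : Matrix (Fin (d i)) (Fin (d i)) ℂ) : ℂ :=
  (tensor (Function.update (fun j => (1 : Matrix (Fin (d j)) (Fin (d j)) ℂ)) i A) * ρ).trace

/-- The distance `[1 - Re tr_ρ (R₀ R₁)]^{1/2}`. -/
def reflDist {d : Fin 8 → ℕ} (ρ : Matrix (∀ i, Fin (d i)) (∀ i, Fin (d i)) ℂ) (i : Fin 8)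
    (R₀ R₁ : Matrix (Fin (d i)) (Fin (d i)) ℂ) : ℝ :=
  Real.sqrt (1 - (localTr ρ i (R₀ * R₁)).re)

/-- The distance of two POVMs: the infimum of `[∑ₐ ‖N₀ᵃ - N₁ᵃ‖_ρ²]^{1/2}` over all measurement
operators with `M_jᵃ = (N_jᵃ)ᴴ N_jᵃ`. -/
def povmDist {d : Fin 8 → ℕ} (ρ : Matrix (∀ i, Fin (d i)) (∀ i, Fin (d i)) ℂ) (i : Fin 8)
    {α : Type*} [Fintype α] (M₀ M₁ : α → Matrix (Fin (d i)) (Fin (d i)) ℂ) : ℝ :=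
  sInf {δ : ℝ | ∃ (m : ℕ) (N₀ N₁ : α → Matrix (Fin m) (Fin (d i)) ℂ),
    (∀ a, (N₀ a)ᴴ * N₀ a = M₀ a) ∧ (∀ a, (N₁ a)ᴴ * N₁ a = M₁ a) ∧
    δ = Real.sqrt (∑ a, (localTr ρ i ((N₀ a - N₁ a)ᴴ * (N₀ a - N₁ a))).re)}

/-! ### Honest operators behind isometries -/

/-- `Vᴴ (A ⊗ 1) V` for an operator `A` on the first tensor factor. -/
def pullback {m b r : Type*} [Fintype b] [Fintype r] [DecidableEq r]
    (V : Matrix (b × r) m ℂ) (A : Matrix b b ℂ) : Matrix m m ℂ :=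
  Vᴴ * Matrix.kronecker A (1 : Matrix r r ℂ) * V

theorem half_commute {m : Type*} [Fintype m] [DecidableEq m] {A B : Matrix m m ℂ}
    (h : Commute A B) (a b : ZMod 2) : Commute (half A a) (half B b) := by
  unfold half
  exact (((Commute.one_left _).add_left
    ((Commute.one_right _).add_right (h.smul_right _) |>.smul_left _)).smul_left _).smul_right _

/-- The projection for the outcome `b` when all operators in `Q` are measured. -/
def jointProj {n k : ℕ} (Q : PauliSet n k) (b : {P // P ∈ Q.1} → ZMod 2) :
    Matrix (Fin n → Fin 2) (Fin n → Fin 2) ℂ :=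
  (Finset.univ : Finset {P // P ∈ Q.1}).noncommProd (fun P => half (pauliOp P.1.1) (b P))
    fun P _ P' _ _ => half_commute (Q.2.2.1 P.1 P.2 P'.1 P'.2) _ _

/-- `Π^{⊗ n} ⊗ 1`, where the `t`-th factor acts on the `t`-th qubits of the eight players. -/
def codeProjN (n : ℕ) (r : Fin 8 → ℕ) :
    Matrix (∀ i, (Fin n → Fin 2) × Fin (r i)) (∀ i, (Fin n → Fin 2) × Fin (r i)) ℂ :=
  Matrix.of fun x y =>
    (∏ t, codeProj (fun i => (x i).1 t) (fun i => (y i).1 t)) *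
      if ∀ i, (x i).2 = (y i).2 then 1 else 0

end StabGame

end

open StabGame

noncomputable section

namespace StabGame

open scoped Matrix.Norms.Frobenius

set_option linter.unusedSectionVars false

/-! ### Frobenius norm and contractions -/

/-! Write `ρ = ψ ψᴴ` and regard `ψ` as a matrix of Frobenius norm one. For each player, `reshape i
ψ` is a matrix whose rows belong to player `i` and whose columns belong to everybody else, so
operators of player `i` multiply from the left and those of the others from the right. Every
estimate has the form `‖A * Ψ - B * Ψ‖ ≤ δ`, which survives left multiplication by contractions. It
survives right multiplication by `C` as soon as `C * Ψ` is close to `Ψ * T` for a contraction `T`,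
because `T` can be pulled out on the right; this is `Mov` with `Mov.subst`. With it approximate
identities can be used inside products (`norm_list_prod_intertwine`).

The number of questions is polynomial in `n` for fixed `k`, so a value near one forces every single
question to be answered with small bias defect (`Strategy.allNear_of_value`). A small defect means
that player `t`'s dilated observable acts on `ψ` like the product of the others' observables
(`norm_dilated_sub_le`).

The stabilizer check makes the reflections of player `i` for `X_u` and `Z_u` anticommute
approximately: their two products can be moved to the other players along two pairs of elements of
`Ξ`, where they become the same operator with opposite signs (`exists_xi_anticommute`,
`Strategy.AllNear.anti`). The confusion check makes reflections on different qubits commute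
approximately, since both are modelled by commuting block signs in one dilated measurement
(`conf_local`, `Strategy.AllNear.comm`).

Reflections with these relations yield `n` qubits. For each Pauli string `g` take the ordered
product of the letter operators, and let the isometry `extract` superpose these words over the Bell
basis labelled by `g`. A Pauli operator on the first Bell half permutes the labels up to a phase,
and in the words this amounts to right multiplication by the player's operator, with an error of
order `n² δ` (`ApproxPauli.extract`).

Parity check and Pauli check carry this to higher weight: `P` acts like the product of its factors
(`reflection_local`), and the block signs of the measurement of `Q` act like the reflections for its
elements (`pauli_local`). Products of the corresponding spectral projections compare the two POVMs
(`povm_extract`). Finally, elements of `Ξ` almost fix the extracted state by the stabilizer check;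
products of them give all generators, and the code projection is the product of the generators' `+1`
projections (`code_extract`). Here a square root is taken a second time, which leads to a fourth
root of `ε`. -/

theorem frobenius_norm_sq {a b : Type*} [Fintype a] [Fintype b] (A : Matrix a b ℂ) :
    ‖A‖ ^ 2 = (Aᴴ * A).trace.re := by
  rw [Matrix.frobenius_norm_def, ← Real.rpow_natCast, ← Real.rpow_mul (by positivity)]
  norm_num
  rw [Matrix.trace, Finset.sum_comm, Complex.re_sum]
  refine Finset.sum_congr rfl fun j _ => ?_
  simp [Matrix.mul_apply, Complex.sq_norm, Complex.normSq_apply]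

theorem trace_conjTranspose_mul_re_comm {a b : Type*} [Fintype a] [Fintype b]
    (A B : Matrix a b ℂ) : (Aᴴ * B).trace.re = (Bᴴ * A).trace.re := by
  have h : (Aᴴ * B).trace = star (Bᴴ * A).trace := by
    rw [← Matrix.trace_conjTranspose, Matrix.conjTranspose_mul, Matrix.conjTranspose_conjTranspose]
  rw [h]; simp

theorem frobenius_norm_sub_sq {a b : Type*} [Fintype a] [Fintype b] (A B : Matrix a b ℂ) :
    ‖A - B‖ ^ 2 = ‖A‖ ^ 2 + ‖B‖ ^ 2 - 2 * (Aᴴ * B).trace.re := by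
  simp only [frobenius_norm_sq, Matrix.conjTranspose_sub, Matrix.sub_mul, Matrix.mul_sub,
    Matrix.trace_sub, Complex.sub_re]
  rw [trace_conjTranspose_mul_re_comm B A]
  ring

/-- This converts correlations into state-dependent closeness; each use costs a square root. -/
theorem norm_sub_le_of_trace {a b : Type*} [Fintype a] [Fintype b] {A B : Matrix a b ℂ} {η : ℝ}
    (hA : ‖A‖ ≤ 1) (hB : ‖B‖ ≤ 1) (h : 1 - η ≤ (Aᴴ * B).trace.re) :
    ‖A - B‖ ≤ Real.sqrt (2 * η) := by
  apply Real.le_sqrt_of_sq_le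
  rw [frobenius_norm_sub_sq]
  nlinarith [norm_nonneg A, norm_nonneg B]

/-- Cauchy–Schwarz, read off from the triangle inequality for `A - (-B)`. -/
theorem trace_conjTranspose_mul_re_le {a b : Type*} [Fintype a] [Fintype b]
    (A B : Matrix a b ℂ) : (Aᴴ * B).trace.re ≤ ‖A‖ * ‖B‖ := by
  have h := frobenius_norm_sub_sq A (-B)
  have h1 : ‖A - -B‖ ≤ ‖A‖ + ‖B‖ := by simpa using norm_add_le A B
  have h2 : ‖A - -B‖ ^ 2 ≤ (‖A‖ + ‖B‖) ^ 2 := by gcongr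
  simp only [Matrix.mul_neg, Matrix.trace_neg, Complex.neg_re, norm_neg] at h
  nlinarith

theorem trace_ge_of_norm_sub {a b : Type*} [Fintype a] [Fintype b] {A B : Matrix a b ℂ} {η : ℝ}
    (hA : ‖A‖ = 1) (h : ‖B - A‖ ≤ η) : 1 - η ≤ (Bᴴ * A).trace.re := by
  have h1 := trace_conjTranspose_mul_re_le (A - B) A
  have h2 := frobenius_norm_sq A
  rw [Matrix.conjTranspose_sub, Matrix.sub_mul, Matrix.trace_sub, Complex.sub_re, ← h2, hA,
    norm_sub_rev] at h1
  linarith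

theorem exists_conjTranspose_mul_self {a : Type*} [Fintype a] [DecidableEq a] {A : Matrix a a ℂ}
    (hA : A.PosSemidef) : ∃ B : Matrix a a ℂ, Bᴴ * B = A := by
  open scoped MatrixOrder in
  obtain ⟨B, rfl⟩ := CStarAlgebra.nonneg_iff_eq_star_mul_self.mp hA.nonneg
  exact ⟨B, rfl⟩

/-- A matrix that does not increase the Euclidean norm. -/
def Contr {a b : Type*} [Fintype a] [DecidableEq b] (A : Matrix a b ℂ) : Prop :=
  (1 - Aᴴ * A).PosSemidef

section Contr

variable {a b c : Type*} [Fintype a] [Fintype b] [Fintype c]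

theorem Contr.norm_mul_le [DecidableEq b] {A : Matrix a b ℂ} (hA : Contr A) (M : Matrix b c ℂ) :
    ‖A * M‖ ≤ ‖M‖ := by
  have h := (hA.conjTranspose_mul_mul_same M).trace_nonneg
  rw [Matrix.mul_sub, Matrix.sub_mul, Matrix.trace_sub, Matrix.mul_one] at h
  have h' := (Complex.le_def.1 h).1
  rw [Complex.zero_re, Complex.sub_re, ← frobenius_norm_sq,
    show Mᴴ * (Aᴴ * A) * M = (A * M)ᴴ * (A * M) by
      simp only [Matrix.conjTranspose_mul, Matrix.mul_assoc], ← frobenius_norm_sq] at h'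
  exact abs_le_of_sq_le_sq' (by linarith) (norm_nonneg _) |>.2

theorem norm_mul_le_right [DecidableEq b] {T : Matrix b c ℂ} (hT : Contr Tᴴ) (M : Matrix a b ℂ) :
    ‖M * T‖ ≤ ‖M‖ := by
  rw [← Matrix.frobenius_norm_conjTranspose (M * T), ← Matrix.frobenius_norm_conjTranspose M,
    Matrix.conjTranspose_mul]
  exact hT.norm_mul_le _

theorem Contr.mul [DecidableEq b] [DecidableEq c] {A : Matrix a b ℂ} {B : Matrix b c ℂ}
    (hA : Contr A) (hB : Contr B) : Contr (A * B) := by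
  have h := (hA.conjTranspose_mul_mul_same B).add hB
  unfold Contr
  convert h using 1
  simp only [Matrix.conjTranspose_mul, Matrix.mul_sub, Matrix.sub_mul, Matrix.mul_one,
    Matrix.mul_assoc]
  abel

theorem contr_of_isometry [DecidableEq b] {A : Matrix a b ℂ} (h : Aᴴ * A = 1) : Contr A := by
  unfold Contr
  rw [h, sub_self]
  exact Matrix.PosSemidef.zero

theorem norm_isometry_mul [DecidableEq b] {A : Matrix a b ℂ} (h : Aᴴ * A = 1)
    (M : Matrix b c ℂ) : ‖A * M‖ = ‖M‖ := by
  rw [← sq_eq_sq₀ (norm_nonneg _) (norm_nonneg _), frobenius_norm_sq, frobenius_norm_sq,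
    Matrix.conjTranspose_mul, Matrix.mul_assoc, ← Matrix.mul_assoc Aᴴ, h, Matrix.one_mul]

/-- The matrix `1 - A * Aᴴ` is a Hermitian idempotent, hence of the form `Bᴴ * B`. -/
theorem contr_conjTranspose_of_isometry [DecidableEq a] [DecidableEq b] {A : Matrix a b ℂ}
    (h : Aᴴ * A = 1) : Contr Aᴴ := by
  have h1 : (1 - A * Aᴴ)ᴴ * (1 - A * Aᴴ) = 1 - Aᴴᴴ * Aᴴ := by
    simp only [Matrix.conjTranspose_sub, Matrix.conjTranspose_one, Matrix.conjTranspose_mul,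
      Matrix.conjTranspose_conjTranspose, Matrix.sub_mul, Matrix.mul_sub, Matrix.one_mul,
      Matrix.mul_one]
    rw [Matrix.mul_assoc A Aᴴ, ← Matrix.mul_assoc Aᴴ, h, Matrix.one_mul]
    simp
  unfold Contr
  rw [← h1]
  exact Matrix.posSemidef_conjTranspose_mul_self _

theorem contr_one [DecidableEq a] : Contr (1 : Matrix a a ℂ) := contr_of_isometry (by simp)

theorem Contr.smul [DecidableEq b] {A : Matrix a b ℂ} (hA : Contr A) {z : ℂ} (hz : ‖z‖ = 1) :
    Contr (z • A) := by
  have h : star z * z = 1 := by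
    rw [Complex.star_def, mul_comm, Complex.mul_conj, Complex.normSq_eq_norm_sq, hz]; simp
  unfold Contr
  rw [Matrix.conjTranspose_smul, Matrix.smul_mul, Matrix.mul_smul, smul_smul, h, one_smul]
  exact hA

/-- A Hermitian matrix with square one. -/
structure IsRefl [DecidableEq a] (A : Matrix a a ℂ) : Prop where
  herm : Aᴴ = A
  sq : A * A = 1

theorem IsRefl.contr [DecidableEq a] {A : Matrix a a ℂ} (hA : IsRefl A) : Contr A :=
  contr_of_isometry (by rw [hA.herm, hA.sq])

theorem norm_sgn (s : ZMod 2) : ‖sgn s‖ = 1 := by simp [sgn]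

theorem star_sgn (s : ZMod 2) : star (sgn s) = sgn s := by simp [sgn]

theorem sgn_mul_self (s : ZMod 2) : sgn s * sgn s = 1 := by
  rw [sgn, ← mul_pow]; simp

theorem sgn_zero : sgn 0 = 1 := by simp [sgn]

theorem sgn_one : sgn 1 = -1 := by simp [sgn, ZMod.val_one]

theorem bit_eq_zero_or_one : ∀ s : ZMod 2, s = 0 ∨ s = 1 := by decide

theorem sgn_add (s t : ZMod 2) : sgn (s + t) = sgn s * sgn t := by
  have h : (1 + 1 : ZMod 2) = 0 := by decide
  rcases bit_eq_zero_or_one s with rfl | rfl <;> rcases bit_eq_zero_or_one t with rfl | rfl <;>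
    simp [sgn_zero, sgn_one, h]

theorem sgn_sum {ι : Type*} (s : Finset ι) (f : ι → ZMod 2) :
    sgn (∑ i ∈ s, f i) = ∏ i ∈ s, sgn (f i) := by
  classical
  induction s using Finset.induction_on with
  | empty => simp [sgn]
  | insert i s hi ih => rw [Finset.sum_insert hi, Finset.prod_insert hi, sgn_add, ih]

theorem IsRefl.half_herm [DecidableEq a] {A : Matrix a a ℂ} (hA : IsRefl A) (s : ZMod 2) :
    (half A s)ᴴ = half A s := by
  simp [half, Matrix.conjTranspose_smul, hA.herm, star_sgn]

theorem IsRefl.half_sq [DecidableEq a] {A : Matrix a a ℂ} (hA : IsRefl A) (s : ZMod 2) :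
    half A s * half A s = half A s := by
  rcases bit_eq_zero_or_one s with rfl | rfl <;>
  · simp only [half, Matrix.smul_mul, Matrix.mul_smul, Matrix.add_mul, Matrix.mul_add,
      Matrix.one_mul, Matrix.mul_one, hA.sq, sgn_zero, sgn_one]
    module

theorem Contr.half [DecidableEq a] {A : Matrix a a ℂ} (hA : Contr A) (s : ZMod 2) :
    Contr (half A s) := by
  have h1 : Contr (sgn s • A) := hA.smul (norm_sgn s)
  -- Parallelogram law for `1` and `sgn s • A`: the defect of their mean is half the defect of `sgn
  -- s • A` plus the square of half their difference.
  have h2 : 1 - (StabGame.half A s)ᴴ * StabGame.half A s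
      = (1 / 2 : ℂ) • (1 - (sgn s • A)ᴴ * (sgn s • A)) +
        ((1 / 2 : ℂ) • (1 - sgn s • A))ᴴ * ((1 / 2 : ℂ) • (1 - sgn s • A)) := by
    simp only [StabGame.half]
    generalize sgn s • A = B
    simp only [Matrix.conjTranspose_smul, Matrix.conjTranspose_add, Matrix.conjTranspose_sub,
      Matrix.conjTranspose_one, Matrix.smul_mul, Matrix.mul_smul, Matrix.add_mul, Matrix.mul_add,
      Matrix.sub_mul, Matrix.mul_sub, Matrix.one_mul, Matrix.mul_one]
    rw [show star (1 / 2 : ℂ) = 1 / 2 by simp]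
    module
  have h3 : (0 : ℂ) ≤ 1 / 2 := by
    rw [Complex.le_def]; norm_num
  unfold Contr
  rw [h2]
  exact (Matrix.PosSemidef.smul h1 h3).add (Matrix.posSemidef_conjTranspose_mul_self _)

theorem contr_list_prod [DecidableEq a] (l : List (Matrix a a ℂ)) (h : ∀ A ∈ l, Contr A) :
    Contr l.prod := by
  induction l with
  | nil => simpa using contr_one
  | cons A l ih =>
    rw [List.prod_cons]
    exact (h A (by simp)).mul (ih fun B hB => h B (by simp [hB]))

end Contr

/-! ### Operators that can be moved to the other side of a bipartite state -/

section Mov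

variable {m E a b : Type*} [Fintype m] [DecidableEq m] [Fintype E] [DecidableEq E]
  [Fintype a] [DecidableEq a] [Fintype b] [DecidableEq b]
  {Ψ : Matrix m E ℂ} {δ ε : ℝ}

/-- On the bipartite state `Ψ` the operator `A` acts, up to `δ`, like a contraction on the second
system. -/
def Mov (Ψ : Matrix m E ℂ) (δ : ℝ) (A : Matrix m m ℂ) : Prop :=
  ∃ T : Matrix E E ℂ, Contr Tᴴ ∧ ‖A * Ψ - Ψ * T‖ ≤ δ

theorem Mov.mono {A : Matrix m m ℂ} {δ' : ℝ} (h : Mov Ψ δ A) (hδ : δ ≤ δ') : Mov Ψ δ' A :=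
  let ⟨T, hT, hA⟩ := h
  ⟨T, hT, hA.trans hδ⟩

theorem mov_one : Mov Ψ 0 1 := ⟨1, by simpa using contr_one, by simp⟩

theorem Mov.smul {A : Matrix m m ℂ} (h : Mov Ψ δ A) {z : ℂ} (hz : ‖z‖ = 1) : Mov Ψ δ (z • A) := by
  obtain ⟨T, hT, hA⟩ := h
  refine ⟨z • T, ?_, ?_⟩
  · rw [Matrix.conjTranspose_smul]
    exact hT.smul (by simpa using hz)
  · rw [Matrix.smul_mul, Matrix.mul_smul, ← smul_sub, norm_smul, hz, one_mul]
    exact hA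

theorem Mov.of_close {A B : Matrix m m ℂ} (h : Mov Ψ δ A) (hB : ‖B * Ψ - A * Ψ‖ ≤ ε) :
    Mov Ψ (ε + δ) B :=
  let ⟨T, hT, hA⟩ := h
  ⟨T, hT, (norm_sub_le_norm_sub_add_norm_sub _ (A * Ψ) _).trans (add_le_add hB hA)⟩

/-- First `B` is moved across the state, then `A`. The order of the factors is kept here, since both
images multiply `Ψ` from the right. -/
theorem norm_mul_move {A B : Matrix m m ℂ} {T T' : Matrix E E ℂ} {δ' : ℝ} (hA : Contr A)
    (hT' : Contr T'ᴴ) (h : ‖A * Ψ - Ψ * T‖ ≤ δ) (h' : ‖B * Ψ - Ψ * T'‖ ≤ δ') :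
    ‖A * B * Ψ - Ψ * (T * T')‖ ≤ δ + δ' := by
  have h1 : A * B * Ψ - Ψ * (T * T') = A * (B * Ψ - Ψ * T') + (A * Ψ - Ψ * T) * T' := by
    simp only [Matrix.mul_sub, Matrix.sub_mul, Matrix.mul_assoc]; abel
  rw [h1]
  refine (norm_add_le _ _).trans ?_
  linarith [(hA.norm_mul_le (B * Ψ - Ψ * T')), norm_mul_le_right hT' (A * Ψ - Ψ * T)]

theorem Mov.mul {A B : Matrix m m ℂ} {δ' : ℝ} (hA : Contr A) (h : Mov Ψ δ A) (h' : Mov Ψ δ' B) :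
    Mov Ψ (δ + δ') (A * B) := by
  obtain ⟨T, hT, h⟩ := h
  obtain ⟨T', hT', h'⟩ := h'
  exact ⟨T * T', by rw [Matrix.conjTranspose_mul]; exact hT'.mul hT, norm_mul_move hA hT' h h'⟩

theorem Mov.list_prod {ι : Type*} (l : List ι) (A : ι → Matrix m m ℂ)
    (hA : ∀ j ∈ l, Contr (A j)) (h : ∀ j ∈ l, Mov Ψ δ (A j)) :
    Mov Ψ (l.length * δ) (l.map A).prod := by
  induction l with
  | nil => simpa using mov_one
  | cons j l ih =>
    rw [List.map_cons, List.prod_cons]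
    refine (Mov.mul (hA j (by simp)) (h j (by simp)) (ih (fun x hx => hA x (by simp [hx]))
      fun x hx => h x (by simp [hx]))).mono ?_
    push_cast [List.length_cons]; linarith

/-- Closeness on `Ψ` alone says nothing about `A * Ψ`. Moving `A` to the right turns it into a
contraction behind `B * Ψ - B' * Ψ`; the move is made once for `B` and once for `B'`, whence `2 *
δ`. -/
theorem Mov.subst {A : Matrix m m ℂ} {B B' : Matrix a m ℂ} (hA : Mov Ψ δ A)
    (hB : Contr B) (hB' : Contr B') (h : ‖B * Ψ - B' * Ψ‖ ≤ ε) :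
    ‖B * A * Ψ - B' * A * Ψ‖ ≤ ε + 2 * δ := by
  obtain ⟨T, hT, hA⟩ := hA
  have h1 : B * A * Ψ - B' * A * Ψ
      = B * (A * Ψ - Ψ * T) + (B * Ψ - B' * Ψ) * T - B' * (A * Ψ - Ψ * T) := by
    simp only [Matrix.mul_sub, Matrix.sub_mul, Matrix.mul_assoc]; abel
  rw [h1]
  refine (norm_sub_le _ _).trans ?_
  linarith [hB.norm_mul_le (A * Ψ - Ψ * T), hB'.norm_mul_le (A * Ψ - Ψ * T),
    norm_mul_le_right hT (B * Ψ - B' * Ψ), norm_add_le (B * (A * Ψ - Ψ * T)) ((B * Ψ - B' * Ψ) * T)]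

theorem half_mul_sub (A : Matrix a a ℂ) (B : Matrix b b ℂ) (W : Matrix a b ℂ) (s : ZMod 2) :
    half A s * W - W * half B s = ((1 / 2 : ℂ) * sgn s) • (A * W - W * B) := by
  simp only [half, Matrix.smul_mul, Matrix.mul_smul, Matrix.add_mul, Matrix.mul_add,
    Matrix.one_mul, Matrix.mul_one]
  module

theorem norm_half_mul_sub (A : Matrix a a ℂ) (B : Matrix b b ℂ) (W : Matrix a b ℂ) (s : ZMod 2) :
    ‖half A s * W - W * half B s‖ ≤ ‖A * W - W * B‖ := by
  rw [half_mul_sub, norm_smul, norm_mul, norm_sgn]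
  norm_num
  linarith [norm_nonneg (A * W - W * B)]

theorem Mov.half {A : Matrix m m ℂ} (h : Mov Ψ δ A) (s : ZMod 2) : Mov Ψ δ (half A s) := by
  obtain ⟨T, hT, h⟩ := h
  refine ⟨StabGame.half T s, ?_, (norm_half_mul_sub _ _ _ _).trans h⟩
  have : (StabGame.half T s)ᴴ = StabGame.half Tᴴ s := by
    simp [StabGame.half, Matrix.conjTranspose_smul, star_sgn]
  rw [this]
  exact hT.half s

/-- Operators that are intertwined by `W` on `Ψ` one by one are intertwined as a product. -/
theorem norm_list_prod_intertwine {ι : Type*} (l : List ι) {W : Matrix a m ℂ} (hW : Contr W)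
    (A' : ι → Matrix a a ℂ) (A : ι → Matrix m m ℂ) (hA' : ∀ j ∈ l, Contr (A' j))
    (hA : ∀ j ∈ l, Contr (A j)) (hM : ∀ j ∈ l, Mov Ψ δ (A j)) (hδ : 0 ≤ δ)
    (h : ∀ j ∈ l, ‖A' j * W * Ψ - W * A j * Ψ‖ ≤ ε) :
    ‖(l.map A').prod * W * Ψ - W * (l.map A).prod * Ψ‖
      ≤ l.length * (ε + 2 * (l.length * δ)) := by
  induction l with
  | nil => simp
  | cons j l ih =>
    have ih := ih (fun x hx => hA' x (by simp [hx])) (fun x hx => hA x (by simp [hx]))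
      (fun x hx => hM x (by simp [hx])) (fun x hx => h x (by simp [hx]))
    -- The relation for the head is needed in front of the product of the tail, so the tail has to
    -- be moved to the other side; this is the quadratic term of the bound.
    have h2 := (Mov.list_prod l A (fun x hx => hA x (by simp [hx]))
      (fun x hx => hM x (by simp [hx]))).subst ((hA' j (by simp)).mul hW)
      (hW.mul (hA j (by simp))) (h j (by simp))
    have h3 := (hA' j (by simp)).norm_mul_le
      ((l.map A').prod * W * Ψ - W * (l.map A).prod * Ψ)
    rw [List.map_cons, List.prod_cons, List.map_cons, List.prod_cons]
    refine (norm_sub_le_norm_sub_add_norm_sub _ (A' j * W * (l.map A).prod * Ψ) _).trans ?_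
    have e1 : A' j * (l.map A').prod * W * Ψ - A' j * W * (l.map A).prod * Ψ
        = A' j * ((l.map A').prod * W * Ψ - W * (l.map A).prod * Ψ) := by
      simp only [Matrix.mul_sub, Matrix.mul_assoc]
    rw [e1, ← Matrix.mul_assoc W]
    push_cast [List.length_cons]
    have : (0 : ℝ) ≤ l.length := by positivity
    nlinarith

end Mov

/-! ### Tensor products of operators -/

section Tensor

variable {ι : Type*} [Fintype ι] [DecidableEq ι] {m : ι → Type*} [∀ i, Fintype (m i)]
  [∀ i, DecidableEq (m i)] {E : Type*} [Fintype E] [DecidableEq E]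

theorem tensor_one : tensor (fun i => (1 : Matrix (m i) (m i) ℂ)) = 1 := by
  ext x y
  simp only [tensor, Matrix.of_apply, Matrix.one_apply]
  rw [Finset.prod_ite_zero]
  simp [funext_iff]

theorem tensor_conjTranspose {m' : ι → Type*} (A : ∀ i, Matrix (m i) (m' i) ℂ) :
    (tensor A)ᴴ = tensor fun i => (A i)ᴴ := by
  ext x y
  simp [tensor, Matrix.conjTranspose_apply]

theorem tensor_smul {m' : ι → Type*} (c : ι → ℂ) (A : ∀ i, Matrix (m i) (m' i) ℂ) :
    tensor (fun i => c i • A i) = (∏ i, c i) • tensor A := by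
  ext x y
  simp [tensor, Finset.prod_mul_distrib]

theorem trace_tensor (A : ∀ i, Matrix (m i) (m i) ℂ) : (tensor A).trace = ∏ i, (A i).trace := by
  simp only [Matrix.trace, Matrix.diag, tensor, Matrix.of_apply]
  exact (Fintype.prod_sum fun i j => A i j j).symm

theorem tensor_sum {m' : ι → Type*} {κ : ι → Type*} [∀ i, Fintype (κ i)]
    (A : ∀ i, κ i → Matrix (m i) (m' i) ℂ) :
    tensor (fun i => ∑ a, A i a) = ∑ a : ∀ i, κ i, tensor fun i => A i (a i) := by
  ext x y
  rw [Matrix.sum_apply]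
  simp only [tensor, Matrix.of_apply, Matrix.sum_apply]
  exact Fintype.prod_sum fun i a => A i a (x i) (y i)

theorem tensor_update_add (A : ∀ i, Matrix (m i) (m i) ℂ) (i : ι) (B C : Matrix (m i) (m i) ℂ) :
    tensor (Function.update A i (B + C))
      = tensor (Function.update A i B) + tensor (Function.update A i C) := by
  ext x y
  have h : ∀ X : Matrix (m i) (m i) ℂ, tensor (Function.update A i X) x y
      = X (x i) (y i) * ∏ j : {j // j ≠ i}, A j (x j) (y j) := by
    intro X
    simp only [tensor, Matrix.of_apply]
    rw [Fintype.prod_eq_mul_prod_subtype_ne _ i, Function.update_self]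
    congr 1
    exact Finset.prod_congr rfl fun j _ => by rw [Function.update_of_ne j.2]
  rw [Matrix.add_apply, h, h, h, Matrix.add_apply, add_mul]

/-- The operator `A` on the `i`-th tensor factor. -/
def loc (i : ι) (A : Matrix (m i) (m i) ℂ) : Matrix (∀ i, m i) (∀ i, m i) ℂ :=
  tensor (Function.update (fun _ => 1) i A)

theorem loc_one (i : ι) : loc (m := m) i 1 = 1 := by
  rw [loc, Function.update_eq_self_iff.2 rfl, tensor_one]

theorem loc_add (i : ι) (A B : Matrix (m i) (m i) ℂ) : loc i (A + B) = loc i A + loc i B :=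
  tensor_update_add _ _ _ _

theorem loc_mul (i : ι) (A B : Matrix (m i) (m i) ℂ) : loc i (A * B) = loc i A * loc i B := by
  rw [loc, loc, loc, tensor_mul]
  congr 1
  funext j
  by_cases h : j = i
  · subst h; simp
  · simp [h]

theorem loc_conjTranspose (i : ι) (A : Matrix (m i) (m i) ℂ) : (loc i A)ᴴ = loc i Aᴴ := by
  rw [loc, loc, tensor_conjTranspose]
  congr 1
  funext j
  by_cases h : j = i
  · subst h; simp
  · simp [h]

theorem tensor_update_eq_mul_loc (A : ∀ i, Matrix (m i) (m i) ℂ) (i : ι)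
    (B : Matrix (m i) (m i) ℂ) :
    tensor (Function.update A i B) = tensor (Function.update A i 1) * loc i B := by
  rw [loc, tensor_mul]
  congr 1
  funext j
  by_cases h : j = i
  · subst h; simp
  · simp [h]

/-- A factorization of the defect `1 - Aᴴ * A` as `Bᴴ * B` passes through `loc`, which respects
sums, products and adjoints. -/
theorem Contr.loc {i : ι} {A : Matrix (m i) (m i) ℂ} (hA : Contr A) : Contr (loc i A) := by
  obtain ⟨B, hB⟩ := exists_conjTranspose_mul_self hA
  have h : 1 - (StabGame.loc i A)ᴴ * StabGame.loc i A = (StabGame.loc i B)ᴴ * StabGame.loc i B := by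
    rw [loc_conjTranspose, loc_conjTranspose, ← loc_mul, ← loc_mul, hB, sub_eq_iff_eq_add,
      ← loc_add, sub_add_cancel, loc_one]
  unfold Contr
  rw [h]
  exact Matrix.posSemidef_conjTranspose_mul_self _

theorem tensor_ite_insert (A B : ∀ i, Matrix (m i) (m i) ℂ) (s : Finset ι) (i : ι) :
    (fun j => if j ∈ insert i s then B j else A j)
      = Function.update (fun j => if j ∈ s then B j else A j) i (B i) := by
  funext j
  by_cases h : j = i
  · subst h; simp
  · simp [h]

theorem contr_tensor {A : ∀ i, Matrix (m i) (m i) ℂ} (hA : ∀ i, Contr (A i)) :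
    Contr (tensor A) := by
  have h : ∀ s : Finset ι, Contr (tensor fun j => if j ∈ s then A j else 1) := by
    intro s
    induction s using Finset.induction_on with
    | empty => simpa [tensor_one] using contr_one
    | insert i s hi ih =>
      rw [tensor_ite_insert (fun _ => 1) A, tensor_update_eq_mul_loc]
      refine Contr.mul ?_ (hA i).loc
      rwa [Function.update_eq_self_iff.2 (by simp [hi])]
  simpa using h Finset.univ

/-- Replacing the tensor factors one by one. -/
theorem norm_tensor_mul_sub_le {A B : ∀ i, Matrix (m i) (m i) ℂ} (hA : ∀ i, Contr (A i))
    (hB : ∀ i, Contr (B i)) (ψ : Matrix (∀ i, m i) E ℂ) (β : ι → ℝ)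
    (h : ∀ i, ‖loc i (B i) * ψ - loc i (A i) * ψ‖ ≤ β i) :
    ‖tensor B * ψ - tensor A * ψ‖ ≤ ∑ i, β i := by
  have key : ∀ s : Finset ι,
      ‖tensor (fun j => if j ∈ s then B j else A j) * ψ - tensor A * ψ‖ ≤ ∑ i ∈ s, β i := by
    intro s
    induction s using Finset.induction_on with
    | empty => simp
    | insert i s hi ih =>
      rw [tensor_ite_insert A B, Finset.sum_insert hi]
      refine (norm_sub_le_norm_sub_add_norm_sub _
        (tensor (fun j => if j ∈ s then B j else A j) * ψ) _).trans (add_le_add ?_ ih)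
      have e : tensor (fun j => if j ∈ s then B j else A j)
          = tensor (Function.update (fun j => if j ∈ s then B j else A j) i (A i)) := by
        rw [Function.update_eq_self_iff.2 (by simp [hi])]
      have hc : Contr
          (tensor (Function.update (fun j => if j ∈ s then B j else A j) i 1)) := by
        refine contr_tensor fun j => ?_
        by_cases hj : j = i
        · subst hj; simpa using contr_one
        · rw [Function.update_of_ne hj]
          split_ifs
          exacts [hB j, hA j]
      rw [tensor_update_eq_mul_loc _ i (B i), e, tensor_update_eq_mul_loc _ i (A i),
        Matrix.mul_assoc, Matrix.mul_assoc, ← Matrix.mul_sub]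
      exact (hc.norm_mul_le _).trans (h i)
  simpa using key Finset.univ

/-- A state of all systems, seen as a bipartite state of the `i`-th system and the rest. -/
def reshape (i : ι) (ψ : Matrix (∀ i, m i) E ℂ) :
    Matrix (m i) ((∀ j : {j // j ≠ i}, m j) × E) ℂ :=
  Matrix.of fun x y => ψ ((Equiv.piSplitAt i m).symm (x, y.1)) y.2

/-- The action of the factors `C j`, `j ≠ i`, on the second system of a reshaped state. -/
def rightOp (E : Type*) [DecidableEq E] (i : ι) (C : ∀ i, Matrix (m i) (m i) ℂ) :
    Matrix ((∀ j : {j // j ≠ i}, m j) × E) ((∀ j : {j // j ≠ i}, m j) × E) ℂ :=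
  Matrix.kronecker (tensor fun j : {j // j ≠ i} => C j)ᵀ (1 : Matrix E E ℂ)

/-- This is what makes the bipartite picture work: the `i`-th factor acts on the rows, all other
factors on the columns. -/
theorem reshape_tensor_mul (i : ι) (C : ∀ i, Matrix (m i) (m i) ℂ) (ψ : Matrix (∀ i, m i) E ℂ) :
    reshape i (tensor C * ψ) = C i * reshape i ψ * rightOp E i C := by
  ext x ⟨y, e⟩
  have hs : ∀ (x' : m i) (y' : ∀ j : {j // j ≠ i}, m j),
      tensor C ((Equiv.piSplitAt i m).symm (x, y)) ((Equiv.piSplitAt i m).symm (x', y'))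
        = C i x x' * ∏ j : {j // j ≠ i}, C j (y j) (y' j) := by
    intro x' y'
    simp only [tensor, Matrix.of_apply]
    rw [Fintype.prod_eq_mul_prod_subtype_ne _ i]
    congr 1
    · simp
    · refine Finset.prod_congr rfl fun j _ => ?_
      simp [j.2]
  have h1 : reshape i (tensor C * ψ) x (y, e) = ∑ p : m i × (∀ j : {j // j ≠ i}, m j),
      (C i x p.1 * ∏ j : {j // j ≠ i}, C j (y j) (p.2 j)) *
        ψ ((Equiv.piSplitAt i m).symm p) e := by
    simp only [reshape, Matrix.of_apply, Matrix.mul_apply]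
    rw [← (Equiv.piSplitAt i m).symm.sum_comp]
    exact Finset.sum_congr rfl fun p _ => by rw [← hs]
  rw [h1, Matrix.mul_apply, Fintype.sum_prod_type, Fintype.sum_prod_type, Finset.sum_comm]
  refine Finset.sum_congr rfl fun y' _ => ?_
  simp only [rightOp, Matrix.kronecker, Matrix.kroneckerMap_apply, Matrix.one_apply, mul_ite,
    mul_one, mul_zero, Finset.sum_ite_eq', Finset.mem_univ, if_true, Matrix.mul_apply,
    Finset.sum_mul, Matrix.transpose_apply, tensor, reshape, Matrix.of_apply]
  exact Finset.sum_congr rfl fun x' _ => by ring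

theorem trace_reshape (i : ι) (ψ φ : Matrix (∀ i, m i) E ℂ) :
    ((reshape i ψ)ᴴ * reshape i φ).trace = (ψᴴ * φ).trace := by
  simp only [Matrix.trace, Matrix.diag, Matrix.mul_apply, Matrix.conjTranspose_apply, reshape,
    Matrix.of_apply, Fintype.sum_prod_type]
  rw [Finset.sum_comm]
  refine Finset.sum_congr rfl fun e _ => ?_
  rw [← (Equiv.piSplitAt i m).symm.sum_comp, Fintype.sum_prod_type, Finset.sum_comm]

theorem norm_reshape (i : ι) (ψ : Matrix (∀ i, m i) E ℂ) : ‖reshape i ψ‖ = ‖ψ‖ := by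
  rw [← sq_eq_sq₀ (norm_nonneg _) (norm_nonneg _), frobenius_norm_sq, frobenius_norm_sq,
    trace_reshape]

theorem reshape_sub (i : ι) (ψ φ : Matrix (∀ i, m i) E ℂ) :
    reshape i (ψ - φ) = reshape i ψ - reshape i φ := rfl

theorem rightOp_congr {i : ι} {C C' : ∀ i, Matrix (m i) (m i) ℂ} (h : ∀ j, j ≠ i → C j = C' j) :
    rightOp E i C = rightOp E i C' := by
  unfold rightOp
  congr 3
  funext j
  exact h j j.2

theorem rightOp_one (i : ι) : rightOp E i (fun j => (1 : Matrix (m j) (m j) ℂ)) = 1 := by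
  rw [rightOp, tensor_one, Matrix.transpose_one]
  exact Matrix.one_kronecker_one

/-- The order reverses because of the transpose: right multiplication is an antirepresentation of
the operators of the other players. -/
theorem rightOp_mul (i : ι) (C C' : ∀ i, Matrix (m i) (m i) ℂ) :
    rightOp E i C * rightOp E i C' = rightOp E i fun j => C' j * C j := by
  unfold rightOp
  refine (Matrix.mul_kronecker_mul _ _ _ _).symm.trans ?_
  rw [← Matrix.transpose_mul, tensor_mul, Matrix.mul_one]
  rfl

theorem rightOp_conjTranspose (i : ι) (C : ∀ i, Matrix (m i) (m i) ℂ) :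
    (rightOp E i C)ᴴ = rightOp E i fun j => (C j)ᴴ := by
  unfold rightOp
  rw [Matrix.kronecker, Matrix.conjTranspose_kronecker, Matrix.conjTranspose_one,
    ← tensor_conjTranspose]
  rfl

theorem isRefl_rightOp (i : ι) {C : ∀ i, Matrix (m i) (m i) ℂ} (hC : ∀ j, IsRefl (C j)) :
    IsRefl (rightOp E i C) := by
  constructor
  · rw [rightOp_conjTranspose]
    exact rightOp_congr fun j _ => (hC j).herm
  · rw [rightOp_mul, rightOp_congr (C' := fun _ => 1) fun j _ => (hC j).sq, rightOp_one]

theorem reshape_loc_mul (i : ι) (A : Matrix (m i) (m i) ℂ) (ψ : Matrix (∀ i, m i) E ℂ) :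
    reshape i (loc i A * ψ) = A * reshape i ψ := by
  rw [loc, reshape_tensor_mul, Function.update_self,
    rightOp_congr (C' := fun _ => 1) fun j hj => by simp [hj], rightOp_one, Matrix.mul_one]

end Tensor

/-! ### Products of Pauli matrices -/

/-- The product of two Pauli matrices up to a phase. -/
def Pauli.mul : Pauli → Pauli → Pauli
  | .I, q => q
  | p, .I => p
  | .X, .X => .I
  | .Y, .Y => .I
  | .Z, .Z => .I
  | .X, .Y => .Z
  | .Y, .X => .Z
  | .X, .Z => .Y
  | .Z, .X => .Y
  | .Y, .Z => .X
  | .Z, .Y => .X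

/-- The phase of the product of two Pauli matrices. -/
def Pauli.phase : Pauli → Pauli → ℂ
  | .X, .Y => Complex.I
  | .Y, .X => -Complex.I
  | .Y, .Z => Complex.I
  | .Z, .Y => -Complex.I
  | .Z, .X => Complex.I
  | .X, .Z => -Complex.I
  | _, _ => 1

theorem Pauli.mat_mul (p q : Pauli) : p.mat * q.mat = p.phase q • (p.mul q).mat := by
  cases p <;> cases q <;> ext i j <;> fin_cases i <;> fin_cases j <;>
    simp [Pauli.mat, Pauli.mul, Pauli.phase]

theorem Pauli.norm_phase (p q : Pauli) : ‖p.phase q‖ = 1 := by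
  cases p <;> cases q <;> simp [Pauli.phase]

theorem Pauli.mul_mul_self (p q : Pauli) : (p.mul q).mul q = p := by
  cases p <;> cases q <;> rfl

theorem Pauli.star_phase (p q : Pauli) : star ((p.mul q).phase q) = p.phase q := by
  cases p <;> cases q <;> simp [Pauli.mul, Pauli.phase]

theorem Pauli.mat_conjTranspose (p : Pauli) : p.matᴴ = p.mat := by
  cases p <;> ext i j <;> fin_cases i <;> fin_cases j <;> simp [Pauli.mat]

theorem Pauli.trace_conjTranspose_mul (p q : Pauli) :
    (p.matᴴ * q.mat).trace = if p = q then 2 else 0 := by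
  cases p <;> cases q <;>
    simp [Pauli.mat, Matrix.trace_fin_two, Matrix.mul_apply, Fin.sum_univ_two] <;> norm_num

theorem Pauli.mat_sq (p : Pauli) : p.mat * p.mat = 1 := by
  rw [Pauli.mat_mul]
  cases p <;> simp [Pauli.phase, Pauli.mul, Pauli.mat]

section PauliOp

variable {ι : Type*} [Fintype ι] [DecidableEq ι]

theorem pauliOp_mul (P Q : ι → Pauli) :
    pauliOp P * pauliOp Q
      = (∏ i, (P i).phase (Q i)) • pauliOp fun i => (P i).mul (Q i) := by
  unfold pauliOp
  rw [tensor_mul, ← tensor_smul]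
  congr 1
  funext i
  exact Pauli.mat_mul _ _

theorem isRefl_pauliOp (P : ι → Pauli) : IsRefl (pauliOp P) := by
  constructor
  · rw [pauliOp, tensor_conjTranspose]
    simp_rw [Pauli.mat_conjTranspose]
  · rw [pauliOp, tensor_mul]
    simp_rw [Pauli.mat_sq]
    exact tensor_one

theorem pauliOp_I : pauliOp (fun _ : ι => Pauli.I) = 1 := tensor_one

theorem trace_pauliOp (P Q : ι → Pauli) :
    ((pauliOp P)ᴴ * pauliOp Q).trace = if P = Q then (2 : ℂ) ^ Fintype.card ι else 0 := by
  rw [pauliOp, pauliOp, tensor_conjTranspose, tensor_mul, trace_tensor]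
  simp_rw [Pauli.trace_conjTranspose_mul]
  rw [Finset.prod_ite_zero]
  simp [funext_iff]

end PauliOp

theorem pauliOp_mul_at1 {n : ℕ} (g : Fin n → Pauli) (u : Fin n) (D : Pauli) :
    pauliOp g * pauliOp (at1 u D)
      = (g u).phase D • pauliOp (Function.update g u ((g u).mul D)) := by
  rw [pauliOp_mul]
  congr 1
  · rw [Finset.prod_eq_single u]
    · simp [at1]
    · intro v _ hv
      have : at1 u D v = .I := if_neg hv
      rw [this]
      cases g v <;> rfl
    · simp
  · congr 1
    funext v
    by_cases hv : v = u
    · subst hv; simp [at1]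
    · have : at1 u D v = .I := if_neg hv
      rw [this, Function.update_of_ne hv]
      cases g v <;> rfl

/-! ### The isometry built from approximate Pauli operators -/

section PauliAverage

variable {n : ℕ} {m m' E : Type*} [Fintype m] [DecidableEq m] [Fintype m'] [Fintype E]

/-- The Bell basis. -/
def bell (n : ℕ) : Matrix ((Fin n → Fin 2) × (Fin n → Fin 2)) (Fin n → Pauli) ℂ :=
  Matrix.of fun x g => ((Real.sqrt (2 ^ n) : ℝ) : ℂ)⁻¹ * star (pauliOp g x.2 x.1)

/-- Orthogonality of distinct Pauli strings for the Hilbert–Schmidt inner product. -/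
theorem bell_isometry (n : ℕ) : (bell n)ᴴ * bell n = 1 := by
  ext g g'
  have h : ((Real.sqrt (2 ^ n) : ℝ) : ℂ)⁻¹ * ((Real.sqrt (2 ^ n) : ℝ) : ℂ)⁻¹ * 2 ^ n = 1 := by
    rw [← mul_inv, ← Complex.ofReal_mul, Real.mul_self_sqrt (by positivity)]
    push_cast
    exact inv_mul_cancel₀ (by positivity)
  have h1 : ((bell n)ᴴ * bell n) g g' = ((Real.sqrt (2 ^ n) : ℝ) : ℂ)⁻¹ *
      ((Real.sqrt (2 ^ n) : ℝ) : ℂ)⁻¹ * ((pauliOp g')ᴴ * pauliOp g).trace := by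
    simp only [Matrix.mul_apply, Matrix.trace, Matrix.diag, Matrix.conjTranspose_apply, bell,
      Matrix.of_apply, Fintype.sum_prod_type, Finset.mul_sum]
    refine Finset.sum_congr rfl fun x _ => Finset.sum_congr rfl fun w _ => ?_
    simp only [star_mul', star_inv₀, Complex.star_def, Complex.conj_ofReal, Complex.conj_conj]
    ring
  rw [h1, trace_pauliOp, Fintype.card_fin, Matrix.one_apply]
  by_cases hg : g = g'
  · simp [hg, h]
  · simp [hg, Ne.symm hg]

/-- The average `2⁻ⁿ ∑ g, |bell g⟩ ⊗ B g` over the Pauli strings `g`. -/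
def pauliAvg (B : (Fin n → Pauli) → Matrix m m' ℂ) :
    Matrix ((Fin n → Fin 2) × ((Fin n → Fin 2) × m)) m' ℂ :=
  Matrix.of fun x q => ((2 : ℂ) ^ n)⁻¹ * (bell n *ᵥ fun g => B g x.2.2 q) (x.1, x.2.1)

/-- Parseval's identity for the orthonormal Bell vectors. -/
theorem pauliAvg_inner (B B' : (Fin n → Pauli) → Matrix m m' ℂ) :
    (pauliAvg B)ᴴ * pauliAvg B' = ((4 : ℂ) ^ n)⁻¹ • ∑ g, (B g)ᴴ * B' g := by
  ext q q'
  have key : ∀ a b : (Fin n → Pauli) → ℂ,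
      ∑ x, ∑ w, star ((bell n *ᵥ a) (x, w)) * (bell n *ᵥ b) (x, w) = ∑ g, star (a g) * b g := by
    intro a b
    have : star (bell n *ᵥ a) ⬝ᵥ (bell n *ᵥ b) = star a ⬝ᵥ b := by
      rw [Matrix.star_mulVec, Matrix.dotProduct_mulVec, Matrix.vecMul_vecMul, bell_isometry,
        Matrix.vecMul_one]
    simpa [dotProduct, Fintype.sum_prod_type] using this
  have h4 : ((4 : ℂ) ^ n)⁻¹ = ((2 : ℂ) ^ n)⁻¹ * ((2 : ℂ) ^ n)⁻¹ := by
    rw [← mul_inv, ← mul_pow]; norm_num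
  simp only [Matrix.mul_apply, Matrix.conjTranspose_apply, pauliAvg, Matrix.of_apply,
    Fintype.sum_prod_type, Matrix.smul_apply, Matrix.sum_apply, smul_eq_mul]
  rw [Finset.sum_comm' (t' := Finset.univ) (s' := fun _ => Finset.univ) (by simp)]
  have h5 : ∀ p : m, ∑ x, ∑ w, star (((2 : ℂ) ^ n)⁻¹ * (bell n *ᵥ fun g => B g p q) (x, w)) *
      (((2 : ℂ) ^ n)⁻¹ * (bell n *ᵥ fun g => B' g p q') (x, w))
      = ((4 : ℂ) ^ n)⁻¹ * ∑ g, star (B g p q) * B' g p q' := by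
    intro p
    rw [← key, Finset.mul_sum]
    refine Finset.sum_congr rfl fun x _ => ?_
    rw [Finset.mul_sum]
    refine Finset.sum_congr rfl fun w _ => ?_
    rw [h4, star_mul', star_inv₀, star_pow, Complex.star_def, Complex.conj_ofNat]
    ring
  have h6 : ∀ f : (Fin n → Fin 2) → (Fin n → Fin 2) → m → ℂ,
      ∑ w, ∑ x, ∑ p, f x w p = ∑ p, ∑ x, ∑ w, f x w p := by
    intro f
    rw [Finset.sum_comm]
    simp_rw [Finset.sum_comm (s := (Finset.univ : Finset (Fin n → Fin 2)))
      (t := (Finset.univ : Finset m))]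
  rw [h6]
  simp_rw [h5]
  rw [← Finset.mul_sum, Finset.sum_comm]

theorem pauliAvg_mul (B : (Fin n → Pauli) → Matrix m m' ℂ) (M : Matrix m' E ℂ) :
    pauliAvg B * M = pauliAvg fun g => B g * M := by
  ext x q
  simp only [Matrix.mul_apply, pauliAvg, Matrix.of_apply, Matrix.mulVec, dotProduct,
    Finset.mul_sum, Finset.sum_mul]
  rw [Finset.sum_comm]
  exact Finset.sum_congr rfl fun g _ => Finset.sum_congr rfl fun p _ => by ring

theorem pauliAvg_sub (B B' : (Fin n → Pauli) → Matrix m m' ℂ) :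
    pauliAvg B - pauliAvg B' = pauliAvg fun g => B g - B' g := by
  ext x q
  simp only [pauliAvg, Matrix.of_apply, Matrix.sub_apply, Matrix.mulVec, dotProduct,
    mul_sub, Finset.sum_sub_distrib]

/-- By `pauliAvg_inner` the squared norm is the mean of `‖B g‖ ^ 2` over the `4 ^ n` strings, so
estimates that are uniform in `g` lose no factor exponential in `n`. -/
theorem norm_pauliAvg_le {B : (Fin n → Pauli) → Matrix m m' ℂ} {β : ℝ} (hβ : 0 ≤ β)
    (h : ∀ g, ‖B g‖ ≤ β) : ‖pauliAvg B‖ ≤ β := by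
  refine abs_le_of_sq_le_sq' ?_ hβ |>.2
  have e : (((4 : ℂ) ^ n)⁻¹ • ∑ g, (B g)ᴴ * B g).trace.re = ((4 : ℝ) ^ n)⁻¹ * ∑ g, ‖B g‖ ^ 2 := by
    rw [Matrix.trace_smul, Matrix.trace_sum]
    have : ((4 : ℂ) ^ n)⁻¹ = (((4 : ℝ) ^ n)⁻¹ : ℝ) := by push_cast; rfl
    rw [this, smul_eq_mul, Complex.re_ofReal_mul, Complex.re_sum]
    simp_rw [frobenius_norm_sq]
  rw [frobenius_norm_sq, pauliAvg_inner, e]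
  have h1 : ∑ g : Fin n → Pauli, ‖B g‖ ^ 2 ≤ ∑ g : Fin n → Pauli, β ^ 2 :=
    Finset.sum_le_sum fun g _ => by gcongr; exact h g
  have h2 : Fintype.card (Fin n → Pauli) = 4 ^ n := by
    rw [Fintype.card_fun, Fintype.card_fin]; rfl
  rw [Finset.sum_const, Finset.card_univ, h2, nsmul_eq_mul] at h1
  calc ((4 : ℝ) ^ n)⁻¹ * ∑ g, ‖B g‖ ^ 2 ≤ ((4 : ℝ) ^ n)⁻¹ * ((4 ^ n : ℕ) * β ^ 2) := by gcongr
    _ = β ^ 2 := by push_cast; field_simp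

theorem pauliAvg_isometry {B : (Fin n → Pauli) → Matrix m m ℂ} (h : ∀ g, (B g)ᴴ * B g = 1) :
    (pauliAvg B)ᴴ * pauliAvg B = 1 := by
  have h2 : Fintype.card (Fin n → Pauli) = 4 ^ n := by
    rw [Fintype.card_fun, Fintype.card_fin]; rfl
  rw [pauliAvg_inner]
  simp_rw [h]
  rw [Finset.sum_const, Finset.card_univ, h2, ← Nat.cast_smul_eq_nsmul ℂ, smul_smul]
  push_cast
  rw [inv_mul_cancel₀ (by positivity), one_smul]

/-- An honest Pauli operator sends Bell vectors to Bell vectors up to phases, through the involution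
that multiplies the label by `D` at `u`. After reindexing, its action is transferred from the
register to the family `B`; this turns the words into a representation of the register's Pauli
operators. -/
theorem kronecker_at1_mul_pauliAvg (u : Fin n) (D : Pauli)
    (B : (Fin n → Pauli) → Matrix m m' ℂ) :
    Matrix.kronecker (pauliOp (at1 u D))
        (1 : Matrix ((Fin n → Fin 2) × m) ((Fin n → Fin 2) × m) ℂ) * pauliAvg B
      = pauliAvg fun g => (g u).phase D • B (Function.update g u ((g u).mul D)) := by
  have hinv : Function.Involutive fun g : Fin n → Pauli => Function.update g u ((g u).mul D) := by
    intro g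
    simp [Pauli.mul_mul_self]
  have hb : ∀ (x w : Fin n → Fin 2) (g : Fin n → Pauli),
      ∑ x', pauliOp (at1 u D) x x' * bell n (x', w) g
        = star ((g u).phase D) * bell n (x, w) (Function.update g u ((g u).mul D)) := by
    intro x w g
    have h1 := congrFun (congrFun (pauliOp_mul_at1 g u D) w) x
    rw [Matrix.smul_apply, smul_eq_mul] at h1
    simp only [bell, Matrix.of_apply]
    rw [mul_left_comm, ← star_mul', ← h1, Matrix.mul_apply, star_sum, Finset.mul_sum]
    refine Finset.sum_congr rfl fun x' _ => ?_
    have h2 : star (pauliOp (at1 u D) x' x) = pauliOp (at1 u D) x x' := by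
      conv_rhs => rw [← (isRefl_pauliOp (at1 u D)).herm]
      rfl
    rw [star_mul', h2]
    ring
  ext ⟨x, w, p⟩ q
  have h3 : (Matrix.kronecker (pauliOp (at1 u D))
      (1 : Matrix ((Fin n → Fin 2) × m) ((Fin n → Fin 2) × m) ℂ) * pauliAvg B) (x, w, p) q = ∑ x', pauliOp (at1 u D) x x' * pauliAvg B (x', w, p) q := by
    rw [Matrix.mul_apply, Fintype.sum_prod_type]
    refine Finset.sum_congr rfl fun x' _ => ?_
    rw [Finset.sum_eq_single (w, p)]
    · simp [Matrix.kronecker]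
    · intro y _ hy
      simp [Matrix.kronecker, Matrix.one_apply_ne hy.symm]
    · simp
  rw [h3]
  simp only [pauliAvg, Matrix.of_apply, Matrix.mulVec, dotProduct]
  have h4 : ∀ a : (Fin n → Pauli) → ℂ,
      ∑ x', pauliOp (at1 u D) x x' * (((2 : ℂ) ^ n)⁻¹ * ∑ g, bell n (x', w) g * a g)
      = ((2 : ℂ) ^ n)⁻¹ * ∑ g, (star ((g u).phase D) *
          bell n (x, w) (Function.update g u ((g u).mul D))) * a g := by
    intro a
    simp_rw [← hb, Finset.mul_sum, Finset.sum_mul, Finset.mul_sum]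
    rw [Finset.sum_comm]
    exact Finset.sum_congr rfl fun g _ => Finset.sum_congr rfl fun x' _ => by ring
  rw [h4]
  congr 1
  -- The involution on labels reindexes the sum; `Pauli.star_phase` identifies the conjugate phase
  -- at the new label with the phase in the statement.
  rw [← Equiv.sum_comp (hinv.toPerm _)]
  refine Finset.sum_congr rfl fun g _ => ?_
  simp only [Function.Involutive.coe_toPerm, Function.update_self, Matrix.smul_apply, smul_eq_mul,
    Pauli.star_phase, Pauli.mul_mul_self, Function.update_idem, Function.update_eq_self]
  ring

end PauliAverage

/-! ### Words in approximate Pauli operators -/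

/-- The letters `X` and `Z`. -/
def xz : Bool → Pauli
  | false => .X
  | true => .Z

theorem xz_ne_Y (c : Bool) : xz c ≠ .Y := by cases c <;> simp [xz]

theorem xz_ne_I (c : Bool) : xz c ≠ .I := by cases c <;> simp [xz]

section Words

variable {n : ℕ} {m E : Type*} [Fintype m] [DecidableEq m] [Fintype E] [DecidableEq E]

/-- The operators that stand for `I, X, Y, Z`, given those for `X` and `Z`. -/
def letter (O : Bool → Matrix m m ℂ) : Pauli → Matrix m m ℂ
  | .I => 1
  | .X => O false
  | .Y => Complex.I • (O false * O true)
  | .Z => O true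

/-- Reflections that satisfy the Pauli relations approximately on the state `Ψ`. -/
structure ApproxPauli (Ψ : Matrix m E ℂ) (δ : ℝ) (O : Fin n → Bool → Matrix m m ℂ) : Prop where
  refl : ∀ u c, IsRefl (O u c)
  mov : ∀ u c, Mov Ψ δ (O u c)
  comm : ∀ u v c c', u ≠ v → ‖O u c * O v c' * Ψ - O v c' * O u c * Ψ‖ ≤ 12 * δ
  anti : ∀ u, ‖O u true * O u false * Ψ + O u false * O u true * Ψ‖ ≤ 4 * δ

/-- The ordered product of the operators for the letters of `g` at the positions in `l`. -/
def word (O : Fin n → Bool → Matrix m m ℂ) (g : Fin n → Pauli) (l : List (Fin n)) :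
    Matrix m m ℂ :=
  (l.map fun v => letter (O v) (g v)).prod

variable {Ψ : Matrix m E ℂ} {δ : ℝ} {O : Fin n → Bool → Matrix m m ℂ}

theorem letter_isometry {O : Bool → Matrix m m ℂ} (h : ∀ c, IsRefl (O c)) (p : Pauli) :
    (letter O p)ᴴ * letter O p = 1 := by
  cases p
  · simp [letter]
  · simp [letter, (h _).herm, (h _).sq]
  · simp only [letter, Matrix.conjTranspose_smul, Matrix.conjTranspose_mul, (h _).herm,
      Matrix.smul_mul, Matrix.mul_smul, smul_smul]
    rw [Matrix.mul_assoc, ← Matrix.mul_assoc (O false), (h _).sq, Matrix.one_mul, (h _).sq]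
    simp
  · simp [letter, (h _).herm, (h _).sq]

theorem word_isometry (h : ∀ u c, IsRefl (O u c)) (g : Fin n → Pauli) (l : List (Fin n)) :
    (word O g l)ᴴ * word O g l = 1 := by
  induction l with
  | nil => simp [word]
  | cons v l ih =>
    have e : word O g (v :: l) = letter (O v) (g v) * word O g l := by simp [word]
    rw [e, Matrix.conjTranspose_mul, Matrix.mul_assoc, ← Matrix.mul_assoc _ (letter _ _),
      letter_isometry (h v), Matrix.one_mul, ih]

theorem ApproxPauli.nonneg (h : ApproxPauli Ψ δ O) (u : Fin n) : 0 ≤ δ := by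
  have := (norm_nonneg _).trans (h.anti u)
  linarith

theorem ApproxPauli.contr_letter (h : ApproxPauli Ψ δ O) (v : Fin n) (p : Pauli) :
    Contr (letter (O v) p) := contr_of_isometry (letter_isometry (h.refl v) p)

theorem ApproxPauli.mov_letter (h : ApproxPauli Ψ δ O) (v : Fin n) (p : Pauli) :
    Mov Ψ (2 * δ) (letter (O v) p) := by
  have h0 := h.nonneg v
  cases p
  · exact mov_one.mono (by linarith)
  · exact (h.mov v false).mono (by linarith)
  · exact (((h.mov v false).mul (h.refl _ _).contr (h.mov v true)).smul (by simp)).mono (by linarith)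
  · exact (h.mov v true).mono (by linarith)

theorem ApproxPauli.mov_word (h : ApproxPauli Ψ δ O) (g : Fin n → Pauli) (l : List (Fin n)) :
    Mov Ψ (l.length * (2 * δ)) (word O g l) :=
  Mov.list_prod l _ (fun v _ => h.contr_letter v (g v)) fun v _ => h.mov_letter v (g v)

/-- The worst letter is `Y`, a product of two reflections: two commutations at `12 * δ` each, and `2
* δ` for performing one of them in front of the other reflection. -/
theorem ApproxPauli.comm_letter (h : ApproxPauli Ψ δ O) {u v : Fin n} (huv : u ≠ v) (c : Bool)
    (p : Pauli) :
    ‖letter (O v) p * O u c * Ψ - O u c * letter (O v) p * Ψ‖ ≤ 26 * δ := by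
  have h0 := h.nonneg v
  cases p
  · simpa [letter] using h0
  · exact (h.comm _ _ _ _ huv.symm).trans (by linarith)
  · have h1 := h.comm v u true c huv.symm
    have h2 := (h.mov v true).subst ((h.refl v false).contr.mul (h.refl u c).contr)
      ((h.refl u c).contr.mul (h.refl v false).contr) (h.comm v u false c huv.symm)
    have h3 := (h.refl v false).contr.norm_mul_le
      (O v true * O u c * Ψ - O u c * O v true * Ψ)
    have e : letter (O v) .Y * O u c * Ψ - O u c * letter (O v) .Y * Ψ
        = Complex.I • (O v false * (O v true * O u c * Ψ - O u c * O v true * Ψ) +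
          (O v false * O u c * O v true * Ψ - O u c * O v false * O v true * Ψ)) := by
      simp only [letter, Matrix.smul_mul, Matrix.mul_smul, Matrix.mul_sub, smul_add, smul_sub,
        Matrix.mul_assoc]
      abel
    rw [e, norm_smul, Complex.norm_I, one_mul]
    refine (norm_add_le _ _).trans ?_
    linarith
  · exact (h.comm _ _ _ _ huv.symm).trans (by linarith)

/-- Most cases are exact because the reflections square to one. Only `Y * X` and `Z * X` need the
anticommutation, as `Y` is written in the order `X`, `Z`. -/
theorem ApproxPauli.merge_letter (h : ApproxPauli Ψ δ O) (u : Fin n) (c : Bool) (p : Pauli) :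
    ‖letter (O u) p * O u c * Ψ - (p.phase (xz c) • letter (O u) (p.mul (xz c))) * Ψ‖
      ≤ 4 * δ := by
  have h0 := h.nonneg u
  have h1 := h.anti u
  have hX := (h.refl u false).sq
  have hZ := (h.refl u true).sq
  cases c <;> cases p <;> simp only [xz, Pauli.phase, Pauli.mul, letter]
  · simpa using h0
  · simpa [hX] using h0
  · have h3 := (h.refl u false).contr.norm_mul_le
      (O u true * O u false * Ψ + O u false * O u true * Ψ)
    have e : (Complex.I • (O u false * O u true)) * O u false * Ψ - (-Complex.I • O u true) * Ψ
        = Complex.I • (O u false * (O u true * O u false * Ψ + O u false * O u true * Ψ)) := by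
      simp only [Matrix.mul_add, ← Matrix.mul_assoc, hX, Matrix.smul_mul, Matrix.one_mul,
        smul_add, neg_smul, Matrix.neg_mul, sub_neg_eq_add]
    rw [e, norm_smul, Complex.norm_I, one_mul]
    linarith
  · have e : O u true * O u false * Ψ - (Complex.I • Complex.I • (O u false * O u true)) * Ψ
        = O u true * O u false * Ψ + O u false * O u true * Ψ := by
      rw [smul_smul, Complex.I_mul_I]; simp
    rw [e]
    exact h1
  · simpa using h0
  · rw [smul_smul]
    simpa using h0
  · simpa [Matrix.mul_assoc, hZ, ← Matrix.mul_assoc (O u true) (O u true)] using h0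
  · simpa [hZ] using h0

theorem ApproxPauli.comm_word (h : ApproxPauli Ψ δ O) (u : Fin n) (c : Bool) (g : Fin n → Pauli)
    (l : List (Fin n)) (hu : u ∉ l) :
    ‖word O g l * O u c * Ψ - O u c * word O g l * Ψ‖
      ≤ l.length * (26 * δ + 4 * (l.length * δ)) := by
  have h0 := h.nonneg u
  have := norm_list_prod_intertwine (Ψ := Ψ) l (h.refl u c).contr
    (fun v => letter (O v) (g v)) (fun v => letter (O v) (g v))
    (fun v _ => h.contr_letter v _) (fun v _ => h.contr_letter v _)
    (fun v _ => h.mov_letter v _) (by linarith)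
    (fun v hv => h.comm_letter (ne_of_mem_of_not_mem hv hu).symm c (g v))
  refine this.trans (le_of_eq ?_)
  ring

/-- The extra operator travels from the right end of the word through the letters of other qubits
(`comm_word`) until it meets the letter at `u`, where it is absorbed. The letters to the left of
that place are contractions and do no harm. -/
theorem ApproxPauli.merge_word (h : ApproxPauli Ψ δ O) (u : Fin n) (c : Bool) (g : Fin n → Pauli)
    (l : List (Fin n)) (hl : l.Nodup) (hu : u ∈ l) :
    ‖word O g l * O u c * Ψ - ((g u).phase (xz c) •
        word O (Function.update g u ((g u).mul (xz c))) l) * Ψ‖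
      ≤ l.length * (26 * δ + 4 * (l.length * δ)) + 4 * δ + 4 * (l.length * δ) := by
  have h0 := h.nonneg u
  induction l with
  | nil => simp at hu
  | cons v l ih =>
    have hw : ∀ g, word O g (v :: l) = letter (O v) (g v) * word O g l := by simp [word]
    have hl0 : (0 : ℝ) ≤ l.length := by positivity
    have hp : 0 ≤ (l.length : ℝ) * δ := by positivity
    rw [List.nodup_cons] at hl
    by_cases hv : v = u
    · subst hv
      have h1 := h.comm_word v c g l hl.1
      have h2 := (h.mov_word g l).subst ((h.contr_letter v (g v)).mul (h.refl v c).contr)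
        ((h.contr_letter v _).smul (Pauli.norm_phase _ _)) (h.merge_letter v c (g v))
      have h3 := (h.contr_letter v (g v)).norm_mul_le
        (word O g l * O v c * Ψ - O v c * word O g l * Ψ)
      have e : word O (Function.update g v ((g v).mul (xz c))) l = word O g l := by
        unfold word
        congr 1
        refine List.map_congr_left fun w hw => ?_
        rw [Function.update_of_ne (ne_of_mem_of_not_mem hw hl.1)]
      rw [hw, hw, e, Function.update_self]
      refine (norm_sub_le_norm_sub_add_norm_sub _
        (letter (O v) (g v) * O v c * word O g l * Ψ) _).trans ?_
      rw [← Matrix.smul_mul]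
      have e1 : letter (O v) (g v) * word O g l * O v c * Ψ
          - letter (O v) (g v) * O v c * word O g l * Ψ
          = letter (O v) (g v) * (word O g l * O v c * Ψ - O v c * word O g l * Ψ) := by
        simp only [Matrix.mul_sub, Matrix.mul_assoc]
      rw [e1]
      push_cast [List.length_cons]
      nlinarith
    · have hul : u ∈ l := by simpa [Ne.symm hv] using hu
      have ih := ih hl.2 hul
      rw [hw, hw, Function.update_of_ne hv]
      have e : letter (O v) (g v) * word O g l * O u c * Ψ - ((g u).phase (xz c) •
          (letter (O v) (g v) * word O (Function.update g u ((g u).mul (xz c))) l)) * Ψ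
          = letter (O v) (g v) * (word O g l * O u c * Ψ - ((g u).phase (xz c) •
            word O (Function.update g u ((g u).mul (xz c))) l) * Ψ) := by
        simp only [Matrix.mul_sub, Matrix.mul_assoc, Matrix.smul_mul, Matrix.mul_smul]
      rw [e]
      refine ((h.contr_letter v _).norm_mul_le _).trans (ih.trans ?_)
      push_cast [List.length_cons]
      nlinarith

/-- The isometry that extracts `n` qubits from approximate Pauli operators. -/
def extract (O : Fin n → Bool → Matrix m m ℂ) :
    Matrix ((Fin n → Fin 2) × ((Fin n → Fin 2) × m)) m ℂ :=
  pauliAvg fun g => word O g (List.finRange n)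

theorem extract_isometry (h : ∀ u c, IsRefl (O u c)) : (extract O)ᴴ * extract O = 1 :=
  pauliAvg_isometry fun g => word_isometry h g _

/-- Both sides are averages over `g`: on the left the label is multiplied by the letter, on the
right the word is. `merge_word` compares them for each `g`; with length `n ≥ 1` its terms add up to
at most `26 + 4 + 4 + 4 = 38` times `n ^ 2 * δ`. -/
theorem ApproxPauli.extract (h : ApproxPauli Ψ δ O) (u : Fin n) (c : Bool) :
    ‖Matrix.kronecker (pauliOp (at1 u (xz c)))
        (1 : Matrix ((Fin n → Fin 2) × m) ((Fin n → Fin 2) × m) ℂ) * extract O * Ψ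
      - extract O * O u c * Ψ‖ ≤ 38 * n ^ 2 * δ := by
  have h0 := h.nonneg u
  have hn : (1 : ℝ) ≤ n := by exact_mod_cast u.pos
  rw [StabGame.extract, kronecker_at1_mul_pauliAvg, Matrix.mul_assoc, pauliAvg_mul, pauliAvg_mul,
    pauliAvg_sub]
  refine norm_pauliAvg_le (by positivity) fun g => ?_
  have := h.merge_word u c g (List.finRange n) (List.nodup_finRange n) (List.mem_finRange u)
  rw [List.length_finRange] at this
  rw [norm_sub_rev, ← Matrix.mul_assoc]
  refine this.trans ?_
  have h1 : (n : ℝ) * δ ≤ n * (n * δ) := by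
    have : 0 ≤ (n : ℝ) * δ := by positivity
    nlinarith
  have h2 : δ ≤ n * δ := by nlinarith
  nlinarith

end Words

/-! ### Dilation of measurements -/

section Naimark

variable {β m : Type*} [Fintype β] [DecidableEq β] [Fintype m] [DecidableEq m]

/-- The sign `(-1)^(f b)` on the block `b`. -/
def blockSign (m : Type*) [DecidableEq m] (f : β → ZMod 2) : Matrix (β × m) (β × m) ℂ :=
  Matrix.diagonal fun x => sgn (f x.1)

/-- The projection onto the block `b`. -/
def blockProj (m : Type*) [DecidableEq m] (b : β) : Matrix (β × m) (β × m) ℂ :=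
  Matrix.diagonal fun x => if x.1 = b then 1 else 0

/-- The isometry stacks factors `B b` with `(B b)ᴴ * B b = M b`; functions of the outcome become
diagonal matrices on the blocks and thus commute. -/
theorem exists_naimark (M : β → Matrix m m ℂ) (hM : ∀ b, (M b).PosSemidef) (hsum : ∑ b, M b = 1) :
    ∃ K : Matrix (β × m) m ℂ, Kᴴ * K = 1 ∧
      ∀ w : β → ℂ, Kᴴ * Matrix.diagonal (fun x : β × m => w x.1) * K = ∑ b, w b • M b := by
  choose B hB using fun b => exists_conjTranspose_mul_self (hM b)
  have key : ∀ w : β → ℂ, (Matrix.of fun (x : β × m) q => B x.1 x.2 q)ᴴ *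
      Matrix.diagonal (fun x : β × m => w x.1) * (Matrix.of fun (x : β × m) q => B x.1 x.2 q)
        = ∑ b, w b • M b := by
    intro w
    ext p q
    rw [Matrix.sum_apply, Matrix.mul_apply, Fintype.sum_prod_type]
    refine Finset.sum_congr rfl fun b _ => ?_
    rw [Matrix.smul_apply, ← hB, Matrix.mul_apply, smul_eq_mul, Finset.mul_sum]
    refine Finset.sum_congr rfl fun y _ => ?_
    rw [Matrix.mul_diagonal]
    simp only [Matrix.conjTranspose_apply, Matrix.of_apply]
    ring
  refine ⟨_, ?_, key⟩
  have := key fun _ => 1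
  rw [Matrix.diagonal_one, Matrix.mul_one] at this
  rw [this]
  simpa using hsum

theorem isRefl_blockSign (f : β → ZMod 2) : IsRefl (blockSign m f) := by
  constructor
  · rw [blockSign, Matrix.diagonal_conjTranspose]
    congr 1
    funext x
    exact star_sgn _
  · rw [blockSign, Matrix.diagonal_mul_diagonal]
    simp_rw [sgn_mul_self]
    exact Matrix.diagonal_one

theorem blockSign_mul (f g : β → ZMod 2) :
    blockSign m f * blockSign m g = blockSign m fun b => f b + g b := by
  rw [blockSign, blockSign, Matrix.diagonal_mul_diagonal, blockSign]
  simp_rw [sgn_add]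

theorem blockSign_list_prod {ι : Type*} (l : List ι) (f : ι → β → ZMod 2) :
    (l.map fun j => blockSign m (f j)).prod = blockSign m fun b => (l.map fun j => f j b).sum := by
  induction l with
  | nil => simp [blockSign, sgn_zero]
  | cons j l ih => simp only [List.map_cons, List.prod_cons, ih, blockSign_mul, List.sum_cons]

theorem half_blockSign (f : β → ZMod 2) (s : ZMod 2) :
    half (blockSign m f) s = Matrix.diagonal fun x => if f x.1 = s then 1 else 0 := by
  unfold half blockSign
  rw [← Matrix.diagonal_one, ← Matrix.diagonal_smul, Matrix.diagonal_add, ← Matrix.diagonal_smul]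
  congr 1
  funext x
  simp only [Pi.smul_apply, smul_eq_mul]
  rcases bit_eq_zero_or_one (f x.1) with h | h <;> rcases bit_eq_zero_or_one s with h' | h' <;>
    simp [h, h', sgn_zero, sgn_one] <;> norm_num

theorem half_blockSign_list_prod {ι : Type*} (l : List ι) (f : ι → β → ZMod 2) (s : ι → ZMod 2) :
    (l.map fun j => half (blockSign m (f j)) (s j)).prod
      = Matrix.diagonal fun x => if ∀ j ∈ l, f j x.1 = s j then 1 else 0 := by
  induction l with
  | nil => simp
  | cons j l ih =>
    rw [List.map_cons, List.prod_cons, ih, half_blockSign, Matrix.diagonal_mul_diagonal]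
    congr 1
    funext x
    by_cases h : f j x.1 = s j <;> simp [h]

end Naimark

/-! ### Observables of a strategy -/

section Observables

variable {n k : ℕ} {d : Fin 8 → ℕ} (S : Strategy n k d)

theorem Strategy.isRefl (i : Fin 8) (P : XZPauli n k) : IsRefl (S.R i P) :=
  ⟨S.R_herm i P, S.R_sq i P⟩

theorem Strategy.meas_posSemidef (i : Fin 8) (q : Question n k) (a : Answer q) :
    (S.meas i q a).PosSemidef := by
  cases q with
  | single P =>
    have h : ∀ a : ZMod 2, (half (S.R i P) a).PosSemidef := by
      intro a
      have h := Matrix.posSemidef_conjTranspose_mul_self (half (S.R i P) a)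
      rwa [(S.isRefl i P).half_herm, (S.isRefl i P).half_sq] at h
    exact h a
  | multi Q => exact S.M_pos i Q a

theorem Strategy.meas_sum (i : Fin 8) (q : Question n k) : ∑ a, S.meas i q a = 1 := by
  cases q with
  | single P =>
    change ∑ a : ZMod 2, half (S.R i P) a = 1
    have : ∑ a : ZMod 2, half (S.R i P) a = half (S.R i P) 0 + half (S.R i P) 1 :=
      Fin.sum_univ_two _
    rw [this, half, half, sgn_zero, sgn_one]
    module
  | multi Q => exact S.M_sum i Q

/-- The observable of the condensed answer bit. -/
def Strategy.obs (i : Fin 8) (w : Query n k) : Matrix (Fin (d i)) (Fin (d i)) ℂ :=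
  ∑ a, sgn (w.bit a) • S.meas i w.q a

theorem Strategy.obs_ask (i : Fin 8) (P : XZPauli n k) : S.obs i (Query.ask P) = S.R i P := by
  change ∑ a : ZMod 2, sgn a • half (S.R i P) a = _
  have : ∑ a : ZMod 2, sgn a • half (S.R i P) a
      = sgn 0 • half (S.R i P) 0 + sgn 1 • half (S.R i P) 1 := Fin.sum_univ_two _
  rw [this, half, half, sgn_zero, sgn_one]
  module

/-- Behind a dilation the observable becomes a diagonal reflection, so it is a compression of a
unitary. -/
theorem Strategy.contr_obs (i : Fin 8) (w : Query n k) : Contr (S.obs i w) := by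
  classical
  obtain ⟨K, hK, hw⟩ := exists_naimark (S.meas i w.q) (S.meas_posSemidef i w.q) (S.meas_sum i w.q)
  have h : S.obs i w = Kᴴ * blockSign (Fin (d i)) w.bit * K := (hw fun a => sgn (w.bit a)).symm
  rw [h]
  exact ((contr_conjTranspose_of_isometry hK).mul (isRefl_blockSign _).contr).mul
    (contr_of_isometry hK)

/-- The indicator of a parity is `(1 + sign) / 2`, and the sign factorizes over the players. -/
theorem Strategy.acceptProb_eq (w : Fin 8 → Query n k) (s : ZMod 2) :
    S.acceptProb w s
      = (1 + (sgn s * ((tensor fun i => S.obs i (w i)) * S.ρ).trace).re) / 2 := by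
  have h1 : ∑ a : ∀ i, Answer (w i).q, ((tensor fun i => S.meas i (w i).q (a i)) * S.ρ).trace
      = 1 := by
    rw [← Matrix.trace_sum, ← Finset.sum_mul, ← tensor_sum]
    simp_rw [S.meas_sum]
    rw [tensor_one, Matrix.one_mul, S.ρ_trace]
  have h2 : ∑ a : ∀ i, Answer (w i).q, sgn (∑ i, (w i).bit (a i)) *
      ((tensor fun i => S.meas i (w i).q (a i)) * S.ρ).trace
      = ((tensor fun i => S.obs i (w i)) * S.ρ).trace := by
    unfold Strategy.obs
    rw [tensor_sum, Finset.sum_mul, Matrix.trace_sum]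
    refine Finset.sum_congr rfl fun a _ => ?_
    rw [tensor_smul, sgn_sum, Matrix.smul_mul, Matrix.trace_smul, smul_eq_mul]
  have h3 : ∀ (t : ZMod 2) (z : ℂ),
      (if t = s then z.re else 0) = (z.re + (sgn s * (sgn t * z)).re) / 2 := by
    intro t z
    rcases bit_eq_zero_or_one t with rfl | rfl <;> rcases bit_eq_zero_or_one s with rfl | rfl <;>
      simp [sgn_zero, sgn_one]
  unfold Strategy.acceptProb
  simp_rw [h3]
  rw [← Finset.sum_div, Finset.sum_add_distrib, ← Complex.re_sum, ← Complex.re_sum, h1,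
    ← Finset.mul_sum, h2, Complex.one_re]

/-- The state as a matrix `ψ` with `ρ = ψ ψᴴ`. -/
theorem Strategy.exists_purification :
    ∃ ψ : Matrix (∀ i, Fin (d i)) (∀ i, Fin (d i)) ℂ, S.ρ = ψ * ψᴴ ∧ ‖ψ‖ = 1 := by
  obtain ⟨B, hB⟩ := exists_conjTranspose_mul_self S.ρ_pos
  refine ⟨Bᴴ, by rw [Matrix.conjTranspose_conjTranspose, hB], ?_⟩
  rw [Matrix.frobenius_norm_conjTranspose,
    ← sq_eq_sq₀ (norm_nonneg _) zero_le_one, frobenius_norm_sq, hB, S.ρ_trace]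
  simp

theorem trace_mul_mul_conjTranspose {a b : Type*} [Fintype a] [Fintype b] (A : Matrix a a ℂ)
    (ψ : Matrix a b ℂ) : (A * (ψ * ψᴴ)).trace = (ψᴴ * (A * ψ)).trace := by
  rw [← Matrix.mul_assoc, Matrix.trace_mul_comm]

theorem Strategy.abs_trace_obs_le (w : Fin 8 → Query n k) (s : ZMod 2) :
    |(sgn s * ((tensor fun i => S.obs i (w i)) * S.ρ).trace).re| ≤ 1 := by
  obtain ⟨ψ, hρ, hψ⟩ := S.exists_purification
  have hT : ‖(tensor fun i => S.obs i (w i)) * ψ‖ ≤ 1 :=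
    ((contr_tensor fun i => S.contr_obs i (w i)).norm_mul_le ψ).trans hψ.le
  have h1 := trace_conjTranspose_mul_re_le ψ ((tensor fun i => S.obs i (w i)) * ψ)
  have h2 := trace_conjTranspose_mul_re_le (-ψ) ((tensor fun i => S.obs i (w i)) * ψ)
  rw [Matrix.conjTranspose_neg, Matrix.neg_mul, Matrix.trace_neg, Complex.neg_re, norm_neg] at h2
  rw [hψ, one_mul] at h1 h2
  rw [hρ, trace_mul_mul_conjTranspose, abs_le]
  rcases bit_eq_zero_or_one s with rfl | rfl
  · rw [sgn_zero, one_mul]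
    constructor <;> linarith
  · rw [sgn_one, neg_one_mul, Complex.neg_re]
    constructor <;> linarith

theorem Strategy.acceptProb_nonneg (w : Fin 8 → Query n k) (s : ZMod 2) :
    0 ≤ S.acceptProb w s := by
  rw [S.acceptProb_eq]
  linarith [(abs_le.1 (S.abs_trace_obs_le w s)).1]

theorem Strategy.acceptProb_le_one (w : Fin 8 → Query n k) (s : ZMod 2) :
    S.acceptProb w s ≤ 1 := by
  rw [S.acceptProb_eq]
  linarith [(abs_le.1 (S.abs_trace_obs_le w s)).2]

/-- The condensed answers to the queries `w` have parity `s` up to the bias `η`. -/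
def Strategy.Near (η : ℝ) (w : Fin 8 → Query n k) (s : ZMod 2) : Prop :=
  1 - η ≤ (sgn s * ((tensor fun i => S.obs i (w i)) * S.ρ).trace).re

theorem Strategy.near_of_acceptProb {w : Fin 8 → Query n k} {s : ZMod 2} {η : ℝ}
    (h : 1 - η ≤ S.acceptProb w s) : S.Near (2 * η) w s := by
  rw [S.acceptProb_eq] at h
  unfold Strategy.Near
  linarith

end Observables

/-! ### From the value of the game to the single questions -/

theorem expect_le_one {ι : Type*} [Fintype ι] {f : ι → ℝ} (h : ∀ x, f x ≤ 1) : 𝔼 x, f x ≤ 1 := by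
  rw [Fintype.expect_eq_sum_div_card]
  refine div_le_one_of_le₀ ?_ (by positivity)
  calc ∑ x, f x ≤ ∑ _x : ι, (1 : ℝ) := Finset.sum_le_sum fun x _ => h x
    _ = Fintype.card ι := by simp

/-- All other terms are at most one, so the whole deficit of the average may sit in a single term.
Applied along the nested averages, this multiplies the deficit by the number of questions. -/
theorem le_of_le_expect {ι : Type*} [Fintype ι] {f : ι → ℝ} (h : ∀ x, f x ≤ 1) {η : ℝ}
    (hf : 1 - η ≤ 𝔼 x, f x) (x : ι) : 1 - Fintype.card ι * η ≤ f x := by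
  classical
  have hc : (0 : ℝ) < Fintype.card ι := by
    exact_mod_cast Fintype.card_pos_iff.2 ⟨x⟩
  rw [Fintype.expect_eq_sum_div_card, le_div_iff₀ hc,
    ← Finset.add_sum_erase _ _ (Finset.mem_univ x)] at hf
  have h1 : ∑ y ∈ Finset.univ.erase x, f y ≤ ∑ _y ∈ Finset.univ.erase x, (1 : ℝ) :=
    Finset.sum_le_sum fun y _ => h y
  rw [Finset.sum_const, Finset.card_erase_of_mem (Finset.mem_univ x), Finset.card_univ,
    nsmul_eq_mul, mul_one, Nat.cast_sub (by exact_mod_cast hc)] at h1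
  push_cast at h1
  linarith

theorem expect_nonneg' {ι : Type*} [Fintype ι] {f : ι → ℝ} (h : ∀ x, 0 ≤ f x) : 0 ≤ 𝔼 x, f x := by
  rw [Fintype.expect_eq_sum_div_card]
  exact div_nonneg (Finset.sum_nonneg fun x _ => h x) (by positivity)

/-- Every single question of the game is answered correctly up to the bias `η`. -/
structure Strategy.AllNear {n k : ℕ} {d : Fin 8 → ℕ} (hk : 2 ≤ k) (S : Strategy n k d) (η : ℝ) :
    Prop where
  stab : ∀ (u : Fin n) (ξ : Xi),
    S.Near η (fun i => Query.ask (weightOne hk u (ξ.1.2 i) (ξ.ne_Y i))) ξ.1.1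
  conf : ∀ (J : {J : Finset (Fin n) // J.card = k}) (u : {v // v ∈ J.1}) (t : Fin 8)
    (ξ : {v // v ∈ J.1} → Xi), S.Near η (fun i =>
        if i = t then
          Query.askIn ((confString J ξ t).split hk)
            ((confString J ξ t).elem hk u.1 (mem_supp_confString J ξ t u))
        else Query.ask (weightOne hk u.1 ((ξ u).1.2 i) ((ξ u).ne_Y i)))
      (ξ u).1.1
  parity : ∀ (P : XZPauli n k) (t : Fin 8) (F : Extension P), S.Near η (fun i =>
      if i = t then Query.ask P
      else Query.parity (F.1.split hk) fun v : {v // v ∈ supp P.1} =>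
        F.1.elem hk v.1 (F.mem_supp v))
    0
  pauli : ∀ (Q : PauliSet n k) (P : {P // P ∈ Q.1}) (t : Fin 8),
    S.Near η (fun i => if i = t then Query.askIn Q P else Query.ask P.1) 0

/-- A string of weight at most `k` is determined by `k` positions that cover its support and the
letters at these positions. -/
theorem card_XZPauli_le {n k : ℕ} (hn : k ≤ n) :
    Fintype.card (XZPauli n k) ≤ (4 * n) ^ k := by
  have h : ∀ P : XZPauli n k, ∃ e : Fin k → Fin n, ∀ v ∈ supp P.1, ∃ j, e j = v := by
    intro P
    obtain ⟨J, hJ, hc⟩ := Finset.exists_superset_card_eq P.2.2 (by simpa using hn)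
    refine ⟨fun j => J.orderEmbOfFin hc j, fun v hv => ?_⟩
    have : v ∈ Set.range (J.orderEmbOfFin hc) := by
      rw [Finset.range_orderEmbOfFin]; exact hJ hv
    exact this
  choose e he using h
  have hinj : Function.Injective fun P : XZPauli n k => fun j => (P.1 (e P j), e P j) := by
    intro P P' hPP
    have hpt : ∀ j, P.1 (e P j) = P'.1 (e P' j) ∧ e P j = e P' j := fun j =>
      Prod.ext_iff.1 (congrFun hPP j)
    apply Subtype.ext
    funext v
    by_cases hv : v ∈ supp P.1
    · obtain ⟨j, rfl⟩ := he P v hv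
      rw [(hpt j).1, (hpt j).2]
    · by_cases hv' : v ∈ supp P'.1
      · obtain ⟨j, rfl⟩ := he P' v hv'
        rw [← (hpt j).1, (hpt j).2]
      · rw [mem_supp, not_not] at hv hv'
        rw [hv, hv']
  refine (Fintype.card_le_of_injective _ hinj).trans (le_of_eq ?_)
  rw [Fintype.card_fun, Fintype.card_prod, Fintype.card_fin, Fintype.card_fin]
  rfl

theorem card_Extension_le {n k : ℕ} (hn : k ≤ n) (P : XZPauli n k) :
    Fintype.card (Extension P) ≤ (4 * n) ^ k := by
  refine le_trans (Fintype.card_le_of_injective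
    (fun F : Extension P => (⟨F.1.1, F.1.2.1, F.1.2.2.le⟩ : XZPauli n k)) ?_) (card_XZPauli_le hn)
  intro F F' h
  exact Subtype.ext (Subtype.ext (Subtype.mk.inj h))

theorem card_PauliSet_le {n k : ℕ} (hn : k ≤ n) :
    Fintype.card (PauliSet n k) ≤ ((4 * n) ^ k) ^ k := by
  have h1 : Fintype.card (PauliSet n k)
      ≤ ((Finset.univ : Finset (XZPauli n k)).powersetCard k).card := by
    rw [← Fintype.card_coe]
    refine Fintype.card_le_of_injective
      (fun Q => ⟨Q.1, Finset.mem_powersetCard.2 ⟨Finset.subset_univ _, Q.2.1⟩⟩) ?_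
    intro Q Q' h
    exact Subtype.ext (Subtype.mk.inj h)
  rw [Finset.card_powersetCard] at h1
  exact h1.trans ((Nat.choose_le_pow _ _).trans (Nat.pow_le_pow_left
    (by simpa using card_XZPauli_le hn) _))

theorem card_subsets_le (n k : ℕ) :
    Fintype.card {J : Finset (Fin n) // J.card = k} ≤ n ^ k := by
  have : Fintype.card {J : Finset (Fin n) // J.card = k} = n.choose k := by
    simp [Fintype.card_finset_len]
  rw [this]
  exact Nat.choose_le_pow _ _

/-- A bound for the number of questions of the game. -/
def numQuestions (n k : ℕ) : ℕ := 8 * k * (4 * (Fintype.card Xi + 1) * n) ^ (2 * k + k * k)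

section Leaves

variable {n k : ℕ} {d : Fin 8 → ℕ} (S : Strategy n k d) (hk : 2 ≤ k)

theorem Strategy.stabCheck_le_one : S.stabCheck hk ≤ 1 :=
  expect_le_one fun _ => expect_le_one fun _ => S.acceptProb_le_one _ _

theorem Strategy.confCheck_le_one : S.confCheck hk ≤ 1 :=
  expect_le_one fun _ => expect_le_one fun _ => expect_le_one fun _ => expect_le_one fun _ =>
    S.acceptProb_le_one _ _

theorem Strategy.parityCheck_le_one : S.parityCheck hk ≤ 1 :=
  expect_le_one fun _ => expect_le_one fun _ => expect_le_one fun _ => S.acceptProb_le_one _ _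

theorem Strategy.pauliCheck_le_one : S.pauliCheck ≤ 1 :=
  expect_le_one fun _ => expect_le_one fun _ => expect_le_one fun _ => S.acceptProb_le_one _ _

theorem Strategy.value_nonneg : 0 ≤ S.value hk := by
  have h1 : 0 ≤ S.stabCheck hk :=
    expect_nonneg' fun _ => expect_nonneg' fun _ => S.acceptProb_nonneg _ _
  have h2 : 0 ≤ S.confCheck hk :=
    expect_nonneg' fun _ => expect_nonneg' fun _ => expect_nonneg' fun _ => expect_nonneg' fun _ =>
      S.acceptProb_nonneg _ _
  have h3 : 0 ≤ S.parityCheck hk :=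
    expect_nonneg' fun _ => expect_nonneg' fun _ => expect_nonneg' fun _ => S.acceptProb_nonneg _ _
  have h4 : 0 ≤ S.pauliCheck :=
    expect_nonneg' fun _ => expect_nonneg' fun _ => expect_nonneg' fun _ => S.acceptProb_nonneg _ _
  unfold Strategy.value
  linarith

/-- The factor `8` is `4` for choosing one of the four tests times `2` for passing from probability
to bias. -/
theorem Strategy.near_of_le {w : Fin 8 → Query n k} {s : ZMod 2} {N N' : ℕ} {ε η : ℝ} (hε : 0 ≤ ε)
    (h : 1 - η ≤ S.acceptProb w s) (hη : η = N * (4 * ε)) (hN : N ≤ N') :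
    S.Near (8 * N' * ε) w s := by
  have h1 : (N : ℝ) ≤ N' := by exact_mod_cast hN
  have h2 : (N : ℝ) * ε ≤ N' * ε := by gcongr
  have h3 := S.near_of_acceptProb h
  unfold Strategy.Near at h3 ⊢
  subst hη
  linarith

theorem Strategy.allNear_of_value {ε : ℝ} (hn : k ≤ n) (hε : 0 ≤ ε) (hS : 1 - ε ≤ S.value hk) :
    S.AllNear hk (8 * numQuestions n k * ε) := by
  have b1 := S.stabCheck_le_one hk
  have b2 := S.confCheck_le_one hk
  have b3 := S.parityCheck_le_one hk
  have b4 := S.pauliCheck_le_one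
  unfold Strategy.value at hS
  have hn1 : 1 ≤ n := by omega
  have hk1 : 1 ≤ k := by omega
  have hkk : 1 ≤ 8 * k := by omega
  have hx : Fintype.card Xi ≤ Fintype.card Xi + 1 := Nat.le_succ _
  -- The added one keeps the base at least one without knowing that `Ξ` has elements, so that powers
  -- with different exponents can be compared.
  have hx1 : 1 ≤ Fintype.card Xi + 1 := Nat.le_add_left _ _
  have hnum : numQuestions n k = 8 * k * (4 * (Fintype.card Xi + 1) * n) ^ (2 * k + k * k) := rfl
  generalize Fintype.card Xi + 1 = x at hx hx1 hnum
  have hy1 : 1 ≤ 4 * x * n := Nat.mul_pos (by omega) hn1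
  have hnx : n * x ≤ 4 * x * n := by nlinarith
  have h4n : 4 * n ≤ 4 * x * n := by nlinarith
  rw [hnum]
  refine ⟨fun u ξ => ?_, fun J u t ξ => ?_, fun P t F => ?_, fun Q P t => ?_⟩
  · have h0 : 1 - 4 * ε ≤ S.stabCheck hk := by linarith
    have h1 := le_of_le_expect
      (fun _ => expect_le_one fun _ => S.acceptProb_le_one _ _) h0 u
    have h2 := le_of_le_expect (fun _ => S.acceptProb_le_one _ _) h1 ξ
    refine S.near_of_le (N := n * Fintype.card Xi) hε h2 (by simp; ring) ?_
    calc n * Fintype.card Xi ≤ n * x := by gcongr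
      _ ≤ 4 * x * n := hnx
      _ ≤ (4 * x * n) ^ (2 * k + k * k) := Nat.le_self_pow (by positivity) _
      _ ≤ _ := Nat.le_mul_of_pos_left _ hkk
  · have h0 : 1 - 4 * ε ≤ S.confCheck hk := by linarith
    have h1 := le_of_le_expect (fun _ => expect_le_one fun _ => expect_le_one fun _ =>
      expect_le_one fun _ => S.acceptProb_le_one _ _) h0 J
    have h2 := le_of_le_expect (fun _ => expect_le_one fun _ => expect_le_one fun _ =>
      S.acceptProb_le_one _ _) h1 u
    have h3 := le_of_le_expect (fun _ => expect_le_one fun _ => S.acceptProb_le_one _ _) h2 t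
    have h4 := le_of_le_expect (fun _ => S.acceptProb_le_one _ _) h3 ξ
    refine S.near_of_le (N := Fintype.card Xi ^ k * (8 * (k *
      Fintype.card {J : Finset (Fin n) // J.card = k}))) hε h4 ?_ ?_
    · rw [Fintype.card_fun, Fintype.card_coe, J.2, Fintype.card_fin]
      push_cast
      ring
    · calc Fintype.card Xi ^ k * (8 * (k * Fintype.card {J : Finset (Fin n) // J.card = k}))
          ≤ x ^ k * (8 * (k * n ^ k)) := by
            gcongr
            exact card_subsets_le n k
        _ = 8 * k * (n * x) ^ k := by rw [mul_pow]; ring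
        _ ≤ 8 * k * (4 * x * n) ^ k := by gcongr
        _ ≤ _ := by gcongr; nlinarith
  · have h0 : 1 - 4 * ε ≤ S.parityCheck hk := by linarith
    have h1 := le_of_le_expect (fun _ => expect_le_one fun _ => expect_le_one fun _ =>
      S.acceptProb_le_one _ _) h0 P
    have h2 := le_of_le_expect (fun _ => expect_le_one fun _ => S.acceptProb_le_one _ _) h1 t
    have h3 := le_of_le_expect (fun _ => S.acceptProb_le_one _ _) h2 F
    refine S.near_of_le (N := Fintype.card (Extension P) * (8 * Fintype.card (XZPauli n k)))
      hε h3 ?_ ?_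
    · rw [Fintype.card_fin]
      push_cast
      ring
    · calc Fintype.card (Extension P) * (8 * Fintype.card (XZPauli n k))
          ≤ (4 * n) ^ k * (8 * (4 * n) ^ k) := by
            gcongr
            exacts [card_Extension_le hn P, card_XZPauli_le hn]
        _ = 8 * 1 * (4 * n) ^ (2 * k) := by rw [two_mul k, pow_add]; ring
        _ ≤ 8 * k * (4 * x * n) ^ (2 * k) := by gcongr
        _ ≤ _ := by gcongr; nlinarith
  · have h0 : 1 - 4 * ε ≤ S.pauliCheck := by linarith
    have h1 := le_of_le_expect (fun _ => expect_le_one fun _ => expect_le_one fun _ =>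
      S.acceptProb_le_one _ _) h0 Q
    have h2 := le_of_le_expect (fun _ => expect_le_one fun _ => S.acceptProb_le_one _ _) h1 P
    have h3 := le_of_le_expect (fun _ => S.acceptProb_le_one _ _) h2 t
    refine S.near_of_le (N := 8 * (k * Fintype.card (PauliSet n k))) hε h3 ?_ ?_
    · rw [Fintype.card_fin, Fintype.card_coe, Q.2.1]
      push_cast
      ring
    · calc 8 * (k * Fintype.card (PauliSet n k)) ≤ 8 * (k * ((4 * n) ^ k) ^ k) := by
            gcongr
            exact card_PauliSet_le hn
        _ = 8 * k * (4 * n) ^ (k * k) := by rw [← pow_mul]; ring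
        _ ≤ 8 * k * (4 * x * n) ^ (k * k) := by gcongr
        _ ≤ _ := by gcongr; nlinarith

end Leaves

/-! ### Elements of the stabilizer -/

theorem pauliOp_gen_mem (j : Fin 6) : pauliOp (gen j) ∈ stabilizer :=
  Submonoid.subset_closure ⟨j, rfl⟩

/-- The pattern of `X`s with `Z`s on the `p`-th pair. -/
def pairZ (p : Fin 4) (i : Fin 8) : Pauli := if i.val / 2 = p.val then .Z else .X

/-- The pattern `XZXZXZXZ` with the `p`-th pair exchanged. -/
def pairSwap (p : Fin 4) (i : Fin 8) : Pauli :=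
  if (i.val % 2 = 0) = (i.val / 2 = p.val) then .Z else .X

/-- The generator `YY` on the `p`-th pair. -/
def pairGen (p : Fin 4) : Fin 6 := ⟨p.val + 2, by omega⟩

/-- On the pair `X * Y = i Z` occurs twice, and `i ^ 2 = -1`. This minus sign is the source of the
anticommutation. -/
theorem gen_zero_mul_pairGen (p : Fin 4) :
    pauliOp (gen 0) * pauliOp (gen (pairGen p)) = sgn 1 • pauliOp (pairZ p) := by
  rw [pauliOp_mul, sgn_one]
  congr 1
  · fin_cases p <;> simp [Fin.prod_univ_eight, gen, pairGen, Pauli.phase]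
  · congr 1
    funext i
    fin_cases p <;> fin_cases i <;> rfl

/-- Here the phases of `X * Y` and `Z * Y` are `i` and `-i`; they cancel. -/
theorem gen_one_mul_pairGen (p : Fin 4) :
    pauliOp (gen 1) * pauliOp (gen (pairGen p)) = sgn 0 • pauliOp (pairSwap p) := by
  rw [pauliOp_mul, sgn_zero]
  congr 1
  · fin_cases p <;> simp [Fin.prod_univ_eight, gen, pairGen, Pauli.phase]
  · congr 1
    funext i
    fin_cases p <;> fin_cases i <;> rfl

theorem pauliOp_all_Z :
    pauliOp (gen 0) * (pauliOp (gen 2) * (pauliOp (gen 3) * (pauliOp (gen 4) * pauliOp (gen 5))))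
      = sgn 0 • pauliOp (fun _ => .Z) := by
  simp only [pauliOp_mul, Matrix.mul_smul, smul_smul, sgn_zero]
  congr 1
  simp [Fin.prod_univ_eight, gen, Pauli.phase, Pauli.mul]

/-- The element of `Ξ` with all letters equal to `xz c`. -/
def xiConst (c : Bool) : Xi :=
  ⟨(0, fun _ => xz c), by
    refine ⟨fun i => by cases c <;> simp [xz], ?_⟩
    cases c
    · have h : gen 0 = fun _ => xz false := by funext i; fin_cases i <;> rfl
      simpa only [sgn_zero, one_smul, h] using pauliOp_gen_mem 0
    · have h := pauliOp_all_Z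
      change sgn 0 • pauliOp (fun _ => Pauli.Z) ∈ stabilizer
      rw [← h]
      exact mul_mem (pauliOp_gen_mem 0) (mul_mem (pauliOp_gen_mem 2) (mul_mem (pauliOp_gen_mem 3)
        (mul_mem (pauliOp_gen_mem 4) (pauliOp_gen_mem 5))))⟩

/-- The element `XZXZXZXZ` of `Ξ`. -/
def xiGen : Xi :=
  ⟨(0, gen 1), by
    refine ⟨fun i => by fin_cases i <;> simp [gen], ?_⟩
    simpa only [sgn_zero, one_smul] using pauliOp_gen_mem 1⟩

/-- The element of `Ξ` with pattern `pairZ p`. -/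
def xiPairZ (p : Fin 4) : Xi :=
  ⟨(1, pairZ p), by
    refine ⟨fun i => by dsimp only [pairZ]; split_ifs <;> simp, ?_⟩
    change sgn 1 • pauliOp (pairZ p) ∈ stabilizer
    rw [← gen_zero_mul_pairGen]
    exact mul_mem (pauliOp_gen_mem _) (pauliOp_gen_mem _)⟩

/-- The element of `Ξ` with pattern `pairSwap p`. -/
def xiPairSwap (p : Fin 4) : Xi :=
  ⟨(0, pairSwap p), by
    refine ⟨fun i => by dsimp only [pairSwap]; split_ifs <;> simp, ?_⟩
    change sgn 0 • pauliOp (pairSwap p) ∈ stabilizer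
    rw [← gen_one_mul_pairGen]
    exact mul_mem (pauliOp_gen_mem _) (pauliOp_gen_mem _)⟩

/-- Two pairs of elements of `Ξ` whose products agree for all players but `i`, with opposite signs
and in the opposite order for player `i`. -/
theorem exists_xi_anticommute (i : Fin 8) : ∃ a b c d : Xi,
    a.1.2 i = .X ∧ b.1.2 i = .Z ∧ c.1.2 i = .X ∧ d.1.2 i = .Z ∧
    sgn b.1.1 * sgn a.1.1 = - (sgn c.1.1 * sgn d.1.1) ∧
    ∀ j, j ≠ i → (a.1.2 j = d.1.2 j ∧ b.1.2 j = c.1.2 j) ∨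
      (a.1.2 j = b.1.2 j ∧ c.1.2 j = d.1.2 j) := by
  have hs : sgn 1 * sgn 0 = - (sgn 0 * sgn 0) := by simp [sgn_zero, sgn_one]
  have hp : i.val / 2 < 4 := by omega
  by_cases hi : i.val % 2 = 0
  · refine ⟨xiConst false, xiPairZ ⟨i / 2, hp⟩, xiGen, xiPairSwap ⟨i / 2, hp⟩,
      ?_, ?_, ?_, ?_, hs, ?_⟩ <;>
    simp only [xiConst, xiPairZ, xiGen, xiPairSwap] <;> revert i <;> decide
  · refine ⟨xiConst false, xiPairZ ⟨i / 2, hp⟩, xiPairSwap ⟨i / 2, hp⟩, xiGen,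
      ?_, ?_, ?_, ?_, hs, ?_⟩ <;>
    simp only [xiConst, xiPairZ, xiGen, xiPairSwap] <;> revert i <;> decide

/-! ### Approximate Pauli relations for each player -/

section Local

variable {d : Fin 8 → ℕ} {E : Type*} [Fintype E] [DecidableEq E]
  {ψ : Matrix (∀ i, Fin (d i)) E ℂ}

/-- If a parity has small bias, the dilated observable of player `t` acts like the observables of
the other players. -/
theorem norm_dilated_sub_le (hψ : ‖ψ‖ = 1) {O : ∀ i, Matrix (Fin (d i)) (Fin (d i)) ℂ}
    (hO : ∀ i, Contr (O i)) {s : ZMod 2} {η : ℝ}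
    (h : 1 - η ≤ (sgn s * (tensor O * (ψ * ψᴴ)).trace).re) (t : Fin 8) {a : Type*} [Fintype a]
    [DecidableEq a] {K : Matrix a (Fin (d t)) ℂ} {N : Matrix a a ℂ} (hK : Kᴴ * K = 1)
    (hN : IsRefl N) (hOt : O t = Kᴴ * N * K) :
    ‖N * K * reshape t ψ - K * reshape t ψ * (sgn s • rightOp E t O)‖ ≤ Real.sqrt (2 * η) := by
  have e : reshape t ψ * rightOp E t O = reshape t (tensor (Function.update O t 1) * ψ) := by
    rw [reshape_tensor_mul, Function.update_self, Matrix.one_mul]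
    congr 1
    exact rightOp_congr fun j hj => by rw [Function.update_of_ne hj]
  refine norm_sub_le_of_trace ?_ ?_ ?_
  · rw [Matrix.mul_assoc]
    exact (hN.contr.norm_mul_le _).trans (by rw [norm_isometry_mul hK, norm_reshape, hψ])
  · rw [Matrix.mul_smul, norm_smul, norm_sgn, one_mul, Matrix.mul_assoc, norm_isometry_mul hK, e,
      norm_reshape]
    refine (Contr.norm_mul_le (contr_tensor fun j => ?_) ψ).trans hψ.le
    by_cases hj : j = t
    · subst hj; simpa using contr_one
    · rw [Function.update_of_ne hj]; exact hO j
  · rw [trace_mul_mul_conjTranspose, ← trace_reshape t, reshape_tensor_mul, hOt] at h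
    refine h.trans (le_of_eq ?_)
    rw [Matrix.mul_smul, Matrix.mul_smul, Matrix.trace_smul, smul_eq_mul, Matrix.conjTranspose_mul,
      Matrix.conjTranspose_mul, hN.herm]
    simp only [Matrix.mul_assoc]

/-- Replacing the operators of the other players one by one. -/
theorem norm_rightOp_sub_le {O O' : ∀ i, Matrix (Fin (d i)) (Fin (d i)) ℂ}
    (hO : ∀ i, Contr (O i)) (hO' : ∀ i, Contr (O' i)) (t : Fin 8) {β : ℝ} (hβ : 0 ≤ β)
    (h : ∀ i, i ≠ t → ‖O i * reshape i ψ - O' i * reshape i ψ‖ ≤ β) :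
    ‖reshape t ψ * rightOp E t O - reshape t ψ * rightOp E t O'‖ ≤ 8 * β := by
  have e : ∀ O : ∀ i, Matrix (Fin (d i)) (Fin (d i)) ℂ,
      reshape t ψ * rightOp E t O = reshape t (tensor (Function.update O t 1) * ψ) := by
    intro O
    rw [reshape_tensor_mul, Function.update_self, Matrix.one_mul]
    congr 1
    exact rightOp_congr fun j hj => by rw [Function.update_of_ne hj]
  have hc : ∀ O : ∀ i, Matrix (Fin (d i)) (Fin (d i)) ℂ, (∀ i, Contr (O i)) →
      ∀ i, Contr (Function.update O t 1 i) := by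
    intro O hO j
    by_cases hj : j = t
    · subst hj; simpa using contr_one
    · rw [Function.update_of_ne hj]; exact hO j
  rw [e, e, ← reshape_sub, norm_reshape]
  refine (norm_tensor_mul_sub_le (hc O' hO') (hc O hO) ψ (fun _ => β) fun j => ?_).trans
    (by simp)
  rw [← norm_reshape j, reshape_sub, reshape_loc_mul, reshape_loc_mul]
  by_cases hj : j = t
  · subst hj; simpa using hβ
  · rw [Function.update_of_ne hj, Function.update_of_ne hj]
    exact h j hj

end Local

section Players

variable {n k : ℕ} {d : Fin 8 → ℕ} (hk : 2 ≤ k) (S : Strategy n k d)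

/-- The reflection of player `i` for the weight-one operator `D_u`. -/
def Strategy.op (i : Fin 8) (u : Fin n) (D : Pauli) : Matrix (Fin (d i)) (Fin (d i)) ℂ :=
  -- The value at `Y` is a filler. It allows letters taken from `Ξ` to be inserted without carrying
  -- a proof that they differ from `Y`.
  if h : D ≠ .Y then S.R i (weightOne hk u D h) else 1

theorem Strategy.op_eq (i : Fin 8) (u : Fin n) {D : Pauli} (h : D ≠ .Y) :
    S.op hk i u D = S.R i (weightOne hk u D h) := dif_pos h

theorem Strategy.isRefl_op (i : Fin 8) (u : Fin n) (D : Pauli) : IsRefl (S.op hk i u D) := by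
  unfold Strategy.op
  split_ifs
  · exact S.isRefl _ _
  · exact ⟨by simp, by simp⟩

theorem Strategy.exists_dilation (i : Fin 8) (Q : PauliSet n k) :
    ∃ K : Matrix (({P // P ∈ Q.1} → ZMod 2) × Fin (d i)) (Fin (d i)) ℂ, Kᴴ * K = 1 ∧
      ∀ w : ({P // P ∈ Q.1} → ZMod 2) → ℂ,
        Kᴴ * Matrix.diagonal (fun x : ({P // P ∈ Q.1} → ZMod 2) × Fin (d i) => w x.1) * K
          = ∑ b, w b • S.M i Q b :=
  exists_naimark (S.M i Q) (S.M_pos i Q) (S.M_sum i Q)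

/-- A dilation of the measurement of player `i` on the question `Q`. -/
def Strategy.dil (i : Fin 8) (Q : PauliSet n k) :
    Matrix (({P // P ∈ Q.1} → ZMod 2) × Fin (d i)) (Fin (d i)) ℂ :=
  (S.exists_dilation i Q).choose

theorem Strategy.dil_isometry (i : Fin 8) (Q : PauliSet n k) : (S.dil i Q)ᴴ * S.dil i Q = 1 :=
  (S.exists_dilation i Q).choose_spec.1

theorem Strategy.obs_multi (i : Fin 8) (Q : PauliSet n k)
    (f : ({P // P ∈ Q.1} → ZMod 2) → ZMod 2) :
    S.obs i ⟨.multi Q, f⟩ = (S.dil i Q)ᴴ * blockSign (Fin (d i)) f * S.dil i Q :=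
  ((S.exists_dilation i Q).choose_spec.2 fun b => sgn (f b)).symm

theorem Strategy.dil_blockProj (i : Fin 8) (Q : PauliSet n k) (b : {P // P ∈ Q.1} → ZMod 2) :
    (blockProj (Fin (d i)) b * S.dil i Q)ᴴ * (blockProj (Fin (d i)) b * S.dil i Q) = S.M i Q b := by
  have h := (S.exists_dilation i Q).choose_spec.2 fun b' => if b' = b then 1 else 0
  have h1 : (blockProj (Fin (d i)) b)ᴴ * blockProj (Fin (d i)) b = blockProj (Fin (d i)) b := by
    rw [blockProj, Matrix.diagonal_conjTranspose, Matrix.diagonal_mul_diagonal]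
    congr 1
    funext x
    by_cases hx : x.1 = b <;> simp [hx]
  rw [Matrix.conjTranspose_mul, Matrix.mul_assoc, ← Matrix.mul_assoc _ (blockProj _ _), h1,
    ← Matrix.mul_assoc]
  refine h.trans ?_
  simp

variable {hk} {S} {η : ℝ} {ψ : Matrix (∀ i, Fin (d i)) (∀ i, Fin (d i)) ℂ}

theorem Strategy.AllNear.stab_local (h : S.AllNear hk η) (hρ : S.ρ = ψ * ψᴴ) (hψ : ‖ψ‖ = 1)
    (i : Fin 8) (u : Fin n) (ξ : Xi) :
    ‖S.op hk i u (ξ.1.2 i) * reshape i ψ - reshape i ψ *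
        (sgn ξ.1.1 • rightOp (∀ i, Fin (d i)) i fun j => S.op hk j u (ξ.1.2 j))‖
      ≤ Real.sqrt (2 * η) := by
  have h1 := h.stab u ξ
  unfold Strategy.Near at h1
  simp_rw [S.obs_ask, ← S.op_eq] at h1
  rw [hρ] at h1
  have h2 := norm_dilated_sub_le hψ (fun j => (S.isRefl_op hk j u (ξ.1.2 j)).contr) h1 i
    (K := 1) (N := S.op hk i u (ξ.1.2 i)) (by simp) (S.isRefl_op _ _ _ _) (by simp)
  simpa only [Matrix.mul_one, Matrix.one_mul] using h2

theorem rightOp_state_mul (i : Fin 8) (C C' : ∀ i, Matrix (Fin (d i)) (Fin (d i)) ℂ) :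
    rightOp (∀ i, Fin (d i)) i C * rightOp (∀ i, Fin (d i)) i C'
      = rightOp (∀ i, Fin (d i)) i fun j => C' j * C j :=
  rightOp_mul (E := ∀ i, Fin (d i)) i C C'

theorem contr_sgn_smul_rightOp (i : Fin 8) (s : ZMod 2)
    {C : ∀ i, Matrix (Fin (d i)) (Fin (d i)) ℂ} (hC : ∀ j, IsRefl (C j)) :
    Contr (sgn s • rightOp (∀ i, Fin (d i)) i C)ᴴ := by
  rw [Matrix.conjTranspose_smul, (isRefl_rightOp i hC).herm, star_sgn]
  exact (isRefl_rightOp i hC).contr.smul (norm_sgn s)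

/-- `Ξ` contains the all-`X` and the all-`Z` string with sign `+`, so all other players hold copies
of the same letter. These moves are used for words later on. -/
theorem Strategy.AllNear.uniform_local (h : S.AllNear hk η) (hρ : S.ρ = ψ * ψᴴ) (hψ : ‖ψ‖ = 1)
    (i : Fin 8) (u : Fin n) (c : Bool) :
    ‖S.op hk i u (xz c) * reshape i ψ - reshape i ψ *
        (rightOp (∀ i, Fin (d i)) i fun j => S.op hk j u (xz c))‖ ≤ Real.sqrt (2 * η) := by
  have := h.stab_local hρ hψ i u (xiConst c)
  simpa only [xiConst, sgn_zero, one_smul] using this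

theorem Strategy.AllNear.mov_op (h : S.AllNear hk η) (hρ : S.ρ = ψ * ψᴴ) (hψ : ‖ψ‖ = 1)
    (i : Fin 8) (u : Fin n) (c : Bool) :
    Mov (reshape i ψ) (Real.sqrt (2 * η)) (S.op hk i u (xz c)) :=
  ⟨_, by rw [(isRefl_rightOp i fun j => S.isRefl_op hk j u (xz c)).herm]
         exact (isRefl_rightOp i fun j => S.isRefl_op hk j u (xz c)).contr,
    h.uniform_local hρ hψ i u c⟩

/-- Along `b`, `a` the product `Z X` moves to the other players, along `c`, `e` the product `X Z`
does. The two images are negatives of each other, and each product costs two moves. -/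
theorem Strategy.AllNear.anti (h : S.AllNear hk η) (hρ : S.ρ = ψ * ψᴴ) (hψ : ‖ψ‖ = 1)
    (i : Fin 8) (u : Fin n) :
    ‖S.op hk i u .Z * S.op hk i u .X * reshape i ψ + S.op hk i u .X * S.op hk i u .Z * reshape i ψ‖
      ≤ 4 * Real.sqrt (2 * η) := by
  obtain ⟨a, b, c, e, ha, hb, hc, he, hs, hj⟩ := exists_xi_anticommute i
  have ha1 := h.stab_local hρ hψ i u a
  have hb1 := h.stab_local hρ hψ i u b
  have hc1 := h.stab_local hρ hψ i u c
  have he1 := h.stab_local hρ hψ i u e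
  rw [ha] at ha1
  rw [hb] at hb1
  rw [hc] at hc1
  rw [he] at he1
  have h1 := norm_mul_move (S.isRefl_op hk i u .Z).contr
    (contr_sgn_smul_rightOp i a.1.1 fun j => S.isRefl_op hk j u (a.1.2 j)) hb1 ha1
  have h2 := norm_mul_move (S.isRefl_op hk i u .X).contr
    (contr_sgn_smul_rightOp i e.1.1 fun j => S.isRefl_op hk j u (e.1.2 j)) hc1 he1
  simp only [Matrix.smul_mul, Matrix.mul_smul, smul_smul] at h1 h2
  have h3 : (rightOp (∀ i, Fin (d i)) i fun j => S.op hk j u (b.1.2 j)) *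
        rightOp (∀ i, Fin (d i)) i (fun j => S.op hk j u (a.1.2 j))
      = rightOp (∀ i, Fin (d i)) i (fun j => S.op hk j u (c.1.2 j)) *
        rightOp (∀ i, Fin (d i)) i fun j => S.op hk j u (e.1.2 j) := by
    rw [rightOp_state_mul, rightOp_state_mul]
    -- For each other player either the two products have literally the same factors, or both are
    -- squares of reflections and hence one.
    refine rightOp_congr fun j hji => ?_
    rcases hj j hji with ⟨h4, h5⟩ | ⟨h4, h5⟩
    · rw [h4, h5]
    · rw [h4, h5, (S.isRefl_op hk j u _).sq, (S.isRefl_op hk j u _).sq]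
  rw [h3, mul_comm (sgn a.1.1), hs, neg_smul, sub_neg_eq_add, mul_comm (sgn c.1.1)] at h1
  generalize (sgn e.1.1 * sgn c.1.1) • (reshape i ψ * (rightOp (∀ i, Fin (d i)) i
    (fun j => S.op hk j u (c.1.2 j)) * rightOp (∀ i, Fin (d i)) i
      fun j => S.op hk j u (e.1.2 j))) = T at h1 h2
  have e1 : S.op hk i u .Z * S.op hk i u .X * reshape i ψ +
      S.op hk i u .X * S.op hk i u .Z * reshape i ψ
      = (S.op hk i u .Z * S.op hk i u .X * reshape i ψ + T) +
        (S.op hk i u .X * S.op hk i u .Z * reshape i ψ - T) := by abel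
  rw [e1]
  refine (norm_add_le _ _).trans ?_
  linarith

/-- Constant elements of `Ξ` already produce every letter for player `t`, so each full string does
occur as his question in the confusion check. -/
theorem FullString.exists_confString (F : FullString n k) (t : Fin 8) :
    ∃ (J : {J : Finset (Fin n) // J.card = k}) (ξ : {v // v ∈ J.1} → Xi),
      F = confString J ξ t := by
  refine ⟨⟨supp F.1, F.2.2⟩, fun v => xiConst (if F.1 v = .X then false else true), ?_⟩
  apply Subtype.ext
  funext v
  by_cases hv : v ∈ supp F.1
  · simp only [confString, dif_pos hv, xiConst]
    have h1 := F.2.1 v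
    have h2 := mem_supp.1 hv
    cases hF : F.1 v <;> simp_all [xz]
  · simp only [confString, dif_neg hv]
    rw [mem_supp, not_not] at hv
    exact hv

/-- The other players receive the same questions in the confusion check as in the stabilizer check
at `v`. Their product is therefore close both to the block sign and to the single-qubit reflection
of player `i`, at cost `√(2η)` each. -/
theorem Strategy.AllNear.conf_local (h : S.AllNear hk η) (hρ : S.ρ = ψ * ψᴴ) (hψ : ‖ψ‖ = 1)
    (i : Fin 8) (F : FullString n k) (v : Fin n) (hv : v ∈ supp F.1) :
    ‖blockSign (Fin (d i)) (fun b : {P // P ∈ (F.split hk).1} → ZMod 2 => b (F.elem hk v hv)) *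
        S.dil i (F.split hk) * reshape i ψ
      - S.dil i (F.split hk) * S.op hk i v (F.1 v) * reshape i ψ‖ ≤ 2 * Real.sqrt (2 * η) := by
  obtain ⟨J, ξ, rfl⟩ := F.exists_confString i
  have hvJ : v ∈ J.1 := by
    by_contra hvJ
    exact mem_supp.1 hv (dif_neg hvJ)
  have hl : (confString J ξ i).1 v = (ξ ⟨v, hvJ⟩).1.2 i := dif_pos hvJ
  have h1 := h.conf J ⟨v, hvJ⟩ i ξ
  unfold Strategy.Near at h1
  rw [hρ] at h1
  have h2 := norm_dilated_sub_le hψ (fun j => S.contr_obs j _) h1 i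
    (S.dil_isometry i ((confString J ξ i).split hk)) (isRefl_blockSign _)
    (by rw [if_pos rfl]; exact S.obs_multi i _ _)
  rw [rightOp_congr (C' := fun j => S.op hk j v ((ξ ⟨v, hvJ⟩).1.2 j)) fun j hj => by
    rw [if_neg hj, S.obs_ask, S.op_eq]] at h2
  have h3 := h.stab_local hρ hψ i v (ξ ⟨v, hvJ⟩)
  rw [← norm_isometry_mul (S.dil_isometry i ((confString J ξ i).split hk)), Matrix.mul_sub,
    ← Matrix.mul_assoc, ← Matrix.mul_assoc, norm_sub_rev] at h3
  rw [hl]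
  refine (norm_sub_le_norm_sub_add_norm_sub _ _ _).trans ((add_le_add h2 h3).trans (by linarith))

theorem exists_fullString (hn : k ≤ n) (G : Fin n → Pauli) (hG : ∀ v, G v ≠ .Y)
    (hc : (supp G).card ≤ k) : ∃ F : FullString n k, ∀ v ∈ supp G, F.1 v = G v := by
  obtain ⟨J, hJ, hc⟩ := Finset.exists_superset_card_eq hc (by simpa using hn)
  refine ⟨⟨fun v => if v ∈ supp G then G v else if v ∈ J then .X else .I, ?_, ?_⟩, ?_⟩
  · intro v
    beta_reduce
    split_ifs
    · exact hG v
    · simp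
    · simp
  · rw [← hc]
    congr 1
    ext v
    rw [mem_supp]
    by_cases h1 : v ∈ supp G
    · simp [h1, hJ h1, mem_supp.1 h1]
    · by_cases h2 : v ∈ J <;> simp [h1, h2]
  · intro v hv
    exact if_pos hv

/-- As `k ≥ 2`, one full string contains both letters, so a single dilated measurement models both
reflections by diagonal, hence commuting, matrices. -/
theorem Strategy.AllNear.comm (h : S.AllNear hk η) (hn : k ≤ n) (hρ : S.ρ = ψ * ψᴴ)
    (hψ : ‖ψ‖ = 1) (i : Fin 8) (u v : Fin n) (c c' : Bool) (huv : u ≠ v) :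
    ‖S.op hk i u (xz c) * S.op hk i v (xz c') * reshape i ψ
      - S.op hk i v (xz c') * S.op hk i u (xz c) * reshape i ψ‖ ≤ 12 * Real.sqrt (2 * η) := by
  obtain ⟨F, hF⟩ := exists_fullString hn
    (fun w => if w = u then xz c else if w = v then xz c' else .I)
    (fun w => by split_ifs <;> simp [xz_ne_Y])
    (by
      refine (Finset.card_le_card (t := {u, v}) fun w hw => ?_).trans (Finset.card_le_two.trans hk)
      rw [mem_supp] at hw
      by_contra hw'
      simp only [Finset.mem_insert, Finset.mem_singleton, not_or] at hw'
      exact hw (by simp [hw'.1, hw'.2]))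
  have hFu : F.1 u = xz c := (hF u (mem_supp.2 (by simp [xz_ne_I]))).trans (by simp)
  have hFv : F.1 v = xz c' :=
    (hF v (mem_supp.2 (by simp [huv.symm, xz_ne_I]))).trans (by simp [huv.symm])
  have hu : u ∈ supp F.1 := mem_supp.2 (by rw [hFu]; exact xz_ne_I c)
  have hv : v ∈ supp F.1 := mem_supp.2 (by rw [hFv]; exact xz_ne_I c')
  have h1 := h.conf_local hρ hψ i F u hu
  have h2 := h.conf_local hρ hψ i F v hv
  rw [hFu] at h1
  rw [hFv] at h2
  have hK := S.dil_isometry i (F.split hk)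
  generalize S.dil i (F.split hk) = K at *
  have hNu := isRefl_blockSign (m := Fin (d i))
    (fun b : {P // P ∈ (F.split hk).1} → ZMod 2 => b (F.elem hk u hu))
  have hNv := isRefl_blockSign (m := Fin (d i))
    (fun b : {P // P ∈ (F.split hk).1} → ZMod 2 => b (F.elem hk v hv))
  have hcomm : blockSign (Fin (d i))
      (fun b : {P // P ∈ (F.split hk).1} → ZMod 2 => b (F.elem hk u hu)) *
      blockSign (Fin (d i)) (fun b : {P // P ∈ (F.split hk).1} → ZMod 2 => b (F.elem hk v hv))
      = blockSign (Fin (d i)) (fun b : {P // P ∈ (F.split hk).1} → ZMod 2 => b (F.elem hk v hv)) *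
        blockSign (Fin (d i))
          (fun b : {P // P ∈ (F.split hk).1} → ZMod 2 => b (F.elem hk u hu)) := by
    rw [blockSign_mul, blockSign_mul]
    congr 1
    funext b
    exact add_comm _ _
  generalize blockSign (Fin (d i))
    (fun b : {P // P ∈ (F.split hk).1} → ZMod 2 => b (F.elem hk u hu)) = Nu at *
  generalize blockSign (Fin (d i))
    (fun b : {P // P ∈ (F.split hk).1} → ZMod 2 => b (F.elem hk v hv)) = Nv at *
  have key : ∀ {N N' : Matrix (({P // P ∈ (F.split hk).1} → ZMod 2) × Fin (d i))
      (({P // P ∈ (F.split hk).1} → ZMod 2) × Fin (d i)) ℂ}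
      {A A' : Matrix (Fin (d i)) (Fin (d i)) ℂ}, IsRefl N → IsRefl N' → IsRefl A → IsRefl A' →
      Mov (reshape i ψ) (Real.sqrt (2 * η)) A' →
      ‖N * K * reshape i ψ - K * A * reshape i ψ‖ ≤ 2 * Real.sqrt (2 * η) →
      ‖N' * K * reshape i ψ - K * A' * reshape i ψ‖ ≤ 2 * Real.sqrt (2 * η) →
      ‖N * N' * K * reshape i ψ - K * (A * A') * reshape i ψ‖ ≤ 6 * Real.sqrt (2 * η) := by
    intro N N' A A' hN hN' hA hA' hm h1 h2
    have h3 := hm.subst (hN.contr.mul (contr_of_isometry hK))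
      ((contr_of_isometry hK).mul hA.contr) h1
    have h4 := (hN.contr.norm_mul_le (N' * K * reshape i ψ - K * A' * reshape i ψ)).trans h2
    have e1 : N * N' * K * reshape i ψ - K * (A * A') * reshape i ψ
        = N * (N' * K * reshape i ψ - K * A' * reshape i ψ) +
          (N * K * A' * reshape i ψ - K * A * A' * reshape i ψ) := by
      simp only [Matrix.mul_sub, Matrix.mul_assoc]; abel
    rw [e1]
    refine (norm_add_le _ _).trans ?_
    linarith
  -- Each order costs `2 + 2` for the two replacements and `2` for moving the second reflection, in
  -- units of `√(2η)`.
  have k1 := key hNu hNv (S.isRefl_op hk i u _) (S.isRefl_op hk i v _) (h.mov_op hρ hψ i v c') h1 h2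
  have k2 := key hNv hNu (S.isRefl_op hk i v _) (S.isRefl_op hk i u _) (h.mov_op hρ hψ i u c) h2 h1
  rw [hcomm, norm_sub_rev] at k1
  rw [← norm_isometry_mul hK, Matrix.mul_sub]
  simp only [← Matrix.mul_assoc] at k1 k2 ⊢
  exact (norm_sub_le_norm_sub_add_norm_sub _ _ _).trans ((add_le_add k1 k2).trans (by linarith))

theorem Strategy.AllNear.approxPauli (h : S.AllNear hk η) (hn : k ≤ n) (hρ : S.ρ = ψ * ψᴴ)
    (hψ : ‖ψ‖ = 1) (i : Fin 8) :
    ApproxPauli (reshape i ψ) (Real.sqrt (2 * η)) fun u c => S.op hk i u (xz c) where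
  refl u _ := S.isRefl_op hk i u _
  mov u c := h.mov_op hρ hψ i u c
  comm u v c c' huv := h.comm hn hρ hψ i u v c c' huv
  anti u := h.anti hρ hψ i u

end Players

/-! ### Operators of higher weight and commuting sets -/

section HigherWeight

variable {n k : ℕ} {d : Fin 8 → ℕ} (hk : 2 ≤ k) (S : Strategy n k d)

/-- Applying `Kᴴ` removes the dilation, as `Kᴴ * K = 1`. -/
theorem norm_compress_sub_le {a m E : Type*} [Fintype a] [DecidableEq a] [Fintype m]
    [DecidableEq m] [Fintype E] {K : Matrix a m ℂ} (hK : Kᴴ * K = 1) {N : Matrix a a ℂ}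
    {A W : Matrix m m ℂ} (hA : A = Kᴴ * N * K) {Ψ : Matrix m E ℂ} {β : ℝ}
    (h : ‖N * K * Ψ - K * W * Ψ‖ ≤ β) : ‖A * Ψ - W * Ψ‖ ≤ β := by
  have e : A * Ψ - W * Ψ = Kᴴ * (N * K * Ψ - K * W * Ψ) := by
    rw [Matrix.mul_sub, Matrix.mul_assoc K, ← Matrix.mul_assoc Kᴴ K, hK, Matrix.one_mul, hA]
    simp only [Matrix.mul_assoc]
  rw [e]
  exact ((contr_conjTranspose_of_isometry hK).norm_mul_le _).trans h

theorem XZPauli.exists_xz (P : XZPauli n k) (v : {v // v ∈ supp P.1}) : ∃ c, P.1 v.1 = xz c := by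
  have h1 := P.2.1 v.1
  have h2 := mem_supp.1 v.2
  cases h : P.1 v.1
  · exact absurd h h2
  · exact ⟨false, rfl⟩
  · exact absurd h h1
  · exact ⟨true, rfl⟩

theorem XZPauli.length_le (P : XZPauli n k) {l : List {v // v ∈ supp P.1}}
    (hl : l.Perm Finset.univ.toList) : l.length ≤ k := by
  rw [hl.length_eq, Finset.length_toList, Finset.card_univ, Fintype.card_coe]
  exact P.2.2

/-- The product of the reflections of player `i` for the factors of `P`. -/
def Strategy.opWord (i : Fin 8) (P : XZPauli n k) (l : List {v // v ∈ supp P.1}) :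
    Matrix (Fin (d i)) (Fin (d i)) ℂ :=
  (l.map fun v => S.op hk i v.1 (P.1 v.1)).prod

theorem Strategy.contr_opWord (i : Fin 8) (P : XZPauli n k) (l : List {v // v ∈ supp P.1}) :
    Contr (S.opWord hk i P l) := by
  refine contr_list_prod _ fun A hA => ?_
  obtain ⟨v, _, rfl⟩ := List.mem_map.1 hA
  exact (S.isRefl_op _ _ _ _).contr

variable {hk} {S} {η : ℝ} {ψ : Matrix (∀ i, Fin (d i)) (∀ i, Fin (d i)) ℂ}

theorem Strategy.AllNear.mov_opWord (h : S.AllNear hk η) (hρ : S.ρ = ψ * ψᴴ) (hψ : ‖ψ‖ = 1)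
    (i : Fin 8) (P : XZPauli n k) (l : List {v // v ∈ supp P.1}) :
    Mov (reshape i ψ) (l.length * Real.sqrt (2 * η)) (S.opWord hk i P l) := by
  refine Mov.list_prod l _ (fun v _ => (S.isRefl_op _ _ _ _).contr) fun v _ => ?_
  obtain ⟨c, hc⟩ := P.exists_xz v
  rw [hc]
  exact h.mov_op hρ hψ i v.1 c

/-- Each factor is moved by `uniform_local`. The word is reversed because the operators on the
column side multiply in the opposite order. -/
theorem Strategy.AllNear.opWord_rightOp (h : S.AllNear hk η) (hρ : S.ρ = ψ * ψᴴ) (hψ : ‖ψ‖ = 1)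
    (i : Fin 8) (P : XZPauli n k) (l : List {v // v ∈ supp P.1}) :
    ‖S.opWord hk i P l.reverse * reshape i ψ
      - reshape i ψ * rightOp (∀ i, Fin (d i)) i fun j => S.opWord hk j P l‖
      ≤ l.length * Real.sqrt (2 * η) := by
  induction l with
  | nil =>
    have h1 : ∀ j, S.opWord hk j P [] = 1 := fun j => rfl
    have h2 : rightOp (∀ i, Fin (d i)) i (fun j => (1 : Matrix (Fin (d j)) (Fin (d j)) ℂ)) = 1 :=
      rightOp_one (E := ∀ i, Fin (d i)) i
    simp [h1, h2]
  | cons v l ih =>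
    have h1 : ∀ j, S.opWord hk j P (v :: l) = S.op hk j v.1 (P.1 v.1) * S.opWord hk j P l := by
      intro j; simp [Strategy.opWord]
    have h2 : S.opWord hk i P (v :: l).reverse
        = S.opWord hk i P l.reverse * S.op hk i v.1 (P.1 v.1) := by
      simp [Strategy.opWord]
    obtain ⟨c, hc⟩ := P.exists_xz v
    have h3 := h.uniform_local hρ hψ i v.1 c
    rw [← hc] at h3
    have hr := isRefl_rightOp (E := ∀ i, Fin (d i)) i fun j => S.isRefl_op hk j v.1 (P.1 v.1)
    have h4 := norm_mul_move (S.contr_opWord hk i P l.reverse) (by rw [hr.herm]; exact hr.contr)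
      ih h3
    rw [rightOp_state_mul] at h4
    simp_rw [h1]
    rw [h2]
    refine h4.trans (le_of_eq ?_)
    push_cast [List.length_cons]
    ring

/-- In the dilation the observable of a parity is the product of the block signs of the single
answers, each of which acts like its reflection by `conf_local`. Any order `l` is admissible, since
block signs commute exactly. -/
theorem Strategy.AllNear.parity_local (h : S.AllNear hk η) (hρ : S.ρ = ψ * ψᴴ) (hψ : ‖ψ‖ = 1)
    (i : Fin 8) (P : XZPauli n k) (F : Extension P) (l : List {v // v ∈ supp P.1})
    (hl : l.Perm Finset.univ.toList) :
    ‖S.obs i (Query.parity (F.1.split hk) fun v : {v // v ∈ supp P.1} =>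
        F.1.elem hk v.1 (F.mem_supp v)) * reshape i ψ - S.opWord hk i P l * reshape i ψ‖
      ≤ 4 * k ^ 2 * Real.sqrt (2 * η) := by
  have hK := S.dil_isometry i (F.1.split hk)
  have h1 := norm_list_prod_intertwine (Ψ := reshape i ψ) (ε := 2 * Real.sqrt (2 * η)) l
    (contr_of_isometry hK)
    (fun v => blockSign (Fin (d i)) fun b : {P // P ∈ (F.1.split hk).1} → ZMod 2 =>
      b (F.1.elem hk v.1 (F.mem_supp v)))
    (fun v => S.op hk i v.1 (P.1 v.1)) (fun v _ => (isRefl_blockSign _).contr)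
    (fun v _ => (S.isRefl_op _ _ _ _).contr)
    (fun v _ => by
      obtain ⟨c, hc⟩ := P.exists_xz v
      rw [hc]
      exact h.mov_op hρ hψ i v.1 c)
    (Real.sqrt_nonneg _)
    (fun v _ => by
      have := h.conf_local hρ hψ i F.1 v.1 (F.mem_supp v)
      rwa [F.2 v.1 v.2] at this)
  have h2 : (l.map fun v => blockSign (Fin (d i)) fun b : {P // P ∈ (F.1.split hk).1} → ZMod 2 =>
      b (F.1.elem hk v.1 (F.mem_supp v))).prod
      = blockSign (Fin (d i)) fun b => ∑ v, b (F.1.elem hk v.1 (F.mem_supp v)) := by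
    rw [blockSign_list_prod]
    congr 1
    funext b
    rw [(hl.map _).sum_eq, Finset.sum_map_toList]
  rw [h2] at h1
  refine (norm_compress_sub_le hK (S.obs_multi i _ _) h1).trans ?_
  have hlk : (l.length : ℝ) ≤ k := by exact_mod_cast P.length_le hl
  have hk1 : (1 : ℝ) ≤ k := by exact_mod_cast (by omega : 1 ≤ k)
  have hδ := Real.sqrt_nonneg (2 * η)
  calc (l.length : ℝ) * (2 * √(2 * η) + 2 * (l.length * √(2 * η)))
      ≤ k * (2 * (k * √(2 * η)) + 2 * (k * √(2 * η))) := by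
        gcongr
        nlinarith
    _ = 4 * k ^ 2 * √(2 * η) := by ring

theorem exists_extension (hn : k ≤ n) (P : XZPauli n k) : Nonempty (Extension P) := by
  obtain ⟨F, hF⟩ := exists_fullString hn P.1 P.2.1 P.2.2
  exact ⟨⟨F, hF⟩⟩

/-- If the dilated observable of player `t` is consistent with observables of the other players
that act like the words for `P`, then it acts like the word for `P`. -/
theorem Strategy.AllNear.dilated_local (h : S.AllNear hk η) (hρ : S.ρ = ψ * ψᴴ) (hψ : ‖ψ‖ = 1)
    (t : Fin 8) (P : XZPauli n k) (l : List {v // v ∈ supp P.1})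
    (hl : l.Perm Finset.univ.toList) {w : Fin 8 → Query n k} (hw : S.Near η w 0) {β : ℝ}
    (hβ : 0 ≤ β) {a : Type*} [Fintype a] [DecidableEq a] {K : Matrix a (Fin (d t)) ℂ}
    {N : Matrix a a ℂ} (hK : Kᴴ * K = 1) (hN : IsRefl N) (hOt : S.obs t (w t) = Kᴴ * N * K)
    (hO : ∀ j, j ≠ t → ‖S.obs j (w j) * reshape j ψ - S.opWord hk j P l.reverse * reshape j ψ‖ ≤ β) :
    ‖N * K * reshape t ψ - K * S.opWord hk t P l * reshape t ψ‖
      ≤ (1 + k) * Real.sqrt (2 * η) + 8 * β := by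
  unfold Strategy.Near at hw
  rw [hρ] at hw
  have h1 := norm_dilated_sub_le hψ (fun j => S.contr_obs j (w j)) hw t hK hN hOt
  rw [sgn_zero, one_smul] at h1
  have h2 := norm_rightOp_sub_le (ψ := ψ) (fun j => S.contr_obs j (w j))
    (fun j => S.contr_opWord hk j P l.reverse) t hβ hO
  have h3 := h.opWord_rightOp hρ hψ t P l.reverse
  rw [List.reverse_reverse, norm_sub_rev] at h3
  have h4 := (norm_sub_le_norm_sub_add_norm_sub _ _ _).trans (add_le_add h2 h3)
  rw [← norm_isometry_mul hK, Matrix.mul_sub, ← Matrix.mul_assoc, ← Matrix.mul_assoc] at h4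
  refine (norm_sub_le_norm_sub_add_norm_sub _ _ _).trans ((add_le_add h1 h4).trans ?_)
  rw [List.length_reverse]
  have hlk : (l.length : ℝ) * √(2 * η) ≤ k * √(2 * η) := by
    gcongr
    exact P.length_le hl
  linarith

theorem reverse_perm_toList {ι : Type*} [Fintype ι] {l : List ι}
    (hl : l.Perm Finset.univ.toList) : l.reverse.Perm Finset.univ.toList :=
  (List.reverse_perm l).trans hl

/-- In the parity check the others' parity observables act like words by `parity_local`; then
`dilated_local` applies with the trivial dilation `K = 1`. The constant collects `8 * 4` and `1 + k
≤ 2 * k ^ 2`. -/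
theorem Strategy.AllNear.reflection_local (h : S.AllNear hk η) (hn : k ≤ n) (hρ : S.ρ = ψ * ψᴴ)
    (hψ : ‖ψ‖ = 1) (i : Fin 8) (P : XZPauli n k) (l : List {v // v ∈ supp P.1})
    (hl : l.Perm Finset.univ.toList) :
    ‖S.R i P * reshape i ψ - S.opWord hk i P l * reshape i ψ‖
      ≤ 34 * k ^ 2 * Real.sqrt (2 * η) := by
  obtain ⟨F⟩ := exists_extension hn P
  have h1 := h.dilated_local hρ hψ i P l hl (h.parity P i F)
    (β := 4 * k ^ 2 * Real.sqrt (2 * η)) (by positivity) (K := 1) (N := S.R i P) (by simp)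
    (S.isRefl i P) (by rw [if_pos rfl, S.obs_ask]; simp)
    (fun j hj => by
      rw [if_neg hj]
      exact h.parity_local hρ hψ j P F l.reverse (reverse_perm_toList hl))
  rw [Matrix.mul_one, Matrix.one_mul] at h1
  refine h1.trans ?_
  have hk1 : (1 : ℝ) ≤ k := by exact_mod_cast (by omega : 1 ≤ k)
  have hkk : 1 + (k : ℝ) ≤ 2 * k ^ 2 := by nlinarith
  have hδ := Real.sqrt_nonneg (2 * η)
  nlinarith

theorem Strategy.AllNear.mov_R (h : S.AllNear hk η) (hn : k ≤ n) (hρ : S.ρ = ψ * ψᴴ)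
    (hψ : ‖ψ‖ = 1) (i : Fin 8) (P : XZPauli n k) :
    Mov (reshape i ψ) (35 * k ^ 2 * Real.sqrt (2 * η)) (S.R i P) := by
  have h1 := (h.mov_opWord hρ hψ i P Finset.univ.toList).of_close
    (h.reflection_local hn hρ hψ i P Finset.univ.toList (List.Perm.refl _))
  refine h1.mono ?_
  have hlk : ((Finset.univ.toList : List {v // v ∈ supp P.1}).length : ℝ) ≤ k := by
    exact_mod_cast P.length_le (List.Perm.refl _)
  have hk1 : (1 : ℝ) ≤ k := by exact_mod_cast (by omega : 1 ≤ k)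
  have hkk : (k : ℝ) ≤ k ^ 2 := by nlinarith
  have hδ := Real.sqrt_nonneg (2 * η)
  nlinarith

/-- Block sign and reflection are both compared with the word for `P`: the first through the Pauli
check, the second by `reflection_local`. The constant is `2 + 8 * 34 + 34`. -/
theorem Strategy.AllNear.pauli_local (h : S.AllNear hk η) (hn : k ≤ n) (hρ : S.ρ = ψ * ψᴴ)
    (hψ : ‖ψ‖ = 1) (i : Fin 8) (Q : PauliSet n k) (P : {P // P ∈ Q.1}) :
    ‖blockSign (Fin (d i)) (fun b : {P // P ∈ Q.1} → ZMod 2 => b P) * S.dil i Q * reshape i ψ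
      - S.dil i Q * S.R i P.1 * reshape i ψ‖ ≤ 308 * k ^ 2 * Real.sqrt (2 * η) := by
  have hl : (Finset.univ.toList : List {v // v ∈ supp P.1.1}).Perm Finset.univ.toList :=
    List.Perm.refl _
  have hK := S.dil_isometry i Q
  have h1 := h.dilated_local hρ hψ i P.1 Finset.univ.toList hl (h.pauli Q P i)
    (β := 34 * k ^ 2 * Real.sqrt (2 * η)) (by positivity) hK (isRefl_blockSign _)
    (by rw [if_pos rfl]; exact S.obs_multi i Q _)
    (fun j hj => by
      rw [if_neg hj, S.obs_ask]
      exact h.reflection_local hn hρ hψ j P.1 _ (reverse_perm_toList hl))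
  have h2 := h.reflection_local hn hρ hψ i P.1 _ hl
  rw [norm_sub_rev, ← norm_isometry_mul hK, Matrix.mul_sub, ← Matrix.mul_assoc,
    ← Matrix.mul_assoc] at h2
  refine (norm_sub_le_norm_sub_add_norm_sub _ _ _).trans ((add_le_add h1 h2).trans ?_)
  have hk1 : (1 : ℝ) ≤ k := by exact_mod_cast (by omega : 1 ≤ k)
  have hkk : 1 + (k : ℝ) ≤ 2 * k ^ 2 := by nlinarith
  have hδ := Real.sqrt_nonneg (2 * η)
  nlinarith

end HigherWeight

/-! ### Honest Pauli operators behind the isometry -/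

section Honest

theorem at1_mul_pauliOp {n : ℕ} (v : Fin n) (g : Fin n → Pauli) (D : Pauli) (hg : g v = .I) :
    pauliOp (at1 v D) * pauliOp g = pauliOp (Function.update g v D) := by
  unfold pauliOp
  rw [tensor_mul]
  congr 1
  funext w
  by_cases hw : w = v
  · subst hw; simp [at1, hg, Pauli.mat]
  · rw [Function.update_of_ne hw, show at1 v D w = .I from if_neg hw]
    simp [Pauli.mat]

theorem pauliOp_list_prod {n : ℕ} (P : Fin n → Pauli) (l : List (Fin n)) (hl : l.Nodup) :
    (l.map fun v => pauliOp (at1 v (P v))).prod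
      = pauliOp fun v => if v ∈ l then P v else .I := by
  induction l with
  | nil => simpa using pauliOp_I.symm
  | cons v l ih =>
    rw [List.nodup_cons] at hl
    rw [List.map_cons, List.prod_cons, ih hl.2, at1_mul_pauliOp _ _ _ (if_neg hl.1)]
    congr 1
    funext w
    by_cases hw : w = v
    · subst hw; simp
    · simp [hw]

theorem pauliOp_eq_list_prod {n k : ℕ} (P : XZPauli n k) :
    ((Finset.univ.toList : List {v // v ∈ supp P.1}).map fun v =>
      pauliOp (at1 v.1 (P.1 v.1))).prod = pauliOp P.1 := by
  have h1 : ((Finset.univ.toList : List {v // v ∈ supp P.1}).map fun v =>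
      pauliOp (at1 v.1 (P.1 v.1)))
      = ((Finset.univ.toList : List {v // v ∈ supp P.1}).map Subtype.val).map fun v =>
        pauliOp (at1 v (P.1 v)) := by
    rw [List.map_map]; rfl
  rw [h1, pauliOp_list_prod _ _ ((Finset.nodup_toList _).map Subtype.val_injective)]
  congr 1
  funext v
  by_cases hv : v ∈ supp P.1
  · rw [if_pos]
    simpa using hv
  · rw [if_neg (by simpa using hv)]
    rw [mem_supp, not_not] at hv
    exact hv.symm

variable {b r m : Type*} [Fintype b] [DecidableEq b] [Fintype r] [DecidableEq r]

/-- `A ⊗ 1`. -/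
def lift (r : Type*) [DecidableEq r] (A : Matrix b b ℂ) : Matrix (b × r) (b × r) ℂ :=
  Matrix.kronecker A (1 : Matrix r r ℂ)

theorem lift_one : lift r (1 : Matrix b b ℂ) = 1 := Matrix.one_kronecker_one

theorem lift_mul (A B : Matrix b b ℂ) : lift r (A * B) = lift r A * lift r B := by
  have := Matrix.mul_kronecker_mul A B (1 : Matrix r r ℂ) (1 : Matrix r r ℂ)
  rwa [Matrix.mul_one] at this

theorem lift_list_prod (l : List (Matrix b b ℂ)) : lift r l.prod = (l.map (lift r)).prod := by
  induction l with
  | nil => simpa using lift_one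
  | cons A l ih => simp only [List.prod_cons, List.map_cons, lift_mul, ih]

theorem lift_conjTranspose (A : Matrix b b ℂ) : (lift r A)ᴴ = lift r Aᴴ := by
  have := Matrix.conjTranspose_kronecker A (1 : Matrix r r ℂ)
  rwa [Matrix.conjTranspose_one] at this

theorem lift_half (A : Matrix b b ℂ) (s : ZMod 2) : lift r (half A s) = half (lift r A) s := by
  ext ⟨x, y⟩ ⟨x', y'⟩
  simp only [lift, half, Matrix.kronecker, Matrix.kroneckerMap_apply, Matrix.smul_apply,
    Matrix.add_apply, smul_eq_mul, Matrix.one_apply, Prod.mk.injEq]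
  by_cases h1 : x = x' <;> by_cases h2 : y = y' <;> simp [h1, h2]

theorem IsRefl.lift {A : Matrix b b ℂ} (hA : IsRefl A) : IsRefl (lift r A) :=
  ⟨by rw [lift_conjTranspose, hA.herm], by rw [← lift_mul, hA.sq, lift_one]⟩

end Honest

/-! ### Distances of the players' measurements from the honest ones -/

theorem exists_fin_isometry (a : Type*) [Fintype a] [DecidableEq a] :
    ∃ (r : ℕ) (U : Matrix (Fin r) a ℂ), Uᴴ * U = 1 := by
  refine ⟨Fintype.card a, (1 : Matrix a a ℂ).submatrix (Fintype.equivFin a).symm id, ?_⟩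
  rw [Matrix.conjTranspose_submatrix, Matrix.conjTranspose_one, Matrix.submatrix_mul_equiv]
  simp

section Extract

variable {n : ℕ} {m E : Type*} [Fintype m] [DecidableEq m] [Fintype E] [DecidableEq E]

/-- The isometry `extract` followed by a relabelling of its auxiliary space by some `Fin r`, which
commutes with everything that acts on the qubits. -/
theorem exists_extract {Ψ : Matrix m E ℂ} {δ : ℝ} {O : Fin n → Bool → Matrix m m ℂ}
    (h : ApproxPauli Ψ δ O) :
    ∃ (r : ℕ) (V : Matrix ((Fin n → Fin 2) × Fin r) m ℂ), Vᴴ * V = 1 ∧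
      ∀ u c, ‖lift (Fin r) (pauliOp (at1 u (xz c))) * V * Ψ - V * O u c * Ψ‖ ≤ 38 * n ^ 2 * δ := by
  obtain ⟨r, U, hU⟩ := exists_fin_isometry ((Fin n → Fin 2) × m)
  have hW : (Matrix.kronecker (1 : Matrix (Fin n → Fin 2) (Fin n → Fin 2) ℂ) U)ᴴ *
      Matrix.kronecker (1 : Matrix (Fin n → Fin 2) (Fin n → Fin 2) ℂ) U = 1 := by
    rw [Matrix.kronecker, Matrix.conjTranspose_kronecker]
    refine (Matrix.mul_kronecker_mul _ _ _ _).symm.trans ?_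
    rw [hU, Matrix.conjTranspose_one, Matrix.mul_one]
    exact Matrix.one_kronecker_one
  have hcomm : ∀ A : Matrix (Fin n → Fin 2) (Fin n → Fin 2) ℂ,
      lift (Fin r) A * Matrix.kronecker (1 : Matrix (Fin n → Fin 2) (Fin n → Fin 2) ℂ) U
        = Matrix.kronecker (1 : Matrix (Fin n → Fin 2) (Fin n → Fin 2) ℂ) U *
          lift ((Fin n → Fin 2) × m) A := by
    intro A
    refine (Matrix.mul_kronecker_mul _ _ _ _).symm.trans
      (Eq.trans ?_ (Matrix.mul_kronecker_mul _ _ _ _))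
    rw [Matrix.mul_one, Matrix.mul_one, Matrix.one_mul, Matrix.one_mul]
  generalize Matrix.kronecker (1 : Matrix (Fin n → Fin 2) (Fin n → Fin 2) ℂ) U = W at hW hcomm
  refine ⟨r, W * extract O, ?_, fun u c => ?_⟩
  · rw [Matrix.conjTranspose_mul, Matrix.mul_assoc, ← Matrix.mul_assoc Wᴴ, hW, Matrix.one_mul,
      extract_isometry h.refl]
  · have h1 := h.extract u c
    rw [← Matrix.mul_assoc, hcomm]
    simp only [Matrix.mul_assoc] at h1 ⊢
    rw [← Matrix.mul_sub, norm_isometry_mul hW]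
    exact h1

end Extract

section Distances

variable {n k : ℕ} {d : Fin 8 → ℕ} {ψ : Matrix (∀ i, Fin (d i)) (∀ i, Fin (d i)) ℂ}

theorem localTr_eq (i : Fin 8) (A : Matrix (Fin (d i)) (Fin (d i)) ℂ) :
    localTr (ψ * ψᴴ) i A = ((reshape i ψ)ᴴ * (A * reshape i ψ)).trace := by
  have h : localTr (ψ * ψᴴ) i A = (loc i A * (ψ * ψᴴ)).trace := rfl
  rw [h, trace_mul_mul_conjTranspose, ← trace_reshape i, reshape_loc_mul]

theorem pullback_eq {m b r : Type*} [Fintype b] [Fintype r] [DecidableEq r]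
    (V : Matrix (b × r) m ℂ) (A : Matrix b b ℂ) : pullback V A = Vᴴ * lift r A * V := rfl

/-- Both vectors have norm one and their inner product is the trace in `reflDist`, so the squared
distance is half of the squared norm of the difference. -/
theorem reflDist_le (hψ : ‖ψ‖ = 1) (i : Fin 8) {R : Matrix (Fin (d i)) (Fin (d i)) ℂ}
    (hR : IsRefl R) {b : Type*} [Fintype b] [DecidableEq b] {r : ℕ}
    {V : Matrix (b × Fin r) (Fin (d i)) ℂ} (hV : Vᴴ * V = 1) {A : Matrix b b ℂ} (hA : IsRefl A)
    {β : ℝ} (hβ : ‖lift (Fin r) A * V * reshape i ψ - V * R * reshape i ψ‖ ≤ β) :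
    reflDist (ψ * ψᴴ) i R (pullback V A) ≤ β := by
  have hβ0 : 0 ≤ β := (norm_nonneg _).trans hβ
  unfold reflDist
  rw [Real.sqrt_le_left hβ0]
  rw [norm_sub_rev] at hβ
  have h1 := frobenius_norm_sub_sq (V * R * reshape i ψ) (lift (Fin r) A * V * reshape i ψ)
  have n1 : ‖V * R * reshape i ψ‖ = 1 := by
    rw [Matrix.mul_assoc, norm_isometry_mul hV, norm_isometry_mul (by rw [hR.herm, hR.sq]),
      norm_reshape, hψ]
  have n2 : ‖lift (Fin r) A * V * reshape i ψ‖ = 1 := by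
    rw [Matrix.mul_assoc, norm_isometry_mul (by rw [hA.lift.herm, hA.lift.sq]),
      norm_isometry_mul hV, norm_reshape, hψ]
  have e : ((V * R * reshape i ψ)ᴴ * (lift (Fin r) A * V * reshape i ψ)).trace
      = localTr (ψ * ψᴴ) i (R * pullback V A) := by
    rw [localTr_eq, pullback_eq, Matrix.conjTranspose_mul, Matrix.conjTranspose_mul, hR.herm]
    simp only [Matrix.mul_assoc]
  rw [e, n1, n2] at h1
  have h2 : ‖V * R * reshape i ψ - lift (Fin r) A * V * reshape i ψ‖ ^ 2 ≤ β ^ 2 := by gcongr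
  nlinarith

theorem povmDist_le (i : Fin 8) {α : Type*} [Fintype α]
    {M₀ M₁ : α → Matrix (Fin (d i)) (Fin (d i)) ℂ} {a : Type*} [Fintype a] [DecidableEq a]
    (N₀ N₁ : α → Matrix a (Fin (d i)) ℂ) (h₀ : ∀ x, (N₀ x)ᴴ * N₀ x = M₀ x)
    (h₁ : ∀ x, (N₁ x)ᴴ * N₁ x = M₁ x) {β : ℝ} (hβ : 0 ≤ β)
    (h : ∀ x, ‖N₀ x * reshape i ψ - N₁ x * reshape i ψ‖ ≤ β) :
    povmDist (ψ * ψᴴ) i M₀ M₁ ≤ Fintype.card α * β := by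
  obtain ⟨m, U, hU⟩ := exists_fin_isometry a
  have hUU : ∀ N N' : Matrix a (Fin (d i)) ℂ, (U * N)ᴴ * (U * N') = Nᴴ * N' := by
    intro N N'
    rw [Matrix.conjTranspose_mul, Matrix.mul_assoc, ← Matrix.mul_assoc Uᴴ, hU, Matrix.one_mul]
  unfold povmDist
  refine le_trans (csInf_le (a := √(∑ x, (localTr (ψ * ψᴴ) i
    ((U * N₀ x - U * N₁ x)ᴴ * (U * N₀ x - U * N₁ x))).re)) ⟨0, ?_⟩
    ⟨m, fun x => U * N₀ x, fun x => U * N₁ x, fun x => by rw [hUU, h₀],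
      fun x => by rw [hUU, h₁], rfl⟩) ?_
  · rintro δ ⟨_, _, _, _, _, rfl⟩
    exact Real.sqrt_nonneg _
  · rw [Real.sqrt_le_left (by positivity)]
    have h1 : ∀ x, (localTr (ψ * ψᴴ) i
        ((U * N₀ x - U * N₁ x)ᴴ * (U * N₀ x - U * N₁ x))).re ≤ β ^ 2 := by
      intro x
      rw [← Matrix.mul_sub, hUU, localTr_eq]
      have e : (reshape i ψ)ᴴ * ((N₀ x - N₁ x)ᴴ * (N₀ x - N₁ x) * reshape i ψ)
          = ((N₀ x - N₁ x) * reshape i ψ)ᴴ * ((N₀ x - N₁ x) * reshape i ψ) := by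
        rw [Matrix.conjTranspose_mul]
        simp only [Matrix.mul_assoc]
      rw [e, ← frobenius_norm_sq, Matrix.sub_mul]
      have := h x
      gcongr
    have h2 := Finset.sum_le_sum fun x (_ : x ∈ (Finset.univ : Finset α)) => h1 x
    refine h2.trans ?_
    rw [Finset.sum_const, Finset.card_univ, nsmul_eq_mul, mul_pow]
    gcongr
    -- The root of the number of outcomes is estimated by that number itself.
    exact_mod_cast Nat.le_self_pow two_ne_zero _

/-- Two dilations of POVMs that are both close to the same operators. -/
theorem povmDist_le_of_dilations (i : Fin 8) {α : Type*} [Fintype α]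
    {M₀ M₁ : α → Matrix (Fin (d i)) (Fin (d i)) ℂ} {a b : Type*} [Fintype a] [DecidableEq a]
    [Fintype b] [DecidableEq b] {K : Matrix a (Fin (d i)) ℂ} {V : Matrix b (Fin (d i)) ℂ}
    (hK : Kᴴ * K = 1) (hV : Vᴴ * V = 1) (P : α → Matrix a a ℂ) (F : α → Matrix b b ℂ)
    (G : α → Matrix (Fin (d i)) (Fin (d i)) ℂ)
    (h₀ : ∀ x, (P x * K)ᴴ * (P x * K) = M₀ x) (h₁ : ∀ x, (F x * V)ᴴ * (F x * V) = M₁ x)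
    {β β' : ℝ} (hβ : 0 ≤ β) (hβ' : 0 ≤ β')
    (h : ∀ x, ‖P x * K * reshape i ψ - K * G x * reshape i ψ‖ ≤ β)
    (h' : ∀ x, ‖F x * V * reshape i ψ - V * G x * reshape i ψ‖ ≤ β') :
    povmDist (ψ * ψᴴ) i M₀ M₁ ≤ Fintype.card α * (β + β') := by
  have hI : (Matrix.fromRows (1 : Matrix a a ℂ) (0 : Matrix b a ℂ))ᴴ *
      Matrix.fromRows (1 : Matrix a a ℂ) (0 : Matrix b a ℂ) = 1 := by
    rw [Matrix.conjTranspose_fromRows_eq_fromCols_conjTranspose, Matrix.fromCols_mul_fromRows]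
    simp
  -- The two dilations live on different spaces. This isometry into the direct sum carries the range
  -- of `V` onto that of `K` in the first summand, and keeps the orthogonal complement in the
  -- second. Thus `V` and `K` become the same map there, and both POVMs can be compared with the
  -- operators `G`.
  have hL : (Matrix.fromRows (K * Vᴴ) (1 - V * Vᴴ))ᴴ * Matrix.fromRows (K * Vᴴ) (1 - V * Vᴴ)
      = 1 := by
    rw [Matrix.conjTranspose_fromRows_eq_fromCols_conjTranspose, Matrix.fromCols_mul_fromRows]
    have e1 : (K * Vᴴ)ᴴ * (K * Vᴴ) = V * Vᴴ := by
      rw [Matrix.conjTranspose_mul, Matrix.conjTranspose_conjTranspose, Matrix.mul_assoc,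
        ← Matrix.mul_assoc Kᴴ, hK, Matrix.one_mul]
    have e2 : V * Vᴴ * (V * Vᴴ) = V * Vᴴ := by
      rw [Matrix.mul_assoc, ← Matrix.mul_assoc Vᴴ, hV, Matrix.one_mul]
    rw [e1, Matrix.conjTranspose_sub, Matrix.conjTranspose_one, Matrix.conjTranspose_mul,
      Matrix.conjTranspose_conjTranspose, Matrix.sub_mul, Matrix.mul_sub, Matrix.mul_sub,
      Matrix.one_mul, Matrix.mul_one, Matrix.one_mul, e2]
    abel
  have hLV : Matrix.fromRows (K * Vᴴ) (1 - V * Vᴴ) * V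
      = Matrix.fromRows (1 : Matrix a a ℂ) (0 : Matrix b a ℂ) * K := by
    rw [Matrix.fromRows_mul, Matrix.fromRows_mul, Matrix.mul_assoc, hV, Matrix.sub_mul,
      Matrix.mul_assoc, hV]
    simp
  generalize Matrix.fromRows (K * Vᴴ) (1 - V * Vᴴ) = Λ at hL hLV
  generalize Matrix.fromRows (1 : Matrix a a ℂ) (0 : Matrix b a ℂ) = J at hI hLV
  refine povmDist_le i (fun x => J * (P x * K)) (fun x => Λ * (F x * V))
    (fun x => by rw [Matrix.conjTranspose_mul, Matrix.mul_assoc, ← Matrix.mul_assoc Jᴴ, hI,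
      Matrix.one_mul, h₀])
    (fun x => by rw [Matrix.conjTranspose_mul, Matrix.mul_assoc, ← Matrix.mul_assoc Λᴴ, hL,
      Matrix.one_mul, h₁]) (by positivity) fun x => ?_
  have e : J * (P x * K) * reshape i ψ - Λ * (F x * V) * reshape i ψ
      = J * (P x * K * reshape i ψ - K * G x * reshape i ψ)
        - Λ * (F x * V * reshape i ψ - V * G x * reshape i ψ) := by
    simp only [Matrix.mul_sub, ← Matrix.mul_assoc, hLV]
    abel
  rw [e]
  refine (norm_sub_le _ _).trans ?_
  rw [norm_isometry_mul hI, norm_isometry_mul hL]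
  exact add_le_add (h x) (h' x)

/-- The head commutes with the tail product, so `Aᴴ * A = A` can be applied inside and the head is
then passed out on the right. -/
theorem list_prod_projection {a : Type*} [Fintype a] [DecidableEq a] (l : List (Matrix a a ℂ))
    (hc : ∀ A ∈ l, ∀ B ∈ l, Commute A B) (hp : ∀ A ∈ l, Aᴴ * A = A) :
    l.prodᴴ * l.prod = l.prod := by
  induction l with
  | nil => simp
  | cons A l ih =>
    have ih := ih (fun B hB C hC => hc B (by simp [hB]) C (by simp [hC]))
      (fun B hB => hp B (by simp [hB]))
    have h1 : A * l.prod = l.prod * A :=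
      Commute.list_prod_right l A fun B hB => hc A (by simp) B (by simp [hB])
    rw [List.prod_cons, Matrix.conjTranspose_mul, Matrix.mul_assoc, ← Matrix.mul_assoc Aᴴ,
      hp A (by simp), h1, ← Matrix.mul_assoc, ih]

theorem noncommProd_eq_list_prod {α M : Type*} [Monoid M] (s : Finset α) (f : α → M)
    (comm : (s : Set α).Pairwise (Function.onFun Commute f)) :
    s.noncommProd f comm = (s.toList.map f).prod := by
  classical
  rw [← Finset.noncommProd_toFinset s.toList f (by simpa using comm) s.nodup_toList]
  exact Finset.noncommProd_congr (by simp) (fun _ _ => rfl) _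

theorem jointProj_eq_list_prod (Q : PauliSet n k) (b : {P // P ∈ Q.1} → ZMod 2) :
    jointProj Q b = ((Finset.univ : Finset {P // P ∈ Q.1}).toList.map
      fun P => half (pauliOp P.1.1) (b P)).prod := by
  exact noncommProd_eq_list_prod _ _ _

theorem jointProj_projection (Q : PauliSet n k) (b : {P // P ∈ Q.1} → ZMod 2) :
    (jointProj Q b)ᴴ * jointProj Q b = jointProj Q b := by
  rw [jointProj_eq_list_prod]
  refine list_prod_projection _ ?_ ?_
  · intro A hA B hB
    obtain ⟨P, _, rfl⟩ := List.mem_map.1 hA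
    obtain ⟨P', _, rfl⟩ := List.mem_map.1 hB
    exact half_commute (Q.2.2.1 P.1 P.2 P'.1 P'.2) _ _
  · intro A hA
    obtain ⟨P, _, rfl⟩ := List.mem_map.1 hA
    rw [(isRefl_pauliOp _).half_herm, (isRefl_pauliOp _).half_sq]

theorem blockProj_eq_list_prod (m : Type*) [Fintype m] [DecidableEq m] (Q : PauliSet n k)
    (b : {P // P ∈ Q.1} → ZMod 2) :
    blockProj m b = ((Finset.univ : Finset {P // P ∈ Q.1}).toList.map
      fun P => half (blockSign m fun b : {P // P ∈ Q.1} → ZMod 2 => b P) (b P)).prod := by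
  rw [half_blockSign_list_prod]
  unfold blockProj
  congr 1
  funext x
  congr 1
  simp [funext_iff]

variable {hk : 2 ≤ k} {S : Strategy n k d} {η : ℝ}

/-- The letters of `P` are intertwined one by one, at `38 * n ^ 2` each, and the resulting word is
replaced by the reflection for `P` through `reflection_local`. -/
theorem Strategy.AllNear.pauli_extract (h : S.AllNear hk η) (hn : k ≤ n) (hρ : S.ρ = ψ * ψᴴ)
    (hψ : ‖ψ‖ = 1) (i : Fin 8) {r : ℕ} {V : Matrix ((Fin n → Fin 2) × Fin r) (Fin (d i)) ℂ}
    (hV : Vᴴ * V = 1)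
    (hVO : ∀ u c, ‖lift (Fin r) (pauliOp (at1 u (xz c))) * V * reshape i ψ
      - V * S.op hk i u (xz c) * reshape i ψ‖ ≤ 38 * n ^ 2 * Real.sqrt (2 * η))
    (P : XZPauli n k) :
    ‖lift (Fin r) (pauliOp P.1) * V * reshape i ψ - V * S.R i P * reshape i ψ‖
      ≤ 74 * k ^ 2 * n ^ 2 * Real.sqrt (2 * η) := by
  have h1 := norm_list_prod_intertwine (Ψ := reshape i ψ)
    (Finset.univ.toList : List {v // v ∈ supp P.1}) (contr_of_isometry hV)
    (fun v => lift (Fin r) (pauliOp (at1 v.1 (P.1 v.1)))) (fun v => S.op hk i v.1 (P.1 v.1))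
    (fun v _ => (isRefl_pauliOp _).lift.contr) (fun v _ => (S.isRefl_op _ _ _ _).contr)
    (fun v _ => by
      obtain ⟨c, hc⟩ := P.exists_xz v
      rw [hc]
      exact h.mov_op hρ hψ i v.1 c)
    (Real.sqrt_nonneg _)
    (fun v _ => by
      obtain ⟨c, hc⟩ := P.exists_xz v
      rw [hc]
      exact hVO v.1 c)
  have h2 : ((Finset.univ.toList : List {v // v ∈ supp P.1}).map fun v =>
      lift (Fin r) (pauliOp (at1 v.1 (P.1 v.1)))).prod = lift (Fin r) (pauliOp P.1) := by
    rw [← pauliOp_eq_list_prod P, lift_list_prod, List.map_map]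
    rfl
  have h3 := h.reflection_local hn hρ hψ i P Finset.univ.toList (List.Perm.refl _)
  rw [norm_sub_rev, ← norm_isometry_mul hV, Matrix.mul_sub, ← Matrix.mul_assoc,
    ← Matrix.mul_assoc] at h3
  rw [h2] at h1
  refine (norm_sub_le_norm_sub_add_norm_sub _ _ _).trans ((add_le_add h1 h3).trans ?_)
  have hl : ((Finset.univ.toList : List {v // v ∈ supp P.1}).length : ℝ) ≤ k := by
    exact_mod_cast P.length_le (List.Perm.refl _)
  have hk1 : (1 : ℝ) ≤ k := by exact_mod_cast (by omega : 1 ≤ k)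
  have hn1 : (1 : ℝ) ≤ n := by exact_mod_cast (by omega : 1 ≤ n)
  have hnn : (1 : ℝ) ≤ n ^ 2 := by nlinarith
  have hδ := Real.sqrt_nonneg (2 * η)
  generalize √(2 * η) = δ at *
  have hL0 : (0 : ℝ) ≤ (Finset.univ.toList : List {v // v ∈ supp P.1}).length := by positivity
  generalize ((Finset.univ.toList : List {v // v ∈ supp P.1}).length : ℝ) = L at *
  calc L * (38 * n ^ 2 * δ + 2 * (L * δ)) + 34 * k ^ 2 * δ
      ≤ k * (38 * n ^ 2 * δ + 2 * (k * δ)) + 34 * k ^ 2 * δ := by gcongr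
    _ = 38 * (k * 1) * n ^ 2 * δ + 36 * k ^ 2 * 1 * δ := by ring
    _ ≤ 38 * (k * k) * n ^ 2 * δ + 36 * k ^ 2 * n ^ 2 * δ := by gcongr
    _ = 74 * k ^ 2 * n ^ 2 * δ := by ring

/-- For every outcome both measurement operators act like the same product of spectral projections
of the reflections `S.R i P`, although these need not commute. The bound adds the two errors, `378 +
144 = 522`, and `2 ^ k` counts the outcomes. -/
theorem Strategy.AllNear.povm_extract (h : S.AllNear hk η) (hn : k ≤ n) (hρ : S.ρ = ψ * ψᴴ)
    (hψ : ‖ψ‖ = 1) (i : Fin 8) {r : ℕ} {V : Matrix ((Fin n → Fin 2) × Fin r) (Fin (d i)) ℂ}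
    (hV : Vᴴ * V = 1)
    (hVP : ∀ P : XZPauli n k, ‖lift (Fin r) (pauliOp P.1) * V * reshape i ψ
      - V * S.R i P * reshape i ψ‖ ≤ 74 * k ^ 2 * n ^ 2 * Real.sqrt (2 * η))
    (Q : PauliSet n k) :
    povmDist S.ρ i (S.M i Q) (fun b => pullback V (jointProj Q b))
      ≤ 2 ^ k * (522 * k ^ 4 * n ^ 2 * Real.sqrt (2 * η)) := by
  have hlen : ((Finset.univ : Finset {P // P ∈ Q.1}).toList.length : ℝ) = k := by
    rw [Finset.length_toList, Finset.card_univ, Fintype.card_coe, Q.2.1]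
  have hk1 : (1 : ℝ) ≤ k := by exact_mod_cast (by omega : 1 ≤ k)
  have hn1 : (1 : ℝ) ≤ n := by exact_mod_cast (by omega : 1 ≤ n)
  have hnn : (1 : ℝ) ≤ n ^ 2 := by nlinarith
  have hδ := Real.sqrt_nonneg (2 * η)
  have hcard : (Fintype.card ({P // P ∈ Q.1} → ZMod 2) : ℝ) = 2 ^ k := by
    rw [Fintype.card_fun, Fintype.card_coe, Q.2.1, ZMod.card]
    push_cast
    rfl
  have hhalf : ∀ {a : Type _} [Fintype a] [DecidableEq a] {W : Matrix a (Fin (d i)) ℂ}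
      {A : Matrix a a ℂ} {R : Matrix (Fin (d i)) (Fin (d i)) ℂ} {β : ℝ} (s : ZMod 2),
      ‖A * W * reshape i ψ - W * R * reshape i ψ‖ ≤ β →
      ‖half A s * W * reshape i ψ - W * half R s * reshape i ψ‖ ≤ β := by
    intro a _ _ W A R β s hβ
    rw [← Matrix.sub_mul, half_mul_sub, Matrix.smul_mul, norm_smul, norm_mul, norm_sgn,
      Matrix.sub_mul]
    have := norm_nonneg (A * W * reshape i ψ - W * R * reshape i ψ)
    norm_num
    linarith
  have hM : ∀ (b : {P // P ∈ Q.1} → ZMod 2) (P : {P // P ∈ Q.1}),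
      Mov (reshape i ψ) (35 * k ^ 2 * Real.sqrt (2 * η)) (half (S.R i P.1) (b P)) :=
    fun b P => (h.mov_R hn hρ hψ i P.1).half _
  have h0 : ∀ b : {P // P ∈ Q.1} → ZMod 2,
      ‖blockProj (Fin (d i)) b * S.dil i Q * reshape i ψ
        - S.dil i Q * ((Finset.univ : Finset {P // P ∈ Q.1}).toList.map
          fun P => half (S.R i P.1) (b P)).prod * reshape i ψ‖
        ≤ 378 * k ^ 4 * n ^ 2 * Real.sqrt (2 * η) := by
    intro b
    rw [blockProj_eq_list_prod]
    refine (norm_list_prod_intertwine (Ψ := reshape i ψ)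
      (Finset.univ : Finset {P // P ∈ Q.1}).toList (contr_of_isometry (S.dil_isometry i Q))
      (fun P => half (blockSign (Fin (d i)) fun b : {P // P ∈ Q.1} → ZMod 2 => b P) (b P))
      (fun P => half (S.R i P.1) (b P))
      (fun P _ => (isRefl_blockSign _).contr.half _) (fun P _ => (S.isRefl i P.1).contr.half _)
      (fun P _ => hM b P) (by positivity)
      (fun P _ => hhalf (b P) (h.pauli_local hn hρ hψ i Q P))).trans ?_
    rw [hlen]
    generalize √(2 * η) = δ at *
    calc k * (308 * k ^ 2 * δ + 2 * (k * (35 * k ^ 2 * δ)))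
        = 308 * (k ^ 3 * 1) * 1 * δ + 70 * k ^ 4 * 1 * δ := by ring
      _ ≤ 308 * (k ^ 3 * k) * n ^ 2 * δ + 70 * k ^ 4 * n ^ 2 * δ := by gcongr
      _ = 378 * k ^ 4 * n ^ 2 * δ := by ring
  have h1 : ∀ b : {P // P ∈ Q.1} → ZMod 2,
      ‖lift (Fin r) (jointProj Q b) * V * reshape i ψ
        - V * ((Finset.univ : Finset {P // P ∈ Q.1}).toList.map
          fun P => half (S.R i P.1) (b P)).prod * reshape i ψ‖
        ≤ 144 * k ^ 4 * n ^ 2 * Real.sqrt (2 * η) := by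
    intro b
    rw [jointProj_eq_list_prod, lift_list_prod, List.map_map]
    refine (norm_list_prod_intertwine (Ψ := reshape i ψ)
      (Finset.univ : Finset {P // P ∈ Q.1}).toList (contr_of_isometry hV)
      (lift (Fin r) ∘ fun P => half (pauliOp P.1.1) (b P)) (fun P => half (S.R i P.1) (b P))
      (fun P _ => ?_) (fun P _ => (S.isRefl i P.1).contr.half _)
      (fun P _ => hM b P) (by positivity) (ε := 74 * k ^ 2 * n ^ 2 * Real.sqrt (2 * η))
      (fun P _ => ?_)).trans ?_
    · rw [Function.comp_apply, lift_half]
      exact (isRefl_pauliOp _).lift.contr.half _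
    · rw [Function.comp_apply, lift_half]
      exact hhalf (b P) (hVP P.1)
    rw [hlen]
    generalize √(2 * η) = δ at *
    calc k * (74 * k ^ 2 * n ^ 2 * δ + 2 * (k * (35 * k ^ 2 * δ)))
        = 74 * (k ^ 3 * 1) * n ^ 2 * δ + 70 * k ^ 4 * 1 * δ := by ring
      _ ≤ 74 * (k ^ 3 * k) * n ^ 2 * δ + 70 * k ^ 4 * n ^ 2 * δ := by gcongr
      _ = 144 * k ^ 4 * n ^ 2 * δ := by ring
  rw [hρ]
  refine (povmDist_le_of_dilations i (S.dil_isometry i Q) hV (fun b => blockProj (Fin (d i)) b)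
    (fun b => lift (Fin r) (jointProj Q b)) _ (fun b => S.dil_blockProj i Q b) (fun b => ?_)
    (by positivity) (by positivity) h0 h1).trans (le_of_eq ?_)
  · rw [pullback_eq, Matrix.conjTranspose_mul, Matrix.mul_assoc, ← Matrix.mul_assoc _ _ V,
      lift_conjTranspose, ← lift_mul, jointProj_projection, ← Matrix.mul_assoc]
  · rw [hcard]
    ring

end Distances

/-! ### The projection onto the code space -/

theorem Pauli.mul_comm' (p q : Pauli) : p.mul q = q.mul p := by
  cases p <;> cases q <;> rfl

theorem gen_commute (j j' : Fin 6) : Commute (pauliOp (gen j)) (pauliOp (gen j')) := by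
  unfold Commute SemiconjBy
  rw [pauliOp_mul, pauliOp_mul]
  have h : ∏ i, (gen j i).phase (gen j' i) = ∏ i, (gen j' i).phase (gen j i) := by
    fin_cases j <;> fin_cases j' <;> simp [Fin.prod_univ_eight, gen, Pauli.phase]
  rw [h]
  simp_rw [Pauli.mul_comm' (gen j _)]

/-- The projection onto the code space as a product. -/
def codeProd : Matrix (Fin 8 → Fin 2) (Fin 8 → Fin 2) ℂ :=
  ((List.finRange 6).map fun j => half (pauliOp (gen j)) 0).prod

theorem IsRefl.mul_half {a : Type*} [Fintype a] [DecidableEq a] {A : Matrix a a ℂ}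
    (hA : IsRefl A) : A * half A 0 = half A 0 := by
  simp only [half, sgn_zero, one_smul, Matrix.mul_smul, Matrix.mul_add, Matrix.mul_one, hA.sq]
  rw [add_comm]

theorem gen_mul_codeProd (j : Fin 6) : pauliOp (gen j) * codeProd = codeProd := by
  have key : ∀ l : List (Fin 6), j ∈ l →
      pauliOp (gen j) * (l.map fun j => half (pauliOp (gen j)) 0).prod
        = (l.map fun j => half (pauliOp (gen j)) 0).prod := by
    intro l
    induction l with
    | nil => simp
    | cons j' l ih =>
      intro hj
      rw [List.map_cons, List.prod_cons]
      by_cases h : j = j'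
      · subst h
        rw [← Matrix.mul_assoc, (isRefl_pauliOp _).mul_half]
      · have hc : Commute (pauliOp (gen j)) (half (pauliOp (gen j')) 0) := by
          unfold half
          exact ((Commute.one_right _).add_right ((gen_commute j j').smul_right _)).smul_right _
        have hc' : pauliOp (gen j) * half (pauliOp (gen j')) 0
            = half (pauliOp (gen j')) 0 * pauliOp (gen j) := hc
        rw [← Matrix.mul_assoc, hc', Matrix.mul_assoc, ih (by simpa [h] using hj)]
  exact key _ (List.mem_finRange j)

theorem mem_codeSpace {v : EuclideanSpace ℂ (Fin 8 → Fin 2)} :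
    v ∈ codeSpace ↔ ∀ j, Matrix.toEuclideanLin (pauliOp (gen j)) v = v := by
  simp [codeSpace, Submodule.mem_iInf]

theorem toEuclideanLin_mul {a : Type*} [Fintype a] [DecidableEq a] (A B : Matrix a a ℂ)
    (v : EuclideanSpace ℂ a) :
    Matrix.toEuclideanLin (A * B) v = Matrix.toEuclideanLin A (Matrix.toEuclideanLin B v) := by
  simp [Matrix.toLpLin_apply]

theorem codeProd_conjTranspose_apply {w : EuclideanSpace ℂ (Fin 8 → Fin 2)} (hw : w ∈ codeSpace) :
    Matrix.toEuclideanLin codeProdᴴ w = w := by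
  have key : ∀ l : List (Fin 6), Matrix.toEuclideanLin
      ((l.map fun j => half (pauliOp (gen j)) 0).prod)ᴴ w = w := by
    intro l
    induction l with
    | nil => simp
    | cons j l ih =>
      have h1 : Matrix.toEuclideanLin (half (pauliOp (gen j)) 0) w = w := by
        have := mem_codeSpace.1 hw j
        rw [half, sgn_zero, one_smul, map_smul, map_add, LinearMap.smul_apply, LinearMap.add_apply,
          this]
        have h1 : Matrix.toEuclideanLin (1 : Matrix (Fin 8 → Fin 2) (Fin 8 → Fin 2) ℂ) w = w := by
          simp
        rw [h1]
        module
      rw [List.map_cons, List.prod_cons, Matrix.conjTranspose_mul, toEuclideanLin_mul,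
        (isRefl_pauliOp _).half_herm, h1, ih]
  exact key _

/-- The product maps into the code space because each generator fixes it, and its adjoint fixes the
code space pointwise; hence `v - codeProd v` is orthogonal to the code space. -/
theorem codeProj_eq_codeProd : codeProj = codeProd := by
  unfold codeProj
  rw [LinearEquiv.symm_apply_eq]
  ext1 v
  change codeSpace.starProjection v = _
  refine Submodule.eq_starProjection_of_mem_of_inner_eq_zero (K := codeSpace) ?_ ?_
  · rw [mem_codeSpace]
    intro j
    rw [← toEuclideanLin_mul, gen_mul_codeProd]
  · intro w hw
    rw [inner_sub_left, sub_eq_zero]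
    conv_lhs => rw [← codeProd_conjTranspose_apply hw]
    rw [Matrix.toEuclideanLin_conjTranspose_eq_adjoint, LinearMap.adjoint_inner_right]

/-! ### Operators on one octuple of qubits -/

theorem tensor_eq_list_prod {n : ℕ} {m : Fin n → Type*} [∀ t, Fintype (m t)]
    [∀ t, DecidableEq (m t)] (A : ∀ t, Matrix (m t) (m t) ℂ) :
    tensor A = ((List.finRange n).map fun t => loc t (A t)).prod := by
  have key : ∀ l : List (Fin n), l.Nodup →
      (l.map fun t => loc t (A t)).prod = tensor fun t => if t ∈ l then A t else 1 := by
    intro l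
    induction l with
    | nil => intro _; simp [tensor_one]
    | cons t l ih =>
      intro hl
      rw [List.nodup_cons] at hl
      rw [List.map_cons, List.prod_cons, ih hl.2, loc, tensor_mul]
      congr 1
      funext j
      by_cases hj : j = t
      · subst hj; simp [hl.1]
      · simp [hj]
  rw [key _ (List.nodup_finRange n)]
  simp

theorem loc_smul {ι : Type*} [Fintype ι] [DecidableEq ι] {m : ι → Type*} [∀ i, Fintype (m i)]
    [∀ i, DecidableEq (m i)] (i : ι) (c : ℂ) (A : Matrix (m i) (m i) ℂ) :
    loc i (c • A) = c • loc i A := by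
  have h : loc i (c • A) = tensor fun j => (if j = i then c else 1) •
      Function.update (fun _ => (1 : Matrix _ _ ℂ)) i A j := by
    unfold loc
    congr 1
    funext j
    by_cases hj : j = i
    · subst hj; simp
    · simp [hj]
  rw [h, tensor_smul]
  simp [loc]

section Place

variable {n : ℕ} {r : Fin 8 → ℕ}

/-- Regrouping of the qubits of the eight players into octuples. -/
def regroup (n : ℕ) (r : Fin 8 → ℕ) :
    (∀ i, (Fin n → Fin 2) × Fin (r i)) ≃ (Fin n → Fin 8 → Fin 2) × (∀ i, Fin (r i)) where
  toFun x := (fun t i => (x i).1 t, fun i => (x i).2)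
  invFun y := fun i => (fun t => y.1 t i, y.2 i)
  left_inv _ := rfl
  right_inv _ := rfl

/-- The operator that acts as `A` on the `t`-th qubits of the eight players. -/
def place (r : Fin 8 → ℕ) (t : Fin n) (A : Matrix (Fin 8 → Fin 2) (Fin 8 → Fin 2) ℂ) :
    Matrix (∀ i, (Fin n → Fin 2) × Fin (r i)) (∀ i, (Fin n → Fin 2) × Fin (r i)) ℂ :=
  (lift (∀ i, Fin (r i)) (loc (m := fun _ : Fin n => Fin 8 → Fin 2) t A)).submatrix
    (regroup n r) (regroup n r)

theorem place_one (t : Fin n) : place r t 1 = 1 := by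
  rw [place, loc_one, lift_one, Matrix.submatrix_one_equiv]

theorem place_mul (t : Fin n) (A B : Matrix (Fin 8 → Fin 2) (Fin 8 → Fin 2) ℂ) :
    place r t (A * B) = place r t A * place r t B := by
  rw [place, loc_mul (m := fun _ : Fin n => Fin 8 → Fin 2), lift_mul,
    ← Matrix.submatrix_mul_equiv _ _ _ (regroup n r)]
  rfl

theorem place_add (t : Fin n) (A B : Matrix (Fin 8 → Fin 2) (Fin 8 → Fin 2) ℂ) :
    place r t (A + B) = place r t A + place r t B := by
  rw [place, loc_add (m := fun _ : Fin n => Fin 8 → Fin 2), lift, Matrix.kronecker,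
    Matrix.add_kronecker]
  rfl

theorem place_smul (t : Fin n) (c : ℂ) (A : Matrix (Fin 8 → Fin 2) (Fin 8 → Fin 2) ℂ) :
    place r t (c • A) = c • place r t A := by
  rw [place, loc_smul (m := fun _ : Fin n => Fin 8 → Fin 2), lift, Matrix.kronecker,
    Matrix.smul_kronecker]
  rfl

theorem place_half (t : Fin n) (A : Matrix (Fin 8 → Fin 2) (Fin 8 → Fin 2) ℂ) (s : ZMod 2) :
    place r t (half A s) = half (place r t A) s := by
  rw [half, place_smul, place_add, place_one, place_smul, half]

theorem place_list_prod (t : Fin n) (l : List (Matrix (Fin 8 → Fin 2) (Fin 8 → Fin 2) ℂ)) :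
    place r t l.prod = (l.map (place r t)).prod := by
  induction l with
  | nil => simpa using place_one t
  | cons A l ih => simp only [List.prod_cons, List.map_cons, place_mul, ih]

theorem place_conjTranspose (t : Fin n) (A : Matrix (Fin 8 → Fin 2) (Fin 8 → Fin 2) ℂ) :
    (place r t A)ᴴ = place r t Aᴴ := by
  rw [place, Matrix.conjTranspose_submatrix, lift_conjTranspose,
    loc_conjTranspose (m := fun _ : Fin n => Fin 8 → Fin 2)]
  rfl

theorem IsRefl.place {A : Matrix (Fin 8 → Fin 2) (Fin 8 → Fin 2) ℂ} (hA : IsRefl A) (t : Fin n) :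
    IsRefl (place r t A) :=
  ⟨by rw [place_conjTranspose, hA.herm], by rw [← place_mul, hA.sq, place_one]⟩

/-- Here the grouping by octuples meets the grouping by players: a Pauli operator on one octuple is
a product of local operators, to which the estimates for the single players apply. -/
theorem place_pauliOp (t : Fin n) (P : Fin 8 → Pauli) :
    place r t (pauliOp P) = tensor fun i => lift (Fin (r i)) (pauliOp (at1 t (P i))) := by
  have h1 : loc (m := fun _ : Fin n => Fin 8 → Fin 2) t (pauliOp P)
      = tensor fun u : Fin n => pauliOp fun i => at1 t (P i) u := by
    unfold loc
    congr 1
    funext u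
    by_cases hu : u = t
    · subst hu; simp [at1]
    · simp only [Function.update_of_ne hu, at1, if_neg hu]
      exact pauliOp_I.symm
  ext x y
  rw [place, h1]
  simp only [Matrix.submatrix_apply, lift, Matrix.kronecker, Matrix.kroneckerMap_apply, regroup,
    Equiv.coe_fn_mk, tensor, pauliOp, Matrix.of_apply, Finset.prod_mul_distrib]
  rw [Finset.prod_comm]
  congr 1
  simp only [Matrix.one_apply]
  rw [Finset.prod_ite_zero]
  simp [funext_iff]

theorem codeProjN_eq_list_prod (n : ℕ) (r : Fin 8 → ℕ) :
    codeProjN n r = ((List.finRange n).map fun t => place r t codeProj).prod := by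
  have h1 : codeProjN n r = (lift (∀ i, Fin (r i)) (tensor fun _ : Fin n => codeProj)).submatrix
      (regroup n r) (regroup n r) := by
    ext x y
    simp [codeProjN, lift, Matrix.kronecker, regroup, tensor, Matrix.one_apply, funext_iff]
  have h2 : ∀ l : List (Matrix ((Fin n → Fin 8 → Fin 2) × (∀ i, Fin (r i)))
      ((Fin n → Fin 8 → Fin 2) × (∀ i, Fin (r i))) ℂ),
      l.prod.submatrix (regroup n r) (regroup n r)
        = (l.map fun A => A.submatrix (regroup n r) (regroup n r)).prod := by
    intro l
    induction l with
    | nil => simp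
    | cons A l ih =>
      rw [List.prod_cons, List.map_cons, List.prod_cons, ← Matrix.submatrix_mul_equiv _ _ _
        (regroup n r), ih]
  rw [h1, tensor_eq_list_prod, lift_list_prod, h2, List.map_map, List.map_map]
  rfl

theorem contr_codeProd_place (t : Fin n) : Contr (place r t codeProd) := by
  rw [codeProd, place_list_prod]
  refine contr_list_prod _ fun A hA => ?_
  simp only [List.map_map, List.mem_map, Function.comp] at hA
  obtain ⟨j, _, rfl⟩ := hA
  rw [place_half]
  exact ((isRefl_pauliOp _).place t).contr.half 0

end Place

/-- A product of contractions that almost fix `φ` almost fixes `φ`. -/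
theorem norm_list_prod_mul_sub_le {ι a E : Type*} [Fintype a] [DecidableEq a] [Fintype E]
    (l : List ι) (A : ι → Matrix a a ℂ) {φ : Matrix a E ℂ} {β : ℝ} (hA : ∀ j ∈ l, Contr (A j))
    (h : ∀ j ∈ l, ‖A j * φ - φ‖ ≤ β) : ‖(l.map A).prod * φ - φ‖ ≤ l.length * β := by
  induction l with
  | nil => simp
  | cons j l ih =>
    have h1 := ih (fun j hj => hA j (List.mem_cons_of_mem _ hj))
      fun j hj => h j (List.mem_cons_of_mem _ hj)
    have h2 := h j List.mem_cons_self
    have e : ((j :: l).map A).prod * φ - φ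
        = A j * ((l.map A).prod * φ - φ) + (A j * φ - φ) := by
      rw [List.map_cons, List.prod_cons, Matrix.mul_sub, Matrix.mul_assoc]; abel
    rw [e, List.length_cons]
    have h3 := (hA j List.mem_cons_self).norm_mul_le ((l.map A).prod * φ - φ)
    push_cast
    linarith [norm_add_le (A j * ((l.map A).prod * φ - φ)) (A j * φ - φ)]

/-- A state that is almost fixed by the generators on each octuple is almost fixed by the code
projection. -/
theorem norm_codeProjN_mul_sub_le {n : ℕ} {r : Fin 8 → ℕ} {E : Type*} [Fintype E]
    {φ : Matrix (∀ i, (Fin n → Fin 2) × Fin (r i)) E ℂ} {β : ℝ}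
    (h : ∀ (t : Fin n) (j : Fin 6), ‖place r t (pauliOp (gen j)) * φ - φ‖ ≤ β) :
    ‖codeProjN n r * φ - φ‖ ≤ n * (6 * β) := by
  rw [codeProjN_eq_list_prod, codeProj_eq_codeProd]
  have h1 : ∀ t : Fin n, ‖place r t codeProd * φ - φ‖ ≤ 6 * β := by
    intro t
    have h2 := norm_list_prod_mul_sub_le (List.finRange 6)
      (fun j => place r t (half (pauliOp (gen j)) 0)) (φ := φ) (β := β)
      (fun j _ => by rw [place_half]; exact ((isRefl_pauliOp _).place t).contr.half 0)
      (fun j _ => by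
        have e : half (place r t (pauliOp (gen j))) 0 * φ - φ
            = (1 / 2 : ℂ) • (place r t (pauliOp (gen j)) * φ - φ) := by
          rw [half, sgn_zero, one_smul, Matrix.smul_mul, Matrix.add_mul, Matrix.one_mul]
          module
        rw [place_half, e, norm_smul]
        have := h t j
        have h3 := norm_nonneg (place r t (pauliOp (gen j)) * φ - φ)
        norm_num
        linarith)
    rw [codeProd, place_list_prod, List.map_map]
    simpa [Function.comp_def] using h2
  simpa using norm_list_prod_mul_sub_le (List.finRange n) _ (fun t _ => contr_codeProd_place t)
    fun t _ => h1 t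

/-! ### The extracted state and the stabilizer of the code -/

section Code

variable {n k : ℕ} {d : Fin 8 → ℕ} {hk : 2 ≤ k} {S : Strategy n k d} {η β : ℝ}
  {ψ : Matrix (∀ i, Fin (d i)) (∀ i, Fin (d i)) ℂ} {r : Fin 8 → ℕ}
  {V : ∀ i, Matrix ((Fin n → Fin 2) × Fin (r i)) (Fin (d i)) ℂ}

theorem tensor_isometry (hV : ∀ i, (V i)ᴴ * V i = 1) : (tensor V)ᴴ * tensor V = 1 := by
  rw [tensor_conjTranspose, tensor_mul]
  simp_rw [hV]
  exact tensor_one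

theorem contr_pullback {b m : Type*} [Fintype b] [DecidableEq b] [Fintype m] [DecidableEq m]
    {s : ℕ} {U : Matrix (b × Fin s) m ℂ} (hU : Uᴴ * U = 1) {A : Matrix b b ℂ} (hA : IsRefl A) :
    Contr (pullback U A) :=
  ((contr_conjTranspose_of_isometry hU).mul hA.lift.contr).mul (contr_of_isometry hU)

/-- The elements of `Ξ` almost fix the extracted state. -/
theorem Strategy.AllNear.place_xi (h : S.AllNear hk η) (hρ : S.ρ = ψ * ψᴴ) (hψ : ‖ψ‖ = 1)
    (hV : ∀ i, (V i)ᴴ * V i = 1)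
    (hVO : ∀ i u c, ‖lift (Fin (r i)) (pauliOp (at1 u (xz c))) * V i * reshape i ψ
      - V i * S.op hk i u (xz c) * reshape i ψ‖ ≤ β) (t : Fin n) (ξ : Xi) :
    ‖place r t (sgn ξ.1.1 • pauliOp ξ.1.2) * (tensor V * ψ) - tensor V * ψ‖
      ≤ Real.sqrt (2 * (η + 8 * β)) := by
  have hφ : ‖tensor V * ψ‖ = 1 := by rw [norm_isometry_mul (tensor_isometry hV), hψ]
  have hstab := h.stab t ξ
  unfold Strategy.Near at hstab
  simp_rw [S.obs_ask] at hstab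
  rw [hρ, trace_mul_mul_conjTranspose] at hstab
  have hloc : ∀ i, ‖pullback (V i) (pauliOp (at1 t (ξ.1.2 i))) * reshape i ψ
      - S.R i (weightOne hk t (ξ.1.2 i) (ξ.ne_Y i)) * reshape i ψ‖ ≤ β := by
    intro i
    have hc : ∃ c, ξ.1.2 i = xz c := by
      rcases ξ.2.1 i with hX | hZ
      · exact ⟨false, hX⟩
      · exact ⟨true, hZ⟩
    obtain ⟨c, hc⟩ := hc
    rw [← S.op_eq hk i t (ξ.ne_Y i), hc]
    exact norm_compress_sub_le (hV i) rfl (hVO i t c)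
  -- The eight reflections are replaced one after the other by compressed honest operators. The
  -- correlation then drops from `1 - η` to no less than `1 - η - 8 * β`.
  have hT : ‖tensor (fun i => pullback (V i) (pauliOp (at1 t (ξ.1.2 i)))) * ψ
      - tensor (fun i => S.R i (weightOne hk t (ξ.1.2 i) (ξ.ne_Y i))) * ψ‖ ≤ 8 * β := by
    refine (norm_tensor_mul_sub_le (fun i => (S.isRefl i _).contr)
      (fun i => contr_pullback (hV i) (isRefl_pauliOp _)) ψ (fun _ => β) fun i => ?_).trans
      (by simp)
    rw [← norm_reshape i, reshape_sub, reshape_loc_mul, reshape_loc_mul]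
    exact hloc i
  have hG : (tensor V * ψ)ᴴ * (place r t (sgn ξ.1.1 • pauliOp ξ.1.2) * (tensor V * ψ))
      = sgn ξ.1.1 • (ψᴴ *
        (tensor (fun i => pullback (V i) (pauliOp (at1 t (ξ.1.2 i)))) * ψ)) := by
    have e : (tensor fun i => pullback (V i) (pauliOp (at1 t (ξ.1.2 i))))
        = (tensor V)ᴴ * (place r t (pauliOp ξ.1.2) * tensor V) := by
      rw [place_pauliOp, tensor_conjTranspose, tensor_mul, tensor_mul]
      congr 1
      funext i
      rw [pullback_eq, Matrix.mul_assoc]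
    rw [e, place_smul, Matrix.conjTranspose_mul]
    simp only [Matrix.smul_mul, Matrix.mul_smul, Matrix.mul_assoc]
  rw [norm_sub_rev]
  refine norm_sub_le_of_trace hφ.le ?_ ?_
  · rw [place_smul]
    exact ((((isRefl_pauliOp _).place t).contr.smul (norm_sgn _)).norm_mul_le _).trans hφ.le
  · have hcs := trace_conjTranspose_mul_re_le ψ
      (sgn ξ.1.1 • (tensor (fun i => S.R i (weightOne hk t (ξ.1.2 i) (ξ.ne_Y i))) * ψ
        - tensor (fun i => pullback (V i) (pauliOp (at1 t (ξ.1.2 i)))) * ψ))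
    rw [norm_smul, norm_sgn, hψ, one_mul, one_mul, norm_sub_rev, Matrix.mul_smul, Matrix.mul_sub,
      Matrix.trace_smul, Matrix.trace_sub, smul_eq_mul, mul_sub, Complex.sub_re] at hcs
    rw [hG, Matrix.trace_smul, smul_eq_mul]
    linarith

theorem exists_pairGen (j : Fin 6) : j = 0 ∨ j = 1 ∨ ∃ p, j = pairGen p := by
  fin_cases j
  · exact Or.inl rfl
  · exact Or.inr (Or.inl rfl)
  · exact Or.inr (Or.inr ⟨0, rfl⟩)
  · exact Or.inr (Or.inr ⟨1, rfl⟩)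
  · exact Or.inr (Or.inr ⟨2, rfl⟩)
  · exact Or.inr (Or.inr ⟨3, rfl⟩)

/-- The first two generators belong to `Ξ`. A generator `YY` does not, but its product with the
first generator does; multiplying that back costs a second error, whence the factor two. -/
theorem Strategy.AllNear.place_gen (h : S.AllNear hk η) (hρ : S.ρ = ψ * ψᴴ) (hψ : ‖ψ‖ = 1)
    (hV : ∀ i, (V i)ᴴ * V i = 1)
    (hVO : ∀ i u c, ‖lift (Fin (r i)) (pauliOp (at1 u (xz c))) * V i * reshape i ψ
      - V i * S.op hk i u (xz c) * reshape i ψ‖ ≤ β) (t : Fin n) (j : Fin 6) :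
    ‖place r t (pauliOp (gen j)) * (tensor V * ψ) - tensor V * ψ‖
      ≤ 2 * Real.sqrt (2 * (η + 8 * β)) := by
  have hs := Real.sqrt_nonneg (2 * (η + 8 * β))
  have h0 : ‖place r t (pauliOp (gen 0)) * (tensor V * ψ) - tensor V * ψ‖
      ≤ Real.sqrt (2 * (η + 8 * β)) := by
    have h1 := h.place_xi hρ hψ hV hVO t (xiConst false)
    have hg : gen 0 = fun _ => xz false := by funext i; fin_cases i <;> rfl
    simpa only [xiConst, sgn_zero, one_smul, hg] using h1
  rcases exists_pairGen j with rfl | rfl | ⟨p, rfl⟩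
  · linarith
  · have h1 := h.place_xi hρ hψ hV hVO t xiGen
    simp only [xiGen, sgn_zero, one_smul] at h1
    linarith
  · have h1 := h.place_xi hρ hψ hV hVO t (xiPairZ p)
    simp only [xiPairZ] at h1
    rw [← gen_zero_mul_pairGen, place_mul] at h1
    have hr := (isRefl_pauliOp (gen 0)).place (r := r) t
    have e : place r t (pauliOp (gen (pairGen p))) * (tensor V * ψ) - tensor V * ψ
        = place r t (pauliOp (gen 0)) * (place r t (pauliOp (gen 0)) *
            place r t (pauliOp (gen (pairGen p))) * (tensor V * ψ) - tensor V * ψ)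
          + (place r t (pauliOp (gen 0)) * (tensor V * ψ) - tensor V * ψ) := by
      generalize tensor V * ψ = φ
      rw [Matrix.mul_sub, ← Matrix.mul_assoc (place r t _) (_ * _), ← Matrix.mul_assoc, hr.sq,
        Matrix.one_mul]
      abel
    rw [e]
    have h2 := hr.contr.norm_mul_le (place r t (pauliOp (gen 0)) *
      place r t (pauliOp (gen (pairGen p))) * (tensor V * ψ) - tensor V * ψ)
    refine (norm_add_le _ _).trans ?_
    linarith

theorem Strategy.AllNear.code_extract (h : S.AllNear hk η) (hρ : S.ρ = ψ * ψᴴ) (hψ : ‖ψ‖ = 1)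
    (hV : ∀ i, (V i)ᴴ * V i = 1)
    (hVO : ∀ i u c, ‖lift (Fin (r i)) (pauliOp (at1 u (xz c))) * V i * reshape i ψ
      - V i * S.op hk i u (xz c) * reshape i ψ‖ ≤ β) :
    1 - 12 * n * Real.sqrt (2 * (η + 8 * β))
      ≤ ((codeProjN n r)ᴴ * (tensor V * S.ρ * (tensor V)ᴴ)).trace.re := by
  have hφ : ‖tensor V * ψ‖ = 1 := by rw [norm_isometry_mul (tensor_isometry hV), hψ]
  have h1 := norm_codeProjN_mul_sub_le fun t j => h.place_gen hρ hψ hV hVO t j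
  have h2 := trace_ge_of_norm_sub hφ h1
  have e : ((codeProjN n r)ᴴ * (tensor V * S.ρ * (tensor V)ᴴ)).trace
      = ((codeProjN n r * (tensor V * ψ))ᴴ * (tensor V * ψ)).trace := by
    have e1 : tensor V * S.ρ * (tensor V)ᴴ = (tensor V * ψ) * (tensor V * ψ)ᴴ := by
      rw [hρ, Matrix.conjTranspose_mul]
      simp only [Matrix.mul_assoc]
    rw [e1, trace_mul_mul_conjTranspose, Matrix.conjTranspose_mul (codeProjN n r), Matrix.mul_assoc]
  rw [e]
  linarith

end Code

/-- The bounds for all questions, in terms of a bound `8 M e⁴` for the bias. -/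
theorem Strategy.AllNear.exists_isometries {n k : ℕ} {d : Fin 8 → ℕ} {hk : 2 ≤ k}
    {S : Strategy n k d} (hn : k ≤ n) {M e : ℝ} (hM : 1 ≤ M) (he : 0 ≤ e) (he1 : e ≤ 1)
    (h : S.AllNear hk (8 * M * e ^ 4)) :
    ∃ (r : Fin 8 → ℕ) (V : ∀ i, Matrix ((Fin n → Fin 2) × Fin (r i)) (Fin (d i)) ℂ),
      (∀ i, (V i)ᴴ * V i = 1) ∧
      (∀ (i : Fin 8) (P : XZPauli n k),
        reflDist S.ρ i (S.R i P) (pullback (V i) (pauliOp P.1))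
          ≤ 2088 * 2 ^ k * k ^ 4 * M * n ^ 3 * e) ∧
      (∀ (i : Fin 8) (Q : PauliSet n k),
        povmDist S.ρ i (S.M i Q) (fun b => pullback (V i) (jointProj Q b))
          ≤ 2088 * 2 ^ k * k ^ 4 * M * n ^ 3 * e) ∧
      1 - 2088 * 2 ^ k * k ^ 4 * M * n ^ 3 * e
        ≤ ((codeProjN n r)ᴴ * (tensor V * S.ρ * (tensor V)ᴴ)).trace.re := by
  obtain ⟨ψ, hρ, hψ⟩ := S.exists_purification
  choose r V hV hVO using fun i => exists_extract (h.approxPauli hn hρ hψ i)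
  have hk1 : (1 : ℝ) ≤ k := by exact_mod_cast (by omega : 1 ≤ k)
  have hn1 : (1 : ℝ) ≤ n := by exact_mod_cast (by omega : 1 ≤ n)
  have h2k : (1 : ℝ) ≤ 2 ^ k := one_le_pow₀ (by norm_num)
  have hMM : M ≤ M ^ 2 := by nlinarith
  have hee : e ^ 2 ≤ e := by nlinarith
  -- The bias defect carries `e ^ 4` so that this root gives `e ^ 2` and the second root, taken for
  -- the code space, still gives `e`. The constant `2088 = 522 * 4` comes from the POVM bound.
  have hδ : Real.sqrt (2 * (8 * M * e ^ 4)) ≤ 4 * M * e ^ 2 := by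
    refine Real.sqrt_le_iff.2 ⟨by positivity, ?_⟩
    calc 2 * (8 * M * e ^ 4) = 16 * M * e ^ 4 := by ring
      _ ≤ 16 * M ^ 2 * e ^ 4 := by gcongr
      _ = (4 * M * e ^ 2) ^ 2 := by ring
  have hδ1 : Real.sqrt (2 * (8 * M * e ^ 4)) ≤ 4 * M * e :=
    hδ.trans (by gcongr)
  have hkp : (k : ℝ) ^ 2 ≤ k ^ 4 := pow_le_pow_right₀ hk1 (by norm_num)
  have hnp : (n : ℝ) ^ 2 ≤ n ^ 3 := pow_le_pow_right₀ hn1 (by norm_num)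
  have hVP := fun i P => h.pauli_extract hn hρ hψ i (hV i) (hVO i) P
  refine ⟨r, V, hV, fun i P => ?_, fun i Q => ?_, ?_⟩
  · have h1 := reflDist_le hψ i (S.isRefl i P) (hV i) (isRefl_pauliOp P.1) (hVP i P)
    rw [← hρ] at h1
    refine h1.trans ?_
    calc 74 * (k : ℝ) ^ 2 * n ^ 2 * Real.sqrt (2 * (8 * M * e ^ 4))
        ≤ 522 * 1 * (k : ℝ) ^ 4 * n ^ 3 * (4 * M * e) := by gcongr; norm_num
      _ ≤ 522 * 2 ^ k * (k : ℝ) ^ 4 * n ^ 3 * (4 * M * e) := by gcongr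
      _ = _ := by ring
  · refine (h.povm_extract hn hρ hψ i (hV i) (hVP i) Q).trans ?_
    calc 2 ^ k * (522 * (k : ℝ) ^ 4 * n ^ 2 * Real.sqrt (2 * (8 * M * e ^ 4)))
        ≤ 2 ^ k * (522 * (k : ℝ) ^ 4 * n ^ 3 * (4 * M * e)) := by gcongr
      _ = _ := by ring
  · refine le_trans ?_ (h.code_extract hρ hψ hV hVO)
    have hn2 : (1 : ℝ) ≤ n ^ 2 := one_le_pow₀ hn1
    -- The constant `2448 = 2 * (8 + 8 * 38 * 4)` is rounded up to the square `50 ^ 2`.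
    have hγ : Real.sqrt (2 * (8 * M * e ^ 4 +
        8 * (38 * n ^ 2 * Real.sqrt (2 * (8 * M * e ^ 4))))) ≤ 50 * (M * n ^ 2 * e) := by
      refine Real.sqrt_le_iff.2 ⟨by positivity, ?_⟩
      have he4 : e ^ 4 ≤ e ^ 2 := pow_le_pow_of_le_one he he1 (by norm_num)
      have hMn : M * n ^ 2 ≤ (M * n ^ 2) ^ 2 := by
        have : 1 ≤ M * n ^ 2 := by nlinarith
        nlinarith
      calc 2 * (8 * M * e ^ 4 + 8 * (38 * n ^ 2 * Real.sqrt (2 * (8 * M * e ^ 4))))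
          ≤ 2 * (8 * M * e ^ 2 * n ^ 2 + 8 * (38 * n ^ 2 * (4 * M * e ^ 2))) := by
            have h4 : 8 * M * e ^ 4 ≤ 8 * M * e ^ 2 * n ^ 2 := by
              calc 8 * M * e ^ 4 ≤ 8 * M * e ^ 2 * 1 := by rw [mul_one]; gcongr
                _ ≤ _ := by gcongr
            have h5 : 38 * n ^ 2 * Real.sqrt (2 * (8 * M * e ^ 4))
                ≤ 38 * n ^ 2 * (4 * M * e ^ 2) := by gcongr
            linarith
        _ = 2448 * ((M * n ^ 2) * e ^ 2) := by ring
        _ ≤ 2500 * ((M * n ^ 2) ^ 2 * e ^ 2) := by gcongr; norm_num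
        _ = _ := by ring
    have h3 : 12 * n * Real.sqrt (2 * (8 * M * e ^ 4 +
        8 * (38 * n ^ 2 * Real.sqrt (2 * (8 * M * e ^ 4)))))
        ≤ 2088 * 2 ^ k * k ^ 4 * M * n ^ 3 * e := by
      have hk4 : (1 : ℝ) ≤ k ^ 4 := one_le_pow₀ hk1
      calc _ ≤ 12 * n * (50 * (M * n ^ 2 * e)) := by gcongr
        _ = 600 * 1 * 1 * M * n ^ 3 * e := by ring
        _ ≤ _ := by gcongr; norm_num
    linarith

end StabGame

end

/-! ### Choice of the constants -/

open StabGame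

theorem mainTheorem7 (k : ℕ) (hk : 2 ≤ k) :
    ∃ κ : ℝ, 0 < κ ∧ ∃ C : ℝ, 0 < C ∧
      ∀ (n : ℕ), k ≤ n → ∀ (d : Fin 8 → ℕ) (S : Strategy n k d) (ε : ℝ), 0 ≤ ε →
        1 - ε ≤ S.value hk →
        ∃ (r : Fin 8 → ℕ) (V : ∀ i, Matrix ((Fin n → Fin 2) × Fin (r i)) (Fin (d i)) ℂ),
          (∀ i, (V i)ᴴ * V i = 1) ∧
          (∀ (i : Fin 8) (P : XZPauli n k),
            reflDist S.ρ i (S.R i P) (pullback (V i) (pauliOp P.1))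
              ≤ C * (n : ℝ) ^ κ * ε ^ (1 / κ)) ∧
          (∀ (i : Fin 8) (Q : PauliSet n k),
            povmDist S.ρ i (S.M i Q) (fun b => pullback (V i) (jointProj Q b))
              ≤ C * (n : ℝ) ^ κ * ε ^ (1 / κ)) ∧
          1 - C * (n : ℝ) ^ κ * ε ^ (1 / κ)
            ≤ ((codeProjN n r)ᴴ * (tensor V * S.ρ * (tensor V)ᴴ)).trace.re := by
  set x : ℝ := Fintype.card Xi + 1 with hx
  set a : ℕ := 2 * k + k * k with ha
  have hx1 : 1 ≤ x := by rw [hx]; linarith [Nat.cast_nonneg (α := ℝ) (Fintype.card Xi)]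
  have hk1 : (1 : ℝ) ≤ k := by exact_mod_cast (by omega : 1 ≤ k)
  have hK : 1 ≤ 8 * k * (4 * x) ^ a := by
    have : 1 ≤ (4 * x) ^ a := one_le_pow₀ (by linarith)
    nlinarith
  -- The number of questions contributes `n ^ a` and the isometry `n ^ 3`. One `κ` has to serve both
  -- exponents, so `κ ≥ a + 3` for the power of `n` and `κ ≥ 4` for the root of `ε`.
  refine ⟨a + 4, by positivity, 2088 * 2 ^ k * k ^ 4 * (8 * k * (4 * x) ^ a), by positivity, ?_⟩
  intro n hn d S ε hε hS
  have hn1 : (1 : ℝ) ≤ n := by exact_mod_cast (by omega : 1 ≤ n)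
  have hmin : 0 ≤ min ε 1 := le_min hε zero_le_one
  set e : ℝ := (min ε 1) ^ (1 / 4 : ℝ) with he
  have he0 : 0 ≤ e := Real.rpow_nonneg hmin _
  have he1 : e ≤ 1 := Real.rpow_le_one hmin (min_le_right _ _) (by norm_num)
  have he4 : e ^ 4 = min ε 1 := by
    rw [he, ← Real.rpow_natCast, ← Real.rpow_mul hmin]
    norm_num
  have hM : 1 ≤ 8 * k * (4 * x) ^ a * (n : ℝ) ^ a := by
    have : 1 ≤ (n : ℝ) ^ a := one_le_pow₀ hn1
    nlinarith
  -- As the value is nonnegative, `ε` may be cut off at one, which ensures `e ≤ 1`.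
  have hval : 1 - min ε 1 ≤ S.value hk := by
    rcases min_choice ε 1 with h | h <;> rw [h]
    · exact hS
    · simpa using S.value_nonneg hk
  have hnear := S.allNear_of_value hk hn hmin hval
  have hN : (numQuestions n k : ℝ) = 8 * k * (4 * x) ^ a * (n : ℝ) ^ a := by
    rw [numQuestions, mul_assoc _ _ ((n : ℝ) ^ a), ← mul_pow]
    push_cast
    rfl
  rw [hN, ← he4] at hnear
  obtain ⟨r, V, hV, hP, hQ, hc⟩ := hnear.exists_isometries hn hM he0 he1
  have hb : 2088 * 2 ^ k * k ^ 4 * (8 * k * (4 * x) ^ a * (n : ℝ) ^ a) * n ^ 3 * e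
      ≤ 2088 * 2 ^ k * k ^ 4 * (8 * k * (4 * x) ^ a) * (n : ℝ) ^ ((a : ℝ) + 4)
        * ε ^ (1 / ((a : ℝ) + 4)) := by
    have h1 : (n : ℝ) ^ a * n ^ 3 ≤ (n : ℝ) ^ ((a : ℝ) + 4) := by
      rw [← pow_add, ← Real.rpow_natCast]
      refine Real.rpow_le_rpow_of_exponent_le hn1 ?_
      push_cast
      linarith
    -- For a base in `[0, 1]` the smaller exponent `1 / (a + 4) ≤ 1 / 4` gives the larger power;
    -- then the cutoff is dropped.
    have h2 : e ≤ ε ^ (1 / ((a : ℝ) + 4)) := by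
      refine (Real.rpow_le_rpow_of_exponent_ge_of_imp hmin (min_le_right _ _) ?_ ?_).trans
        (Real.rpow_le_rpow hmin (min_le_left _ _) (by positivity))
      · exact one_div_le_one_div_of_le (by norm_num) (by linarith [Nat.cast_nonneg (α := ℝ) a])
      · intro _ h
        have : 0 < 1 / ((a : ℝ) + 4) := by positivity
        linarith
    calc _ = 2088 * 2 ^ k * k ^ 4 * (8 * k * (4 * x) ^ a) * ((n : ℝ) ^ a * n ^ 3) * e := by ring
      _ ≤ _ := by gcongr
  exact ⟨r, V, hV, fun i P => (hP i P).trans hb, fun i Q => (hQ i Q).trans hb, by linarith⟩
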